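/- Let $\mathbb S=\mathbb R/2\pi\mathbb Z$ and let $L^2(\mathbb S)$ carry the scalar product $\langle u,v\rangle=\int_0^{2\pi}u(\theta)\overline{v(\theta)}\,d\theta$. Let $\Lambda$ be the self-adjoint operator on $L^2(\mathbb S)$ with $\Lambda e^{in\theta}=|n|e^{in\theta}$ for $n\in\mathbb Z$. For a positive function $a\in C^\infty(\mathbb S)$ with $\int_0^{2\pi}a^{-1}(\theta)\,d\theta=2\pi$ put $\Lambda_a=a^{1/2}\Lambda a^{1/2}$ and $$\phi_n^a(\theta)=\frac1{\sqrt{2\pi a(\theta)}}\,e^{in\int_0^\theta a^{-1}(s)\,ds},\qquad n\in\mathbb Z,$$ let $P_0^a$ be the orthogonal projection onto the line spanned by $\phi_0^a=(2\pi a)^{-1/2}$, and define $\ln(\Lambda_a+P_0^a)u=\sum_\lambda \ln(\lambda)\,\Pi_\lambda u$, where $\lambda$ runs over the (positive, discrete) eigenvalues of $\Lambda_a+P_0^a$ and $\Pi_\lambda$ is the orthogonal projection onto the eigenspace of $\lambda$. Let $\varepsilon>0$ and let $\alpha_\tau$, $\tau\in[0,\varepsilon)$, be a $C^\infty$ variation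 of the constant function $\mathbf 1$: the real function $(\tau,\theta)\mapsto\alpha_\tau(\theta)$ is $C^\infty$ on $[0,\varepsilon)\times\mathbb S$, $\alpha_0=\mathbf 1$, and for every $\tau\in[0,\varepsilon)$ the function $\alpha_\tau$ is positive with $\int_0^{2\pi}\alpha_\tau^{-1}(\theta)\,d\theta=2\pi$. Write $P_{0,\tau}=P_0^{\alpha_\tau}$, $\phi_{n,\tau}=\phi_n^{\alpha_\tau}$, $\beta=\frac{\partial\alpha_\tau}{\partial\tau}\big|_{\tau=0}$ and $\hat\beta_k=\frac1{2\pi}\int_0^{2\pi}\beta(\theta)e^{-ik\theta}\,d\theta$. Let $m$ be a positive integer and $$F(\tau)=\langle\ln(\Lambda_{\alpha_\tau}+P_{0,\tau})\phi_{m,\tau},\phi_{m,\tau}\rangle,\qquad \gamma(p,m)=\frac{pm\big(2\ln(p/m)\,mp+(p+m)(m-p)\big)}{(m-p)^2(m+p)^2}\quad(p\ne m).$$ Then the series that defines $\ln(\Lambda_{\alpha_\tau}+P_{0,\tau})\phi_{m,\tau}$ converges in $L^2(\mathbb S)$ for every $\tau\in[0,\varepsilon)$, the series $\sum_{p>0,\,p\ne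 m}\gamma(p,m)|\hat\beta_{m+p}|^2$ (over integers $p$) converges, $F$ is differentiable near $0$ and twice differentiable at $0$ (all derivatives at $0$ being one-sided, from the right), and $$F'(0)=0,\qquad F''(0)=4\sum_{p>0,\;p\ne m}\gamma(p,m)\,|\hat\beta_{m+p}|^2.$$ Moreover $$F(\tau)=\ln m+2\tau^2\sum_{p>0,\;p\neq m}\gamma(p,m)\,|\hat\beta_{m+p}|^2+o(\tau^2)\qquad\text{as }\tau\to0^+ .$$ -/

import Mathlib

open MeasureTheory Filter Topology Asymptotics
open scoped ContDiff ENNReal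

noncomputable section

namespace SteklovLog

instance two_pi_fact : Fact (0 < 2 * Real.pi) := ⟨Real.two_pi_pos⟩

/-- The unit circle, parametrized by the angle `θ` modulo `2π`. -/
abbrev Circ : Type := AddCircle (2 * Real.pi)

/-- The Hilbert space `L²` of the circle, for the arc length measure `dθ` of total mass `2π`. -/
abbrev L2 : Type := Lp ℂ 2 (volume : Measure Circ)

/-- A continuous function as an element of `L²`. -/
def toL2 (f : C(Circ, ℂ)) : L2 := ContinuousMap.toLp 2 volume ℂ f

/-- The scalar product `⟨u, v⟩ = ∫ u(θ) conj(v(θ)) dθ`, linear in `u` and conjugate linear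
in `v`. -/
def pairing (u v : L2) : ℂ := inner ℂ v u

/-- The bounded operator on `L²` of multiplication by a continuous function. -/
def mulOp (b : C(Circ, ℂ)) : L2 →L[ℂ] L2 :=
  (ContinuousLinearMap.mul ℂ ℂ).holderL volume ∞ 2 2 (ContinuousMap.toLp ∞ volume ℂ b)

theorem coeFn_mulOp (b : C(Circ, ℂ)) (u : L2) :
    (mulOp b u : Circ → ℂ) =ᵐ[volume] fun x => b x * u x := by
  have h1 := ContinuousLinearMap.coeFn_holder (r := 2) (ContinuousLinearMap.mul ℂ ℂ)
    (ContinuousMap.toLp (E := ℂ) ∞ (volume : Measure Circ) ℂ b) u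
  have h2 := ContinuousMap.coeFn_toLp (p := ∞) (𝕜 := ℂ) (volume : Measure Circ) b
  filter_upwards [h1, h2] with x hx1 hx2
  simp only [mulOp, ContinuousLinearMap.holderL_apply_apply]
  rw [hx1, hx2]
  rfl

/-- The smooth positive functions `a` on the circle with `∫ a⁻¹ dθ = 2π`. -/
structure Weight where
  toFun : Circ → ℝ
  smooth : ContDiff ℝ ∞ fun θ : ℝ => toFun (θ : Circ)
  pos : ∀ x, 0 < toFun x
  normalized : ∫ θ in (0 : ℝ)..(2 * Real.pi), (toFun (θ : Circ))⁻¹ = 2 * Real.pi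

instance : CoeFun Weight fun _ => Circ → ℝ := ⟨Weight.toFun⟩

theorem Weight.continuous (a : Weight) : Continuous (a : Circ → ℝ) :=
  (isQuotientMap_quotient_mk'.continuous_iff).2 a.smooth.continuous

theorem Weight.continuous_inv (a : Weight) : Continuous fun θ : ℝ => (a (θ : Circ))⁻¹ :=
  a.smooth.continuous.inv₀ fun _ => (a.pos _).ne'

/-- The function `a^{1/2}`. -/
def Weight.sqrtMap (a : Weight) : C(Circ, ℂ) where
  toFun x := ((Real.sqrt (a x) : ℝ) : ℂ)
  continuous_toFun := Complex.continuous_ofReal.comp (Real.continuous_sqrt.comp a.continuous)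

/-- The function `a^{-1/2}`. -/
def Weight.invSqrtMap (a : Weight) : C(Circ, ℂ) where
  toFun x := (((Real.sqrt (a x))⁻¹ : ℝ) : ℂ)
  continuous_toFun := Complex.continuous_ofReal.comp
    ((Real.continuous_sqrt.comp a.continuous).inv₀ fun x => (Real.sqrt_pos.2 (a.pos x)).ne')

theorem Weight.mulOp_invSqrt_sqrt (a : Weight) (u : L2) :
    mulOp a.invSqrtMap (mulOp a.sqrtMap u) = u := by
  apply Lp.ext
  filter_upwards [coeFn_mulOp a.invSqrtMap (mulOp a.sqrtMap u), coeFn_mulOp a.sqrtMap u]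
    with x h1 h2
  have h : (Real.sqrt (a x) : ℂ) ≠ 0 := by
    exact_mod_cast (Real.sqrt_pos.2 (a.pos x)).ne'
  rw [h1, h2]
  simp [Weight.invSqrtMap, Weight.sqrtMap, h]

theorem Weight.mulOp_sqrt_invSqrt (a : Weight) (u : L2) :
    mulOp a.sqrtMap (mulOp a.invSqrtMap u) = u := by
  apply Lp.ext
  filter_upwards [coeFn_mulOp a.sqrtMap (mulOp a.invSqrtMap u), coeFn_mulOp a.invSqrtMap u]
    with x h1 h2
  have h : (Real.sqrt (a x) : ℂ) ≠ 0 := by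
    exact_mod_cast (Real.sqrt_pos.2 (a.pos x)).ne'
  rw [h1, h2]
  simp [Weight.invSqrtMap, Weight.sqrtMap, h]

/-- The function `θ ↦ (2πa(θ))^{-1/2} exp(i n ∫₀^θ a⁻¹(s) ds)` on the real line. -/
def Weight.phiReal (a : Weight) (n : ℤ) (θ : ℝ) : ℂ :=
  (((Real.sqrt (2 * Real.pi * a (θ : Circ)))⁻¹ : ℝ) : ℂ) *
    Complex.exp (Complex.I * n * ((∫ s in (0 : ℝ)..θ, (a (s : Circ))⁻¹ : ℝ) : ℂ))

theorem Weight.phiReal_periodic (a : Weight) (n : ℤ) :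
    Function.Periodic (a.phiReal n) (2 * Real.pi) := by
  intro θ
  have hper : Function.Periodic (fun s : ℝ => (a (s : Circ))⁻¹) (2 * Real.pi) := by
    intro s
    simp only [AddCircle.coe_add_period]
  have hint : ∀ s t : ℝ, IntervalIntegrable (fun s : ℝ => (a (s : Circ))⁻¹) volume s t :=
    fun s t => a.continuous_inv.intervalIntegrable s t
  have h := hper.intervalIntegral_add_eq_add 0 θ hint
  simp only [zero_add] at h
  rw [a.normalized] at h
  unfold Weight.phiReal
  rw [AddCircle.coe_add_period]
  rw [h]
  congr 1
  rw [Complex.exp_eq_exp_iff_exists_int]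
  refine ⟨n, ?_⟩
  push_cast
  ring

theorem Weight.phiReal_continuous (a : Weight) (n : ℤ) : Continuous (a.phiReal n) := by
  unfold Weight.phiReal
  refine Continuous.mul ?_ ?_
  · refine Complex.continuous_ofReal.comp (Continuous.inv₀ ?_ ?_)
    · exact Real.continuous_sqrt.comp (continuous_const.mul a.smooth.continuous)
    · intro θ
      exact (Real.sqrt_pos.2 (mul_pos Real.two_pi_pos (a.pos _))).ne'
  · refine Complex.continuous_exp.comp (continuous_const.mul (Complex.continuous_ofReal.comp ?_))
    exact intervalIntegral.continuous_primitive
      (fun s t => a.continuous_inv.intervalIntegrable s t) 0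

/-- The function `φ_n` on the circle. -/
def Weight.phiMap (a : Weight) (n : ℤ) : C(Circ, ℂ) where
  toFun := (a.phiReal_periodic n).lift
  continuous_toFun := continuous_quot_lift _ (a.phiReal_continuous n)

/-- `φ_n` as an element of `L²`. -/
def Weight.phi (a : Weight) (n : ℤ) : L2 := toL2 (a.phiMap n)

/-- `w = Λ u`, where `Λ` is the self-adjoint operator on `L²` with `Λ e^{inθ} = |n| e^{inθ}`
(the Dirichlet-to-Neumann operator of the unit disk). The existence of such a `w` in `L²` says
that `u` is in the domain of `Λ`. -/
def IsLambda (u w : L2) : Prop :=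
  ∀ n : ℤ, pairing w (toL2 (fourier n)) = (|n| : ℤ) * pairing u (toL2 (fourier n))

/-- `v = Λ_a u`, where `Λ_a = a^{1/2} Λ a^{1/2}`. -/
def Weight.IsSteklov (a : Weight) (u v : L2) : Prop :=
  ∃ w : L2, IsLambda (mulOp a.sqrtMap u) w ∧ v = mulOp a.sqrtMap w

/-- The orthogonal projection `P₀` onto the line spanned by `φ₀ = (2πa)^{-1/2}`. -/
def Weight.P0 (a : Weight) : L2 →L[ℂ] L2 := (Submodule.span ℂ {a.phi 0}).starProjection

/-- The eigenspace of `Λ_a + P₀` for the real number `lam` (zero unless `lam` is an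
eigenvalue). -/
def Weight.eigenspace (a : Weight) (lam : ℝ) : Submodule ℂ L2 where
  carrier := {u | ∃ v : L2, a.IsSteklov u v ∧ v + a.P0 u = (lam : ℂ) • u}
  zero_mem' := ⟨0, ⟨0, by intro n; simp [pairing], by simp⟩, by simp⟩
  add_mem' := by
    rintro u₁ u₂ ⟨v₁, ⟨w₁, h₁, rfl⟩, e₁⟩ ⟨v₂, ⟨w₂, h₂, rfl⟩, e₂⟩
    refine ⟨_, ⟨w₁ + w₂, ?_, rfl⟩, ?_⟩
    · intro n
      have k₁ := h₁ n
      have k₂ := h₂ n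
      simp only [pairing, map_add, inner_add_right] at *
      rw [k₁, k₂, mul_add]
    · rw [smul_add, ← e₁, ← e₂, map_add, map_add]
      abel
  smul_mem' := by
    rintro c u ⟨v, ⟨w, h, rfl⟩, e⟩
    refine ⟨_, ⟨c • w, ?_, rfl⟩, ?_⟩
    · intro n
      have := h n
      simp only [pairing, map_smul, inner_smul_right] at *
      rw [this]
      ring
    · rw [smul_comm, ← e, map_smul, map_smul, smul_add]

theorem Weight.mem_eigenspace (a : Weight) (lam : ℝ) (u : L2) :
    u ∈ a.eigenspace lam ↔ ∃ v : L2, a.IsSteklov u v ∧ v + a.P0 u = (lam : ℂ) • u := Iff.rfl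

theorem Weight.isClosed_eigenspace (a : Weight) (lam : ℝ) :
    IsClosed (a.eigenspace lam : Set L2) := by
  have key : (a.eigenspace lam : Set L2) = ⋂ n : ℤ, {u : L2 |
      pairing (mulOp a.invSqrtMap ((lam : ℂ) • u - a.P0 u)) (toL2 (fourier n)) =
        (|n| : ℤ) * pairing (mulOp a.sqrtMap u) (toL2 (fourier n))} := by
    ext u
    simp only [SetLike.mem_coe, a.mem_eigenspace, Set.mem_iInter, Set.mem_ofPred_eq]
    constructor
    · rintro ⟨v, ⟨w, hw, rfl⟩, e⟩ n
      rw [← e, add_sub_cancel_right, a.mulOp_invSqrt_sqrt]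
      exact hw n
    · intro h
      exact ⟨_, ⟨_, h, rfl⟩, by rw [a.mulOp_sqrt_invSqrt, sub_add_cancel]⟩
  rw [key]
  refine isClosed_iInter fun n => isClosed_eq ?_ ?_
  · unfold pairing
    fun_prop
  · unfold pairing
    fun_prop

instance Weight.completeSpace_eigenspace (a : Weight) (lam : ℝ) :
    CompleteSpace (a.eigenspace lam) :=
  (a.isClosed_eigenspace lam).isComplete.completeSpace_coe

/-- The term of `ln(Λ_a + P₀) u` that belongs to `lam`: `ln(lam)` times the orthogonal projection
of `u` onto the eigenspace of `lam`. -/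
def Weight.lnTerm (a : Weight) (u : L2) (lam : ℝ) : L2 :=
  (Real.log lam : ℂ) • (a.eigenspace lam).starProjection u

/-- `ln(Λ_a + P₀) u = ∑ ln(λ) Π_λ u`, the sum running over the eigenvalues `λ` of `Λ_a + P₀`, with
`Π_λ` the orthogonal projection onto the eigenspace of `λ`; for every orthonormal basis `ψ_k` of
eigenvectors this is `∑ ln(λ_k) ⟨u, ψ_k⟩ ψ_k`. (The real numbers that are not eigenvalues
contribute `0`.) -/
def Weight.lnOp (a : Weight) (u : L2) : L2 := ∑' lam : ℝ, a.lnTerm u lam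

/-- `⟨ln(Λ_a + P₀) φ_m, φ_m⟩`. -/
def Weight.lnDiag (a : Weight) (m : ℤ) : ℂ := pairing (a.lnOp (a.phi m)) (a.phi m)

/-- `α_τ`, `τ ∈ [0, ε)`, is a `C^∞` variation of the constant function `1`. Positivity and
normalization of `α_τ` are part of `Weight`; the values for `τ` outside `[0, ε)` are
irrelevant. -/
structure IsVariationOfOne (ε : ℝ) (α : ℝ → Weight) : Prop where
  eps_pos : 0 < ε
  smooth : ContDiffOn ℝ ∞ (fun q : ℝ × ℝ => α q.1 (q.2 : Circ)) (Set.Ico 0 ε ×ˢ Set.univ)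
  initial : ∀ x, α 0 x = 1

/-- `β = ∂α_τ/∂τ` at `τ = 0` (a one-sided derivative). -/
def velocity (α : ℝ → Weight) (x : Circ) : ℝ :=
  derivWithin (fun τ => α τ x) (Set.Ici 0) 0

/-- `β̂_k = (2π)⁻¹ ∫ β(θ) e^{-ikθ} dθ`. -/
def velocityCoeff (α : ℝ → Weight) (k : ℤ) : ℂ :=
  fourierCoeff (fun x : Circ => (velocity α x : ℂ)) k

/-- `γ(p, m)`. -/
def gammaCoeff (p m : ℕ) : ℝ :=
  (p * m * (2 * Real.log (p / m) * m * p + (p + m) * ((m : ℝ) - p))) /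
    (((m : ℝ) - p) ^ 2 * ((m : ℝ) + p) ^ 2)

/-- The term `γ(p, m) |β̂_{m+p}|²`, indexed by the integers `p > 0` with `p ≠ m`. -/
def secondTerm (α : ℝ → Weight) (m : ℕ) (p : {p : ℕ // 0 < p ∧ p ≠ m}) : ℝ :=
  gammaCoeff p m * ‖velocityCoeff α ((m : ℤ) + (p : ℕ))‖ ^ 2

end SteklovLog

end

/-! In the basis `φ_n` the operator `Λ_a + P₀` is `D + R`, where `D = diag(d)` with `d_0 = 1` (the
contribution of `P₀`) and `d_n = |n|` otherwise. The theorem is second order perturbation theory for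
`ln(D + R)` at the eigenvector `e_m` of `D`.

The matrix. Put `t(θ) = ∫₀^θ a⁻¹` and `c(n, j) = (2π)⁻¹ ∫ e^{i(n t + jθ)} dθ`. By Parseval, `⟨Λ_a
φ_n, φ_k⟩ = ∑_j |j| c(n, -j) conj c(k, -j)`, and the same sum with `j` in place of `|j|` is `n
δ_{kn}`. For `n > 0` the difference of the two involves only `c(n, j)` with `j > 0`, whose phase has
no stationary point because `t' > 0`; for `n < 0` the sum of the two plays this role. These
coefficients decay rapidly, so `R` is a bounded operator that depends smoothly on a parameter
(`IsSmoothLoop.exists_pert`).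

The logarithm. The formula `ln λ = ln m + (λ - m) ∫₀¹ (m + t(λ - m))⁻¹ dt` passes to `D + R`. As `(D
+ R - m) e_m = R e_m`, it gives `⟨ln(D + R) e_m, e_m⟩ = ln m + m⁻¹ ∫₀¹ ⟨(1 + R Q_t)⁻¹ R e_m, e_m⟩
dt` with `Q_t = t (m + t(D - m))⁻¹` (`Weight.HasPert.lnDiag_eq`). This is smooth in `R` for `‖R‖ <
1` (`contDiffAt_logEntry`) and equals `ln m + m⁻¹ (R_{mm} - ∫₀¹ ⟨Q_t R e_m, R e_m⟩ dt) + O(‖R‖³)`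
(`logEntry_expansion`).

The coefficient. To first order `c(m, p)` is `τ m/(m + p)` times a Fourier coefficient of `β` of
modulus `|β̂_{m+p}|`. To first order `R e_m` has only the entries `2p c(m, p)` at the places `-p`,
while `R_{mm}` is already of second order, namely `∑ 2p |c(m, p)|²`. So `F` has no first order term,
and the two second order contributions combine to `γ(p, m)`; they cancel for `p = m`
(`expansion_term`).

The boundary point. The substitution `τ = δ sin² σ` turns the one-sided variation into a family on
the whole line that is smooth, periodic and even. Periodicity makes all constants uniform by
compactness, and evenness gives `R = O(σ²)`. Then `F(τ) = G(σ)` with `G` smooth and `G - ln m` of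
order `σ⁴`; smoothness allows this expansion to be differentiated, and changing back to `τ` gives
both derivatives of `F`.

The convergence of the logarithm series for every `τ` is separate: it follows from a positive lower
bound for the spectrum (`Weight.summable_lnTerm`). -/

noncomputable section

namespace SteklovLog

/-! ### Calculus -/

theorem hasFDerivAt_parametric_intervalIntegral {E F : Type} [NormedAddCommGroup E]
    [NormedSpace ℝ E] [FiniteDimensional ℝ E] [NormedAddCommGroup F] [NormedSpace ℝ F]
    {f : E × ℝ → F} (hf : ContDiff ℝ 1 f) (a b : ℝ) (x₀ : E) :
    HasFDerivAt (fun x => ∫ s in a..b, f (x, s))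
      (∫ s in a..b, (fderiv ℝ f (x₀, s)).comp (ContinuousLinearMap.inl ℝ E ℝ)) x₀ := by
  have hcont : Continuous fun q : E × ℝ =>
      (fderiv ℝ f q).comp (ContinuousLinearMap.inl ℝ E ℝ) :=
    (hf.continuous_fderiv one_ne_zero).clm_comp continuous_const
  have : ProperSpace E := FiniteDimensional.proper ℝ E
  obtain ⟨C, hC⟩ := ((isCompact_closedBall x₀ 1).prod
    (isCompact_uIcc (a := a) (b := b))).exists_bound_of_continuousOn hcont.continuousOn
  refine intervalIntegral.hasFDerivAt_integral_of_dominated_of_fderiv_le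
    (F := fun x s => f (x, s))
    (F' := fun x s => (fderiv ℝ f (x, s)).comp (ContinuousLinearMap.inl ℝ E ℝ))
    (bound := fun _ => C) (Metric.ball_mem_nhds x₀ one_pos) ?_ ?_ ?_ ?_ ?_ ?_
  · exact Eventually.of_forall fun x =>
      (hf.continuous.comp (by fun_prop : Continuous fun s : ℝ => (x, s))).aestronglyMeasurable
  · exact (hf.continuous.comp
      (by fun_prop : Continuous fun s : ℝ => (x₀, s))).intervalIntegrable _ _
  · exact (hcont.comp (by fun_prop : Continuous fun s : ℝ => (x₀, s))).aestronglyMeasurable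
  · exact Eventually.of_forall fun s hs x hx =>
      hC (x, s) ⟨Metric.ball_subset_closedBall hx, Set.uIoc_subset_uIcc hs⟩
  · exact intervalIntegrable_const
  · refine Eventually.of_forall fun s _ x _ => ?_
    have h1 : HasFDerivAt f (fderiv ℝ f (x, s)) (x, s) :=
      (hf.differentiable one_ne_zero _).hasFDerivAt
    have h2 : HasFDerivAt (fun y : E => (y, s)) (ContinuousLinearMap.inl ℝ E ℝ) x :=
      (hasFDerivAt_id x).prodMk (hasFDerivAt_const s x)
    exact h1.comp x h2

/-- The target `F` is quantified inside the induction because the derivative is again a parametric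
integral, with values in `E →L[ℝ] F`. -/
theorem contDiff_parametric_intervalIntegral_nat {E : Type} [NormedAddCommGroup E]
    [NormedSpace ℝ E] [FiniteDimensional ℝ E] (a b : ℝ) (n : ℕ) :
    ∀ {F : Type} [NormedAddCommGroup F] [NormedSpace ℝ F] {f : E × ℝ → F},
      ContDiff ℝ n f → ContDiff ℝ n fun x => ∫ s in a..b, f (x, s) := by
  induction n with
  | zero =>
    intro F _ _ f hf
    rw [Nat.cast_zero, contDiff_zero] at *
    exact intervalIntegral.continuous_parametric_intervalIntegral_of_continuous'
      (f := fun x s => f (x, s)) hf a b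
  | succ n ih =>
    intro F _ _ f hf
    have h1 : ContDiff ℝ 1 f := hf.of_le (by exact_mod_cast Nat.le_add_left 1 n)
    have hd := hasFDerivAt_parametric_intervalIntegral h1 a b
    push_cast
    rw [contDiff_succ_iff_fderiv]
    refine ⟨fun x => (hd x).differentiableAt, by simp, ?_⟩
    have : fderiv ℝ (fun x => ∫ s in a..b, f (x, s)) = fun x => ∫ s in a..b,
        (fderiv ℝ f (x, s)).comp (ContinuousLinearMap.inl ℝ E ℝ) := funext fun x => (hd x).fderiv
    rw [this]
    refine ih (f := fun q => (fderiv ℝ f q).comp (ContinuousLinearMap.inl ℝ E ℝ)) ?_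
    exact (hf.fderiv_right (m := n) (by push_cast; rfl)).clm_comp contDiff_const

theorem contDiff_parametric_intervalIntegral {E F : Type} [NormedAddCommGroup E]
    [NormedSpace ℝ E] [FiniteDimensional ℝ E] [NormedAddCommGroup F] [NormedSpace ℝ F]
    {f : E × ℝ → F} (hf : ContDiff ℝ ∞ f) (a b : ℝ) :
    ContDiff ℝ ∞ fun x => ∫ s in a..b, f (x, s) :=
  contDiff_infty.2 fun n => contDiff_parametric_intervalIntegral_nat a b n (contDiff_infty.1 hf n)

/-- A polynomial of degree at most `N` that is `o(x ^ N)` at `0` has no nonzero coefficient. -/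
theorem coeff_eq_zero_of_isLittleO {E : Type*} [NormedAddCommGroup E] [NormedSpace ℝ E] (N : ℕ) :
    ∀ c : ℕ → E, (fun x : ℝ => ∑ i ∈ Finset.range (N + 1), x ^ i • c i) =o[𝓝[≠] 0]
      (fun x : ℝ => x ^ N) → ∀ i ≤ N, c i = 0 := by
  induction N with
  | zero =>
    intro c h i hi
    obtain rfl : i = 0 := by omega
    simpa using h
  | succ N ih =>
    intro c h
    have h0 : c 0 = 0 := by
      have h1 : Tendsto (fun x : ℝ => ∑ i ∈ Finset.range (N + 1 + 1), x ^ i • c i) (𝓝[≠] 0)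
          (𝓝 0) := by
        refine h.trans_tendsto ?_
        have : Tendsto (fun x : ℝ => x ^ (N + 1)) (𝓝 0) (𝓝 (0 ^ (N + 1))) :=
          (continuous_pow _).tendsto 0
        rw [zero_pow (by omega)] at this
        exact this.mono_left nhdsWithin_le_nhds
      have h2 : Tendsto (fun x : ℝ => ∑ i ∈ Finset.range (N + 1 + 1), x ^ i • c i) (𝓝[≠] 0)
          (𝓝 (∑ i ∈ Finset.range (N + 1 + 1), (0 : ℝ) ^ i • c i)) := by
        refine Tendsto.mono_left ?_ nhdsWithin_le_nhds
        exact (by fun_prop : Continuous fun x : ℝ =>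
          ∑ i ∈ Finset.range (N + 1 + 1), x ^ i • c i).tendsto 0
      have h3 := tendsto_nhds_unique h1 h2
      rw [Finset.sum_range_succ'] at h3
      simpa using h3.symm
    have h4 : (fun x : ℝ => ∑ i ∈ Finset.range (N + 1), x ^ i • c (i + 1)) =o[𝓝[≠] 0]
        (fun x : ℝ => x ^ N) := by
      have h5 := (isBigO_refl (fun x : ℝ => x⁻¹) (𝓝[≠] 0)).smul_isLittleO h
      refine h5.congr' ?_ ?_
      · filter_upwards [self_mem_nhdsWithin] with x hx
        rw [Finset.sum_range_succ', h0, smul_zero, add_zero, Finset.smul_sum]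
        refine Finset.sum_congr rfl fun i _ => ?_
        rw [smul_smul, pow_succ', ← mul_assoc, inv_mul_cancel₀ hx, one_mul]
      · filter_upwards [self_mem_nhdsWithin] with x hx
        rw [smul_eq_mul, pow_succ', ← mul_assoc, inv_mul_cancel₀ hx, one_mul]
    intro i hi
    cases i with
    | zero => exact h0
    | succ i => exact ih _ h4 i (by omega)

/-- A smooth function that is `o(x ^ (n + 1))` at `0` has a derivative that is `o(x ^ n)`. -/
theorem deriv_isLittleO_of_isLittleO {E : Type*} [NormedAddCommGroup E] [NormedSpace ℝ E]
    {f : ℝ → E} {n : ℕ} {r : ℝ} (hr : 0 < r) (hf : ContDiffOn ℝ (n + 1 : ℕ) f (Set.Ioo (-r) r))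
    (ho : f =o[𝓝 0] fun x : ℝ => x ^ (n + 1)) : deriv f =o[𝓝 0] fun x : ℝ => x ^ n := by
  set s := Set.Ioo (-r) r with hs
  have h0 : (0 : ℝ) ∈ s := ⟨by linarith, hr⟩
  have hsn : s ∈ 𝓝 (0 : ℝ) := isOpen_Ioo.mem_nhds h0
  have hnhds : 𝓝[s] (0 : ℝ) = 𝓝 0 := isOpen_Ioo.nhdsWithin_eq h0
  have ht := taylor_isLittleO (convex_Ioo (-r) r) h0 hf
  rw [← hs, hnhds] at ht
  simp only [sub_zero] at ht
  have hp := ho.sub ht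
  -- The Taylor polynomial of degree `n + 1` is a difference of two functions that are `o(x ^ (n +
  -- 1))`, so all its coefficients vanish.
  have hz : ∀ i ≤ n + 1, ((i.factorial : ℝ)⁻¹) • iteratedDerivWithin i f s 0 = 0 := by
    refine coeff_eq_zero_of_isLittleO (n + 1) _ ((hp.mono nhdsWithin_le_nhds).congr_left ?_)
    intro x
    rw [sub_sub_cancel, taylor_within_apply]
    refine Finset.sum_congr rfl fun i _ => ?_
    rw [smul_smul, sub_zero, mul_comm]
  have hzero : ∀ i ≤ n + 1, iteratedDerivWithin i f s 0 = 0 := fun i hi =>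
    (smul_eq_zero.1 (hz i hi)).resolve_left (by positivity)
  have hd : ContDiffOn ℝ n (derivWithin f s) s :=
    hf.derivWithin isOpen_Ioo.uniqueDiffOn (by push_cast; rfl)
  have ht' := taylor_isLittleO (convex_Ioo (-r) r) h0 hd
  rw [← hs, hnhds] at ht'
  -- The coefficients of the Taylor polynomial of the derivative are among those just shown to
  -- vanish, so the derivative is its own Taylor remainder.
  refine ht'.congr' ?_ (by simp)
  filter_upwards [hsn] with x hx
  rw [derivWithin_of_isOpen isOpen_Ioo hx, taylor_within_apply, sub_eq_self]
  refine Finset.sum_eq_zero fun i hi => ?_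
  rw [← iteratedDerivWithin_succ', hzero _ (by simpa using hi), smul_zero]

theorem deriv_zero_of_even {E : Type*} [NormedAddCommGroup E] [NormedSpace ℝ E] {f : ℝ → E}
    (he : ∀ x, f (-x) = f x) : deriv f 0 = 0 := by
  have h1 : deriv (fun x => f (-x)) 0 = deriv f 0 := by simp_rw [he]
  rw [deriv_comp_neg, neg_zero] at h1
  have h2 : (2 : ℝ) • deriv f 0 = 0 := by
    rw [two_smul]; nth_rewrite 1 [← h1]; simp
  exact (smul_eq_zero.1 h2).resolve_left two_ne_zero

/-- Second order bound for a twice differentiable even function that vanishes at `0`. -/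
theorem norm_le_sq_of_even {E : Type*} [NormedAddCommGroup E] [NormedSpace ℝ E] {f : ℝ → E}
    (hf : ContDiff ℝ 2 f) (he : ∀ x, f (-x) = f x) (h0 : f 0 = 0) {C : ℝ}
    (hC : ∀ x, ‖iteratedDeriv 2 f x‖ ≤ C) (x : ℝ) : ‖f x‖ ≤ C * x ^ 2 := by
  have hC' : ∀ x, ‖deriv (deriv f) x‖ ≤ C := by
    intro x; have := hC x; rwa [iteratedDeriv_succ, iteratedDeriv_one] at this
  have hd : ContDiff ℝ 1 (deriv f) := by
    have : ContDiff ℝ (1 + 1) f := by convert hf using 1; norm_num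
    exact (contDiff_succ_iff_deriv.1 this).2.2
  have h1 : ∀ y, ‖deriv f y‖ ≤ C * |y| := by
    intro y
    have := Convex.norm_image_sub_le_of_norm_deriv_le (s := Set.univ) (x := (0 : ℝ)) (y := y)
      (fun z _ => hd.differentiable one_ne_zero z) (fun z _ => hC' z) convex_univ trivial trivial
    simpa [deriv_zero_of_even he] using this
  have hC0 : 0 ≤ C := (norm_nonneg _).trans (hC 0)
  have h2 := Convex.norm_image_sub_le_of_norm_deriv_le (s := Set.Icc (-|x|) |x|) (x := (0 : ℝ))
    (y := x) (C := C * |x|) (fun z _ => hf.differentiable two_ne_zero z)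
    (fun z hz => (h1 z).trans (mul_le_mul_of_nonneg_left (abs_le.2 hz) hC0)) (convex_Icc _ _)
    ⟨by simp, abs_nonneg x⟩ ⟨neg_abs_le x, le_abs_self x⟩
  rw [h0, sub_zero, sub_zero, Real.norm_eq_abs, mul_assoc, ← sq, sq_abs] at h2
  exact h2

/-- Second order limit of a twice differentiable even function that vanishes at `0`. -/
theorem tendsto_inv_sq_smul_of_even {E : Type*} [NormedAddCommGroup E] [NormedSpace ℝ E]
    {f : ℝ → E} (hf : ContDiff ℝ 2 f) (he : ∀ x, f (-x) = f x) (h0 : f 0 = 0) :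
    ∃ v : E, Tendsto (fun x : ℝ => (x ^ 2)⁻¹ • f x) (𝓝[≠] 0) (𝓝 v) := by
  refine ⟨(2 : ℝ)⁻¹ • iteratedDeriv 2 f 0, ?_⟩
  have h := taylor_tendsto (n := 2) convex_univ (Set.mem_univ (0 : ℝ))
    (by exact_mod_cast hf.contDiffOn)
  rw [nhdsWithin_univ] at h
  have h' := (h.mono_left (nhdsWithin_le_nhds (s := {0}ᶜ))).add_const
    ((2 : ℝ)⁻¹ • iteratedDeriv 2 f 0)
  rw [zero_add] at h'
  refine h'.congr' ?_
  filter_upwards [self_mem_nhdsWithin] with x hx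
  have hx : x ≠ 0 := hx
  rw [taylor_within_apply]
  simp [Finset.sum_range_succ, h0, iteratedDerivWithin_univ, iteratedDeriv_one,
    deriv_zero_of_even he, smul_sub, smul_smul]
  field_simp
  simp

/-! ### Oscillatory integrals -/

/-- Generators of the period lattice of `ℝ³`. -/
def periodVectors : Set (ℝ × ℝ × ℝ) :=
  {(2 * Real.pi, 0, 0), (0, 2 * Real.pi, 0), (0, 0, 2 * Real.pi)}

/-- Smooth functions on `ℝ³` that are `2π`-periodic in each variable. -/
structure TorusSmooth (h : ℝ × ℝ × ℝ → ℂ) : Prop where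
  smooth : ContDiff ℝ ∞ h
  periodic : ∀ w ∈ periodVectors, ∀ q, h (q + w) = h q

/-- The derivative of `h` in the direction `v`. -/
def dirDeriv (v : ℝ × ℝ × ℝ) (h : ℝ × ℝ × ℝ → ℂ) (q : ℝ × ℝ × ℝ) : ℂ := fderiv ℝ h q v

theorem TorusSmooth.dirDeriv {h : ℝ × ℝ × ℝ → ℂ} (hh : TorusSmooth h) (v : ℝ × ℝ × ℝ) :
    TorusSmooth (dirDeriv v h) where
  smooth := (hh.smooth.fderiv_right (m := ∞) (by simp)).clm_apply contDiff_const
  periodic w hw q := by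
    have h1 : (fun q => h (q + w)) = h := funext (hh.periodic w hw)
    have h2 := fderiv_comp_add_right (𝕜 := ℝ) (f := h) (x := q) w
    rw [h1] at h2
    simp only [SteklovLog.dirDeriv, h2]

theorem TorusSmooth.mul {h g : ℝ × ℝ × ℝ → ℂ} (hh : TorusSmooth h) (hg : TorusSmooth g) :
    TorusSmooth fun q => h q * g q where
  smooth := hh.smooth.mul hg.smooth
  periodic w hw q := by rw [hh.periodic w hw, hg.periodic w hw]

/-- Closure under such quotients is what allows integration by parts to be repeated. -/
theorem TorusSmooth.div {h g : ℝ × ℝ × ℝ → ℂ} (hh : TorusSmooth h) (hg : TorusSmooth g)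
    (h0 : ∀ q, g q ≠ 0) : TorusSmooth fun q => h q / g q where
  smooth := by
    simp_rw [div_eq_mul_inv]
    exact hh.smooth.mul (hg.smooth.inv h0)
  periodic w hw q := by rw [hh.periodic w hw, hg.periodic w hw]

theorem torusSmooth_one : TorusSmooth fun _ => 1 := ⟨contDiff_const, fun _ _ _ => rfl⟩

/-- Periodicity reduces the bound to a compact cube. The uniformity in `r`, `σ`, `θ` of the later
constants comes from here. -/
theorem TorusSmooth.bounded {h : ℝ × ℝ × ℝ → ℂ} (hh : TorusSmooth h) :
    ∃ C, 0 ≤ C ∧ ∀ q, ‖h q‖ ≤ C := by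
  obtain ⟨C, hC⟩ := ((isCompact_Icc (a := (0 : ℝ)) (b := 2 * Real.pi)).prod
    ((isCompact_Icc (a := (0 : ℝ)) (b := 2 * Real.pi)).prod
      (isCompact_Icc (a := (0 : ℝ)) (b := 2 * Real.pi)))).exists_bound_of_continuousOn
    hh.smooth.continuous.continuousOn
  refine ⟨C, (norm_nonneg _).trans (hC (0, 0, 0) ?_), ?_⟩
  · simp [Real.pi_pos.le]
  rintro ⟨x, y, z⟩
  have p1 : ∀ y z, Function.Periodic (fun x => h (x, y, z)) (2 * Real.pi) := fun y z x => by
    simpa using hh.periodic (2 * Real.pi, 0, 0) (by simp [periodVectors]) (x, y, z)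
  have p2 : ∀ x z, Function.Periodic (fun y => h (x, y, z)) (2 * Real.pi) := fun x z y => by
    simpa using hh.periodic (0, 2 * Real.pi, 0) (by simp [periodVectors]) (x, y, z)
  have p3 : ∀ x y, Function.Periodic (fun z => h (x, y, z)) (2 * Real.pi) := fun x y z => by
    simpa using hh.periodic (0, 0, 2 * Real.pi) (by simp [periodVectors]) (x, y, z)
  obtain ⟨x', hx', ex⟩ := (p1 y z).exists_mem_Ico₀ Real.two_pi_pos x
  obtain ⟨y', hy', ey⟩ := (p2 x' z).exists_mem_Ico₀ Real.two_pi_pos y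
  obtain ⟨z', hzero, ez⟩ := (p3 x' y').exists_mem_Ico₀ Real.two_pi_pos z
  rw [ex, ey, ez]
  exact hC _ ⟨Set.Ico_subset_Icc_self hx', Set.Ico_subset_Icc_self hy',
    Set.Ico_subset_Icc_self hzero⟩

/-- A smooth family, periodic in the first variable, of lifts to the real line of orientation
preserving diffeomorphisms of the circle. -/
structure IsPhase (t : ℝ × ℝ → ℝ) : Prop where
  smooth : ContDiff ℝ ∞ t
  periodic : ∀ σ θ, t (σ + 2 * Real.pi, θ) = t (σ, θ)
  add_two_pi : ∀ σ θ, t (σ, θ + 2 * Real.pi) = t (σ, θ) + 2 * Real.pi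
  deriv_pos : ∀ q, 0 < fderiv ℝ t q (0, 1)

variable {t : ℝ × ℝ → ℝ}

/-- A translation by a period changes `t` by a constant only, so its derivative is periodic although
`t` is not. -/
theorem IsPhase.torusSmooth_fderiv (ht : IsPhase t) (v : ℝ × ℝ) :
    TorusSmooth fun q => ((fderiv ℝ t q.2 v : ℝ) : ℂ) where
  smooth := by
    have h1 : ContDiff ℝ ∞ fun q : ℝ × ℝ => fderiv ℝ t q v :=
      (ht.smooth.fderiv_right (m := ∞) (by simp)).clm_apply contDiff_const
    exact Complex.ofRealCLM.contDiff.comp (h1.comp contDiff_snd)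
  periodic w hw q := by
    have key : ∀ u : ℝ × ℝ, (∃ c : ℝ, ∀ p, t (p + u) = t p + c) → ∀ p,
        fderiv ℝ t (p + u) = fderiv ℝ t p := by
      rintro u ⟨c, hc⟩ p
      rw [← fderiv_comp_add_right (𝕜 := ℝ) (f := t) (x := p) u, funext hc, fderiv_add_const]
    rcases hw with rfl | rfl | rfl
    · rw [Prod.snd_add, key _ ⟨0, fun p => by simp [Prod.mk_zero_zero]⟩]
    · rw [Prod.snd_add, key _ ⟨0, fun ⟨x, y⟩ => by simpa using ht.periodic x y⟩]
    · rw [Prod.snd_add, key _ ⟨2 * Real.pi, fun ⟨x, y⟩ => by simpa using ht.add_two_pi x y⟩]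

/-- The integral `∫ h e^{i(n t + j θ)} dθ` over a period. -/
def oscIntegral (t : ℝ × ℝ → ℝ) (h : ℝ × ℝ × ℝ → ℂ) (n j : ℤ) (r σ : ℝ) : ℂ :=
  ∫ θ in (0 : ℝ)..(2 * Real.pi),
    h (r, σ, θ) * Complex.exp (Complex.I * (n * (t (σ, θ) : ℂ) + j * (θ : ℂ)))

theorem IsPhase.contDiff_integrand (ht : IsPhase t) {h : ℝ × ℝ × ℝ → ℂ} (hh : TorusSmooth h)
    (n j : ℤ) (r : ℝ) : ContDiff ℝ ∞ fun p : ℝ × ℝ =>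
      h (r, p.1, p.2) * Complex.exp (Complex.I * (n * (t p : ℂ) + j * (p.2 : ℂ))) := by
  have h1 : ContDiff ℝ ∞ fun p : ℝ × ℝ => (t p : ℂ) := Complex.ofRealCLM.contDiff.comp ht.smooth
  have h2 : ContDiff ℝ ∞ fun p : ℝ × ℝ => (p.2 : ℂ) :=
    Complex.ofRealCLM.contDiff.comp contDiff_snd
  have h3 : ContDiff ℝ ∞ fun p : ℝ × ℝ => h (r, p.1, p.2) :=
    hh.smooth.comp (by fun_prop : ContDiff ℝ ∞ fun p : ℝ × ℝ => (r, p.1, p.2))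
  exact h3.mul (Complex.contDiff_exp.comp
    (contDiff_const.mul ((contDiff_const.mul h1).add (contDiff_const.mul h2))))

theorem IsPhase.contDiff_oscIntegral (ht : IsPhase t) {h : ℝ × ℝ × ℝ → ℂ} (hh : TorusSmooth h)
    (n j : ℤ) (r : ℝ) : ContDiff ℝ ∞ (oscIntegral t h n j r) :=
  contDiff_parametric_intervalIntegral (ht.contDiff_integrand hh n j r) _ _

theorem IsPhase.fderiv_integrand (ht : IsPhase t) {h : ℝ × ℝ × ℝ → ℂ} (hh : TorusSmooth h)
    (n j : ℤ) (r : ℝ) (p v : ℝ × ℝ) :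
    fderiv ℝ (fun p : ℝ × ℝ => h (r, p.1, p.2) *
      Complex.exp (Complex.I * (n * (t p : ℂ) + j * (p.2 : ℂ)))) p v =
    (dirDeriv (0, v) h (r, p) + Complex.I * (h (r, p) *
      (n * ((fderiv ℝ t p v : ℝ) : ℂ) + j * (v.2 : ℂ)))) *
      Complex.exp (Complex.I * (n * (t p : ℂ) + j * (p.2 : ℂ))) := by
  have d1 : HasFDerivAt (fun p : ℝ × ℝ => (t p : ℂ)) (Complex.ofRealCLM.comp (fderiv ℝ t p)) p :=
    Complex.ofRealCLM.hasFDerivAt.comp p (ht.smooth.differentiable (by simp) p).hasFDerivAt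
  have d2 : HasFDerivAt (fun p : ℝ × ℝ => (p.2 : ℂ))
      (Complex.ofRealCLM.comp (ContinuousLinearMap.snd ℝ ℝ ℝ)) p :=
    Complex.ofRealCLM.hasFDerivAt.comp p hasFDerivAt_snd
  have d3 : HasFDerivAt (fun p : ℝ × ℝ => h (r, p.1, p.2))
      ((fderiv ℝ h (r, p)).comp (ContinuousLinearMap.inr ℝ ℝ (ℝ × ℝ))) p := by
    have e1 : HasFDerivAt (fun p : ℝ × ℝ => (r, p)) (ContinuousLinearMap.inr ℝ ℝ (ℝ × ℝ)) p :=
      (hasFDerivAt_const r p).prodMk (hasFDerivAt_id p)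
    exact (hh.smooth.differentiable (by simp) (r, p)).hasFDerivAt.comp p e1
  have d4 := ((d1.const_mul (n : ℂ)).add (d2.const_mul (j : ℂ))).const_mul Complex.I
  have d5 := d3.mul d4.cexp
  have d6 : fderiv ℝ (fun p : ℝ × ℝ => h (r, p.1, p.2) *
      Complex.exp (Complex.I * (n * (t p : ℂ) + j * (p.2 : ℂ)))) p = _ := d5.fderiv
  rw [d6]
  simp [dirDeriv]
  ring

theorem IsPhase.deriv_oscIntegral (ht : IsPhase t) {h : ℝ × ℝ × ℝ → ℂ} (hh : TorusSmooth h)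
    (n j : ℤ) (r : ℝ) : deriv (oscIntegral t h n j r) =
      oscIntegral t (dirDeriv (0, 1, 0) h) n j r + fun σ => Complex.I * n *
        oscIntegral t (fun q => h q * ((fderiv ℝ t q.2 (1, 0) : ℝ) : ℂ)) n j r σ := by
  funext σ
  have hc := ht.contDiff_integrand hh n j r
  have h1 : ContDiff ℝ 1 _ := hc.of_le (by simp)
  have h2 := (hasFDerivAt_parametric_intervalIntegral h1 0 (2 * Real.pi) σ).hasDerivAt
  have h3 : deriv (oscIntegral t h n j r) σ = _ := h2.deriv
  rw [h3, ContinuousLinearMap.intervalIntegral_apply]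
  · simp only [ContinuousLinearMap.coe_comp, Function.comp_apply,
      ContinuousLinearMap.inl_apply, ht.fderiv_integrand hh, Pi.add_apply, oscIntegral]
    rw [← intervalIntegral.integral_const_mul, ← intervalIntegral.integral_add]
    · refine intervalIntegral.integral_congr fun θ _ => ?_
      simp only [Complex.ofReal_zero, mul_zero, add_zero]
      ring
    · exact ((ht.contDiff_integrand (hh.dirDeriv (0, 1, 0)) n j r).continuous.comp
        (by fun_prop : Continuous fun θ : ℝ => (σ, θ))).intervalIntegrable _ _
    · exact (((ht.contDiff_integrand (hh.mul (ht.torusSmooth_fderiv (1, 0)))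
        n j r).continuous.comp
        (by fun_prop : Continuous fun θ : ℝ => (σ, θ))).const_mul _).intervalIntegrable _ _
  · refine Continuous.intervalIntegrable ?_ _ _
    exact ((h1.continuous_fderiv one_ne_zero).comp
      (by fun_prop : Continuous fun θ : ℝ => (σ, θ))).clm_comp continuous_const

/-- Integration by parts over a period. -/
theorem IsPhase.oscIntegral_by_parts (ht : IsPhase t) {h : ℝ × ℝ × ℝ → ℂ} (hh : TorusSmooth h)
    (n j : ℤ) (r σ : ℝ) :
    oscIntegral t (fun q => h q * (n * ((fderiv ℝ t q.2 (0, 1) : ℝ) : ℂ) + j)) n j r σ =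
      Complex.I * oscIntegral t (dirDeriv (0, 0, 1) h) n j r σ := by
  have hc := ht.contDiff_integrand hh n j r
  set u : ℝ × ℝ → ℂ := fun p => h (r, p.1, p.2) *
    Complex.exp (Complex.I * (n * (t p : ℂ) + j * (p.2 : ℂ))) with hu
  have hd : ∀ θ : ℝ, HasDerivAt (fun θ => u (σ, θ)) (fderiv ℝ u (σ, θ) (0, 1)) θ := by
    intro θ
    have e1 : HasDerivAt (fun θ : ℝ => (σ, θ)) (0, 1) θ :=
      (hasDerivAt_const θ σ).prodMk (hasDerivAt_id θ)
    exact ((hc.differentiable (by simp) (σ, θ)).hasFDerivAt).comp_hasDerivAt θ e1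
  have hcont : Continuous fun θ : ℝ => fderiv ℝ u (σ, θ) (0, 1) :=
    ((hc.continuous_fderiv (by simp)).comp
      (by fun_prop : Continuous fun θ : ℝ => (σ, θ))).clm_apply continuous_const
  have hIntegral := intervalIntegral.integral_eq_sub_of_hasDerivAt (a := 0) (b := 2 * Real.pi)
    (fun θ _ => hd θ) (hcont.intervalIntegrable _ _)
  have hper : u (σ, 2 * Real.pi) = u (σ, 0) := by
    have e1 := hh.periodic (0, 0, 2 * Real.pi) (by simp [periodVectors]) (r, σ, 0)
    have e2 := ht.add_two_pi σ 0
    simp only [Prod.mk_add_mk, add_zero, zero_add] at e1 e2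
    simp only [hu, e1, e2]
    congr 1
    rw [Complex.exp_eq_exp_iff_exists_int]
    refine ⟨n + j, ?_⟩
    push_cast
    ring
  rw [hper, sub_self] at hIntegral
  simp only [hu, ht.fderiv_integrand hh] at hIntegral
  have i1 : IntervalIntegrable (fun θ : ℝ => dirDeriv (0, 0, 1) h (r, σ, θ) *
      Complex.exp (Complex.I * (n * (t (σ, θ) : ℂ) + j * (θ : ℂ)))) volume 0 (2 * Real.pi) :=
    ((ht.contDiff_integrand (hh.dirDeriv (0, 0, 1)) n j r).continuous.comp
        (by fun_prop : Continuous fun θ : ℝ => (σ, θ))).intervalIntegrable _ _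
  have c2 : Continuous fun θ : ℝ => h (r, σ, θ) *
      (n * ((fderiv ℝ t (σ, θ) (0, 1) : ℝ) : ℂ) + j) *
      Complex.exp (Complex.I * (n * (t (σ, θ) : ℂ) + j * (θ : ℂ))) := by
    have k1 : Continuous fun θ : ℝ => h (r, σ, θ) := hh.smooth.continuous.comp (by fun_prop)
    have k2 : Continuous fun θ : ℝ => ((fderiv ℝ t (σ, θ) (0, 1) : ℝ) : ℂ) :=
      (ht.torusSmooth_fderiv (0, 1)).smooth.continuous.comp
        (by fun_prop : Continuous fun θ : ℝ => (r, σ, θ))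
    have k3 : Continuous fun θ : ℝ => (t (σ, θ) : ℂ) :=
      Complex.continuous_ofReal.comp (ht.smooth.continuous.comp (by fun_prop))
    exact (k1.mul ((continuous_const.mul k2).add continuous_const)).mul (Complex.continuous_exp.comp
      (continuous_const.mul ((continuous_const.mul k3).add
        (continuous_const.mul Complex.continuous_ofReal))))
  have e3 : oscIntegral t (dirDeriv (0, 0, 1) h) n j r σ + Complex.I * oscIntegral t
      (fun q => h q * (n * ((fderiv ℝ t q.2 (0, 1) : ℝ) : ℂ) + j)) n j r σ = 0 := by
    rw [oscIntegral, oscIntegral, ← intervalIntegral.integral_const_mul,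
      ← intervalIntegral.integral_add i1 ((c2.const_mul _).intervalIntegrable _ _), ← hIntegral]
    refine intervalIntegral.integral_congr fun θ _ => ?_
    simp only [Complex.ofReal_one, mul_one]
    ring
  linear_combination (-Complex.I) * e3 + oscIntegral t
    (fun q => h q * (n * ((fderiv ℝ t q.2 (0, 1) : ℝ) : ℂ) + j)) n j r σ * Complex.I_mul_I

/-! ### Size of the oscillatory integrals and of their derivatives in the parameter. -/

theorem norm_oscIntegral_le {h : ℝ × ℝ × ℝ → ℂ} {C : ℝ} (hC : ∀ q, ‖h q‖ ≤ C) (n j : ℤ)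
    (r σ : ℝ) : ‖oscIntegral t h n j r σ‖ ≤ C * (2 * Real.pi) := by
  have := intervalIntegral.norm_integral_le_of_norm_le_const (a := 0) (b := 2 * Real.pi)
    (C := C) (f := fun θ : ℝ => h (r, σ, θ) *
      Complex.exp (Complex.I * (n * (t (σ, θ) : ℂ) + j * (θ : ℂ)))) fun θ _ => by
    rw [norm_mul]
    have : Complex.I * (n * (t (σ, θ) : ℂ) + j * (θ : ℂ)) =
      ((n * t (σ, θ) + j * θ : ℝ) : ℂ) * Complex.I := by push_cast; ring
    rw [this, Complex.norm_exp_ofReal_mul_I, mul_one]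
    exact hC _
  rwa [sub_zero, abs_of_pos Real.two_pi_pos] at this

/-- Decay of the integrals whose phase has no stationary points. -/
theorem IsPhase.oscIntegral_decay (ht : IsPhase t) (M : ℕ) :
    ∀ {h : ℝ × ℝ × ℝ → ℂ}, TorusSmooth h → ∃ C, ∀ (n j : ℤ) (N r σ : ℝ), 0 ≤ N →
      (n : ℝ) = N * Real.sin r ^ 2 → (j : ℝ) = N * Real.cos r ^ 2 →
      ‖oscIntegral t h n j r σ‖ * N ^ M ≤ C := by
  induction M with
  | zero =>
    intro h hh
    obtain ⟨C, -, hC⟩ := hh.bounded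
    exact ⟨C * (2 * Real.pi), fun n j N r σ _ _ _ => by
      simpa using norm_oscIntegral_le hC n j r σ⟩
  | succ M ih =>
    intro h hh
    -- The `θ`-derivative of the phase is `N g`, so integrating `h / g` by parts gains a factor `N`.
    -- Since the ratio of `n` and `j` is encoded in the periodic variable `r`, both `g` and `1 / g`
    -- are smooth on the torus and the constants do not depend on `n` and `j`.
    set g : ℝ × ℝ × ℝ → ℂ := fun q =>
      ((Real.sin q.1 ^ 2 * fderiv ℝ t q.2 (0, 1) + Real.cos q.1 ^ 2 : ℝ) : ℂ) with hgdef
    have hg : TorusSmooth g := by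
      have h1 := ht.torusSmooth_fderiv (0, 1)
      refine ⟨?_, fun w hw q => ?_⟩
      · have s1 : ContDiff ℝ ∞ fun q : ℝ × ℝ × ℝ => ((Real.sin q.1 : ℝ) : ℂ) :=
          Complex.ofRealCLM.contDiff.comp (Real.contDiff_sin.comp contDiff_fst)
        have s2 : ContDiff ℝ ∞ fun q : ℝ × ℝ × ℝ => ((Real.cos q.1 : ℝ) : ℂ) :=
          Complex.ofRealCLM.contDiff.comp (Real.contDiff_cos.comp contDiff_fst)
        have := ((s1.pow 2).mul h1.smooth).add (s2.pow 2)
        have e : g = fun q => ((Real.sin q.1 : ℝ) : ℂ) ^ 2 * ((fderiv ℝ t q.2 (0, 1) : ℝ) : ℂ) +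
            ((Real.cos q.1 : ℝ) : ℂ) ^ 2 := by
          funext q
          simp [hgdef]
        rw [e]
        exact this
      · have h2 := h1.periodic w hw q
        simp only [Complex.ofReal_inj] at h2
        simp only [hgdef, h2]
        rcases hw with rfl | rfl | rfl <;> simp [Real.sin_add_two_pi, Real.cos_add_two_pi]
    have hg0 : ∀ q, g q ≠ 0 := by
      intro q
      have h1 := ht.deriv_pos q.2
      have h2 := Real.sin_sq_add_cos_sq q.1
      have : 0 < Real.sin q.1 ^ 2 * fderiv ℝ t q.2 (0, 1) + Real.cos q.1 ^ 2 := by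
        rcases (sq_nonneg (Real.sin q.1)).eq_or_lt with h | h
        · rw [← h] at h2 ⊢; linarith
        · have := sq_nonneg (Real.cos q.1); positivity
      exact Complex.ofReal_ne_zero.2 this.ne'
    have hdiv := hh.div hg hg0
    obtain ⟨C, hC⟩ := ih (hdiv.dirDeriv (0, 0, 1))
    refine ⟨C, fun n j N r σ hN hn hj => ?_⟩
    have h1 := ht.oscIntegral_by_parts hdiv n j r σ
    have h2 : oscIntegral t (fun q => h q / g q *
        (n * ((fderiv ℝ t q.2 (0, 1) : ℝ) : ℂ) + j)) n j r σ =
        N * oscIntegral t h n j r σ := by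
      rw [oscIntegral, oscIntegral, ← intervalIntegral.integral_const_mul]
      refine intervalIntegral.integral_congr fun θ _ => ?_
      have h3 : (n * ((fderiv ℝ t (σ, θ) (0, 1) : ℝ) : ℂ) + j) = N * g (r, σ, θ) := by
        have e1 : (n : ℂ) = ((n : ℝ) : ℂ) := by push_cast; rfl
        have e2 : (j : ℂ) = ((j : ℝ) : ℂ) := by push_cast; rfl
        rw [e1, e2, hn, hj]
        simp only [hgdef]
        push_cast
        ring
      simp only [h3]
      have := hg0 (r, σ, θ)
      field_simp
    rw [h2] at h1
    have h4 := congrArg norm h1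
    rw [norm_mul, norm_mul, Complex.norm_I, one_mul, Complex.norm_real, Real.norm_of_nonneg hN]
      at h4
    calc ‖oscIntegral t h n j r σ‖ * N ^ (M + 1)
        = (N * ‖oscIntegral t h n j r σ‖) * N ^ M := by ring
      _ ≤ C := by rw [h4]; exact hC n j N r σ hN hn hj

theorem IsPhase.iteratedDeriv_oscIntegral_succ (ht : IsPhase t) {h : ℝ × ℝ × ℝ → ℂ}
    (hh : TorusSmooth h) (n j : ℤ) (r : ℝ) (i : ℕ) (σ : ℝ) :
    iteratedDeriv (i + 1) (oscIntegral t h n j r) σ =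
      iteratedDeriv i (oscIntegral t (dirDeriv (0, 1, 0) h) n j r) σ +
      Complex.I * n * iteratedDeriv i (oscIntegral t
        (fun q => h q * ((fderiv ℝ t q.2 (1, 0) : ℝ) : ℂ)) n j r) σ := by
  rw [iteratedDeriv_succ', ht.deriv_oscIntegral hh]
  have c1 := ht.contDiff_oscIntegral (hh.dirDeriv (0, 1, 0)) n j r
  have c2 := ht.contDiff_oscIntegral (hh.mul (ht.torusSmooth_fderiv (1, 0))) n j r
  rw [iteratedDeriv_add (c1.contDiffAt.of_le (by exact_mod_cast le_top))
    ((contDiff_const.mul c2).contDiffAt.of_le (by exact_mod_cast le_top)),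
    iteratedDeriv_const_mul_field]

/-- Each derivative in `σ` brings down a factor proportional to `n`, and `|n| ≤ N`. It costs one
power of `N`, which is why the induction runs over all `M` at once. -/
theorem IsPhase.iteratedDeriv_oscIntegral_decay (ht : IsPhase t) (i : ℕ) :
    ∀ (M : ℕ) {h : ℝ × ℝ × ℝ → ℂ}, TorusSmooth h → ∃ C, ∀ (n j : ℤ) (N r σ : ℝ), 0 ≤ N →
      (n : ℝ) = N * Real.sin r ^ 2 → (j : ℝ) = N * Real.cos r ^ 2 →
      ‖iteratedDeriv i (oscIntegral t h n j r) σ‖ * N ^ M ≤ C := by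
  induction i with
  | zero =>
    intro M h hh
    simpa using ht.oscIntegral_decay M hh
  | succ i ih =>
    intro M h hh
    obtain ⟨C1, hC1⟩ := ih M (hh.dirDeriv (0, 1, 0))
    obtain ⟨C2, hC2⟩ := ih (M + 1) (hh.mul (ht.torusSmooth_fderiv (1, 0)))
    refine ⟨C1 + C2, fun n j N r σ hN hn hj => ?_⟩
    have hn' : |(n : ℝ)| ≤ N := by
      rw [hn, abs_of_nonneg (by positivity)]
      exact mul_le_of_le_one_right hN (Real.sin_sq_le_one r)
    rw [ht.iteratedDeriv_oscIntegral_succ hh]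
    have h1 := hC1 n j N r σ hN hn hj
    have h2 := hC2 n j N r σ hN hn hj
    set A := iteratedDeriv i (oscIntegral t (dirDeriv (0, 1, 0) h) n j r) σ
    set B := iteratedDeriv i (oscIntegral t
        (fun q => h q * ((fderiv ℝ t q.2 (1, 0) : ℝ) : ℂ)) n j r) σ
    have h3 : ‖Complex.I * n * B‖ ≤ N * ‖B‖ := by
      rw [norm_mul, norm_mul, Complex.norm_I, one_mul, Complex.norm_intCast]
      gcongr
    calc ‖A + Complex.I * n * B‖ * N ^ M ≤ (‖A‖ + N * ‖B‖) * N ^ M := by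
          gcongr
          exact (norm_add_le _ _).trans (add_le_add le_rfl h3)
      _ = ‖A‖ * N ^ M + ‖B‖ * N ^ (M + 1) := by ring
      _ ≤ C1 + C2 := add_le_add h1 h2

/-- Here `n` and `j` have arbitrary signs and the phase may be stationary. Dividing by `∂t/∂θ` alone
and integrating by parts trades each power of `|n|` for one of `1 + |j|`. -/
theorem IsPhase.oscIntegral_growth (ht : IsPhase t) (M : ℕ) :
    ∀ {h : ℝ × ℝ × ℝ → ℂ}, TorusSmooth h → ∃ C, 0 ≤ C ∧ ∀ (n j : ℤ) (r σ : ℝ),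
      ‖oscIntegral t h n j r σ‖ * |(n : ℝ)| ^ M ≤ C * (1 + |(j : ℝ)|) ^ M := by
  induction M with
  | zero =>
    intro h hh
    obtain ⟨C, hC0, hC⟩ := hh.bounded
    exact ⟨C * (2 * Real.pi), by positivity, fun n j r σ => by
      simpa using norm_oscIntegral_le hC n j r σ⟩
  | succ M ih =>
    intro h hh
    have hg := ht.torusSmooth_fderiv (0, 1)
    have hg0 : ∀ q : ℝ × ℝ × ℝ, ((fderiv ℝ t q.2 (0, 1) : ℝ) : ℂ) ≠ 0 := fun q =>
      Complex.ofReal_ne_zero.2 (ht.deriv_pos q.2).ne'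
    have hdiv := hh.div hg hg0
    obtain ⟨C1, hC10, hC1⟩ := ih (hdiv.dirDeriv (0, 0, 1))
    obtain ⟨C2, hC20, hC2⟩ := ih hdiv
    refine ⟨C1 + C2, by positivity, fun n j r σ => ?_⟩
    have h1 := ht.oscIntegral_by_parts hdiv n j r σ
    have h2 : oscIntegral t (fun q => h q / ((fderiv ℝ t q.2 (0, 1) : ℝ) : ℂ) *
        (n * ((fderiv ℝ t q.2 (0, 1) : ℝ) : ℂ) + j)) n j r σ =
        n * oscIntegral t h n j r σ + j * oscIntegral t
          (fun q => h q / ((fderiv ℝ t q.2 (0, 1) : ℝ) : ℂ)) n j r σ := by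
      rw [oscIntegral, oscIntegral, oscIntegral, ← intervalIntegral.integral_const_mul,
        ← intervalIntegral.integral_const_mul, ← intervalIntegral.integral_add]
      · refine intervalIntegral.integral_congr fun θ _ => ?_
        have := hg0 (r, σ, θ)
        field_simp
      · exact (((ht.contDiff_integrand hh n j r).continuous.comp
          (by fun_prop : Continuous fun θ : ℝ => (σ, θ))).const_mul _).intervalIntegrable _ _
      · exact (((ht.contDiff_integrand hdiv n j r).continuous.comp
          (by fun_prop : Continuous fun θ : ℝ => (σ, θ))).const_mul _).intervalIntegrable _ _
    rw [h2] at h1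
    have h3 := hC1 n j r σ
    have h4 := hC2 n j r σ
    set A := oscIntegral t (dirDeriv (0, 0, 1)
      fun q => h q / ((fderiv ℝ t q.2 (0, 1) : ℝ) : ℂ)) n j r σ
    set B := oscIntegral t (fun q => h q / ((fderiv ℝ t q.2 (0, 1) : ℝ) : ℂ)) n j r σ
    have h5 : |(n : ℝ)| * ‖oscIntegral t h n j r σ‖ ≤ ‖A‖ + |(j : ℝ)| * ‖B‖ := by
      have e : (n : ℂ) * oscIntegral t h n j r σ = Complex.I * A - j * B := by
        linear_combination h1
      have := congrArg norm e
      rw [norm_mul, Complex.norm_intCast] at this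
      rw [this]
      refine (norm_sub_le _ _).trans ?_
      simp [Complex.norm_intCast]
    have hj1 : (1 : ℝ) ≤ 1 + |(j : ℝ)| := by simp
    calc ‖oscIntegral t h n j r σ‖ * |(n : ℝ)| ^ (M + 1)
        = (|(n : ℝ)| * ‖oscIntegral t h n j r σ‖) * |(n : ℝ)| ^ M := by ring
      _ ≤ (‖A‖ + |(j : ℝ)| * ‖B‖) * |(n : ℝ)| ^ M := by gcongr
      _ = ‖A‖ * |(n : ℝ)| ^ M + |(j : ℝ)| * (‖B‖ * |(n : ℝ)| ^ M) := by ring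
      _ ≤ C1 * (1 + |(j : ℝ)|) ^ M + |(j : ℝ)| * (C2 * (1 + |(j : ℝ)|) ^ M) := by gcongr
      _ ≤ C1 * (1 + |(j : ℝ)|) ^ (M + 1) + (1 + |(j : ℝ)|) * (C2 * (1 + |(j : ℝ)|) ^ M) := by
        gcongr
        · omega
        · linarith
      _ = (C1 + C2) * (1 + |(j : ℝ)|) ^ (M + 1) := by ring

theorem IsPhase.iteratedDeriv_oscIntegral_growth (ht : IsPhase t) (i : ℕ) :
    ∀ (M : ℕ) {h : ℝ × ℝ × ℝ → ℂ}, TorusSmooth h → ∃ C, 0 ≤ C ∧ ∀ (n j : ℤ) (r σ : ℝ),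
      ‖iteratedDeriv i (oscIntegral t h n j r) σ‖ * |(n : ℝ)| ^ M ≤
        C * (1 + |(j : ℝ)|) ^ (M + i) := by
  induction i with
  | zero =>
    intro M h hh
    simpa using ht.oscIntegral_growth M hh
  | succ i ih =>
    intro M h hh
    obtain ⟨C1, hC10, hC1⟩ := ih M (hh.dirDeriv (0, 1, 0))
    obtain ⟨C2, hC20, hC2⟩ := ih (M + 1) (hh.mul (ht.torusSmooth_fderiv (1, 0)))
    refine ⟨C1 + C2, by positivity, fun n j r σ => ?_⟩
    rw [ht.iteratedDeriv_oscIntegral_succ hh]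
    have h1 := hC1 n j r σ
    have h2 := hC2 n j r σ
    set A := iteratedDeriv i (oscIntegral t (dirDeriv (0, 1, 0) h) n j r) σ
    set B := iteratedDeriv i (oscIntegral t
        (fun q => h q * ((fderiv ℝ t q.2 (1, 0) : ℝ) : ℂ)) n j r) σ
    have h3 : ‖Complex.I * n * B‖ = |(n : ℝ)| * ‖B‖ := by
      rw [norm_mul, norm_mul, Complex.norm_I, one_mul, Complex.norm_intCast]
    have hj1 : (1 : ℝ) ≤ 1 + |(j : ℝ)| := by simp
    calc ‖A + Complex.I * n * B‖ * |(n : ℝ)| ^ M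
        ≤ (‖A‖ + |(n : ℝ)| * ‖B‖) * |(n : ℝ)| ^ M := by
          gcongr
          exact (norm_add_le _ _).trans (add_le_add le_rfl h3.le)
      _ = ‖A‖ * |(n : ℝ)| ^ M + ‖B‖ * |(n : ℝ)| ^ (M + 1) := by ring
      _ ≤ C1 * (1 + |(j : ℝ)|) ^ (M + i) + C2 * (1 + |(j : ℝ)|) ^ (M + 1 + i) :=
        add_le_add h1 h2
      _ ≤ C1 * (1 + |(j : ℝ)|) ^ (M + (i + 1)) + C2 * (1 + |(j : ℝ)|) ^ (M + (i + 1)) := by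
        have := pow_le_pow_right₀ hj1 (by omega : M + i ≤ M + (i + 1))
        rw [show M + 1 + i = M + (i + 1) by ring]
        gcongr
      _ = _ := by ring

/-! ### The orthonormal basis `φ_n` -/

theorem inner_toL2 (f g : C(Circ, ℂ)) : inner ℂ (toL2 f) (toL2 g) =
    ∫ θ in (0 : ℝ)..(2 * Real.pi), g (θ : Circ) * (starRingEnd ℂ) (f (θ : Circ)) := by
  rw [toL2, toL2, ContinuousMap.inner_toLp, ← AddCircle.intervalIntegral_preimage _ 0, zero_add]

theorem mulOp_toL2 (b f : C(Circ, ℂ)) : mulOp b (toL2 f) = toL2 (b * f) := by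
  apply Lp.ext
  filter_upwards [coeFn_mulOp b (toL2 f),
    ContinuousMap.coeFn_toLp (p := 2) (𝕜 := ℂ) (volume : Measure Circ) f,
    ContinuousMap.coeFn_toLp (p := 2) (𝕜 := ℂ) (volume : Measure Circ) (b * f)] with x h1 h2 h3
  rw [h1]
  simp only [toL2]
  rw [h2, h3]
  rfl

theorem inner_mulOp_left {b : C(Circ, ℂ)} (hb : ∀ x, (starRingEnd ℂ) (b x) = b x) (u v : L2) :
    inner ℂ (mulOp b u) v = inner ℂ u (mulOp b v) := by
  rw [L2.inner_def, L2.inner_def]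
  refine integral_congr_ae ?_
  filter_upwards [coeFn_mulOp b u, coeFn_mulOp b v] with x h1 h2
  rw [h1, h2]
  simp only [RCLike.inner_apply, map_mul, hb]
  ring

theorem sqrt_mul_inv_sqrt_mul {c x : ℝ} (hc : 0 < c) (hx : 0 < x) :
    Real.sqrt x * (Real.sqrt (c * x))⁻¹ * (Real.sqrt c)⁻¹ = c⁻¹ := by
  have h1 : Real.sqrt x ≠ 0 := (Real.sqrt_pos.2 hx).ne'
  have h2 : Real.sqrt c ≠ 0 := (Real.sqrt_pos.2 hc).ne'
  have h3 : Real.sqrt c ^ 2 = c := Real.sq_sqrt hc.le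
  rw [Real.sqrt_mul hc.le]
  nth_rewrite 3 [← h3]
  field_simp

theorem inv_sqrt_mul_inv_sqrt_mul {c x : ℝ} (hc : 0 < c) (hx : 0 < x) :
    (Real.sqrt x)⁻¹ * (Real.sqrt (c * x))⁻¹ * (Real.sqrt c)⁻¹ = c⁻¹ * x⁻¹ := by
  have h1 : Real.sqrt x ≠ 0 := (Real.sqrt_pos.2 hx).ne'
  have h4 : Real.sqrt x ^ 2 = x := Real.sq_sqrt hx.le
  have h5 : (Real.sqrt x)⁻¹ = Real.sqrt x * x⁻¹ := by
    nth_rewrite 3 [← h4]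
    field_simp
  rw [h5, ← sqrt_mul_inv_sqrt_mul hc hx]
  ring

namespace Weight

variable (a : Weight)

theorem inner_mulOp_sqrt (u v : L2) :
    inner ℂ (mulOp a.sqrtMap u) v = inner ℂ u (mulOp a.sqrtMap v) :=
  inner_mulOp_left (fun x => by simp [sqrtMap]) u v

theorem inner_mulOp_invSqrt (u v : L2) :
    inner ℂ (mulOp a.invSqrtMap u) v = inner ℂ u (mulOp a.invSqrtMap v) :=
  inner_mulOp_left (fun x => by simp [invSqrtMap]) u v

/-- The new angle `∫₀^θ a⁻¹`. -/
def angle (θ : ℝ) : ℝ := ∫ s in (0 : ℝ)..θ, (a (s : Circ))⁻¹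

theorem hasDerivAt_angle (θ : ℝ) : HasDerivAt a.angle (a (θ : Circ))⁻¹ θ :=
  intervalIntegral.integral_hasDerivAt_right (a.continuous_inv.intervalIntegrable _ _)
    (a.continuous_inv.stronglyMeasurableAtFilter _ _) a.continuous_inv.continuousAt

theorem continuous_angle : Continuous a.angle :=
  continuous_iff_continuousAt.2 fun θ => (a.hasDerivAt_angle θ).continuousAt

theorem angle_zero : a.angle 0 = 0 := intervalIntegral.integral_same

theorem angle_add_two_pi (θ : ℝ) : a.angle (θ + 2 * Real.pi) = a.angle θ + 2 * Real.pi := by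
  have hper : Function.Periodic (fun s : ℝ => (a (s : Circ))⁻¹) (2 * Real.pi) := by
    intro s
    simp only [AddCircle.coe_add_period]
  have h := hper.intervalIntegral_add_eq_add 0 θ
    fun s t => a.continuous_inv.intervalIntegrable s t
  simp only [zero_add] at h
  rw [a.normalized] at h
  exact h

theorem strictMono_angle : StrictMono a.angle :=
  strictMono_of_hasDerivAt_pos a.hasDerivAt_angle fun _ => inv_pos.2 (a.pos _)

theorem phiMap_coe (n : ℤ) (θ : ℝ) : a.phiMap n (θ : Circ) =
    (((Real.sqrt (2 * Real.pi * a (θ : Circ)))⁻¹ : ℝ) : ℂ) *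
      Complex.exp (Complex.I * (n * (a.angle θ : ℂ))) := by
  change a.phiReal n θ = _
  rw [phiReal, angle, mul_assoc Complex.I]

/-- The coefficient `(2π)⁻¹ ∫ e^{i(n t + j θ)} dθ`, where `t = ∫₀^θ a⁻¹`. -/
def coef (n j : ℤ) : ℂ := ((2 * Real.pi : ℝ) : ℂ)⁻¹ * ∫ θ in (0 : ℝ)..(2 * Real.pi),
  Complex.exp (Complex.I * (n * (a.angle θ : ℂ) + j * (θ : ℂ)))

theorem hasDerivAt_exp (n j : ℤ) (θ : ℝ) :
    HasDerivAt (fun θ : ℝ => Complex.exp (Complex.I * (n * (a.angle θ : ℂ) + j * (θ : ℂ))))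
      (Complex.I * ((n * (((a (θ : Circ))⁻¹ : ℝ) : ℂ) + j) *
        Complex.exp (Complex.I * (n * (a.angle θ : ℂ) + j * (θ : ℂ))))) θ := by
  have h1 : HasDerivAt (fun θ : ℝ => (a.angle θ : ℂ)) (((a (θ : Circ))⁻¹ : ℝ) : ℂ) θ :=
    (a.hasDerivAt_angle θ).ofReal_comp
  have h2 : HasDerivAt (fun θ : ℝ => (θ : ℂ)) ((1 : ℝ) : ℂ) θ := (hasDerivAt_id θ).ofReal_comp
  have h3 := (((h1.const_mul (n : ℂ)).add (h2.const_mul (j : ℂ))).const_mul Complex.I).cexp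
  refine h3.congr_deriv ?_
  simp only [Pi.add_apply, Complex.ofReal_one, mul_one]
  ring

theorem continuous_exp (n j : ℤ) : Continuous fun θ : ℝ =>
    Complex.exp (Complex.I * (n * (a.angle θ : ℂ) + j * (θ : ℂ))) :=
  continuous_iff_continuousAt.2 fun θ => (a.hasDerivAt_exp n j θ).continuousAt

theorem continuous_inv_ofReal : Continuous fun θ : ℝ => (((a (θ : Circ))⁻¹ : ℝ) : ℂ) :=
  Complex.continuous_ofReal.comp a.continuous_inv

/-- Up to the factor `I` the integrand is the derivative of a periodic function. -/
theorem integral_inv_mul_exp_add (n j : ℤ) : ∫ θ in (0 : ℝ)..(2 * Real.pi),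
    (n * (((a (θ : Circ))⁻¹ : ℝ) : ℂ) + j) *
      Complex.exp (Complex.I * (n * (a.angle θ : ℂ) + j * (θ : ℂ))) = 0 := by
  have hc : Continuous fun θ : ℝ => (n * (((a (θ : Circ))⁻¹ : ℝ) : ℂ) + j) *
      Complex.exp (Complex.I * (n * (a.angle θ : ℂ) + j * (θ : ℂ))) :=
    ((continuous_const.mul a.continuous_inv_ofReal).add continuous_const).mul
      (a.continuous_exp n j)
  have h := intervalIntegral.integral_eq_sub_of_hasDerivAt (a := 0) (b := 2 * Real.pi)
    (fun θ _ => a.hasDerivAt_exp n j θ) ((continuous_const.mul hc).intervalIntegrable _ _)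
  have h2 : a.angle (2 * Real.pi) = 2 * Real.pi := by
    have := a.angle_add_two_pi 0
    rwa [zero_add, angle_zero, zero_add] at this
  have h3 : Complex.exp (Complex.I * (n * (a.angle (2 * Real.pi) : ℂ) +
      j * ((2 * Real.pi : ℝ) : ℂ))) =
      Complex.exp (Complex.I * (n * (a.angle 0 : ℂ) + j * ((0 : ℝ) : ℂ))) := by
    rw [h2, angle_zero, Complex.exp_eq_exp_iff_exists_int]
    refine ⟨n + j, ?_⟩
    push_cast
    ring
  rw [h3, sub_self, intervalIntegral.integral_const_mul] at h
  exact (mul_eq_zero.1 h).resolve_left Complex.I_ne_zero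

theorem integral_inv_mul_exp (n : ℤ) : ∫ θ in (0 : ℝ)..(2 * Real.pi),
    (((a (θ : Circ))⁻¹ : ℝ) : ℂ) * Complex.exp (Complex.I * (n * (a.angle θ : ℂ))) =
      if n = 0 then ((2 * Real.pi : ℝ) : ℂ) else 0 := by
  split_ifs with hn
  · subst hn
    simp only [Int.cast_zero, zero_mul, mul_zero, Complex.exp_zero, mul_one]
    rw [intervalIntegral.integral_ofReal, a.normalized]
  · have h := a.integral_inv_mul_exp_add n 0
    simp only [Int.cast_zero, zero_mul, add_zero, mul_assoc] at h
    rw [intervalIntegral.integral_const_mul] at h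
    exact (mul_eq_zero.1 h).resolve_left (Int.cast_ne_zero.2 hn)

theorem conj_exp_I_mul_ofReal (x : ℝ) : (starRingEnd ℂ) (Complex.exp (Complex.I * x)) =
    Complex.exp (Complex.I * ((-x : ℝ) : ℂ)) := by
  rw [← Complex.exp_conj]
  simp

/-- In the variable `t` with `dt = a⁻¹ dθ` this is the orthonormality of the exponentials
`(2π)^{-1/2} e^{int}`. -/
theorem orthonormal_phi : Orthonormal ℂ a.phi := by
  rw [orthonormal_iff_ite]
  intro n k
  rw [phi, phi, inner_toL2]
  have h : ∀ θ : ℝ, a.phiMap k (θ : Circ) * (starRingEnd ℂ) (a.phiMap n (θ : Circ)) =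
      ((2 * Real.pi : ℝ) : ℂ)⁻¹ * ((((a (θ : Circ))⁻¹ : ℝ) : ℂ) *
        Complex.exp (Complex.I * ((k - n : ℤ) * (a.angle θ : ℂ)))) := by
    intro θ
    rw [phiMap_coe, phiMap_coe, map_mul, Complex.conj_ofReal]
    have e1 : (n : ℂ) * (a.angle θ : ℂ) = ((n * a.angle θ : ℝ) : ℂ) := by push_cast; ring
    rw [e1, conj_exp_I_mul_ofReal]
    have e2 : Complex.exp (Complex.I * ((k - n : ℤ) * (a.angle θ : ℂ))) =
        Complex.exp (Complex.I * (k * (a.angle θ : ℂ))) *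
        Complex.exp (Complex.I * ((-(n * a.angle θ) : ℝ) : ℂ)) := by
      rw [← Complex.exp_add]
      congr 1
      push_cast
      ring
    have e3 : ((((Real.sqrt (2 * Real.pi * a (θ : Circ)))⁻¹ : ℝ) : ℂ)) *
        (((Real.sqrt (2 * Real.pi * a (θ : Circ)))⁻¹ : ℝ) : ℂ) =
        ((2 * Real.pi : ℝ) : ℂ)⁻¹ * (((a (θ : Circ))⁻¹ : ℝ) : ℂ) := by
      rw [← Complex.ofReal_mul, ← mul_inv, Real.mul_self_sqrt
        (mul_pos Real.two_pi_pos (a.pos _)).le, mul_inv]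
      push_cast
      ring
    rw [e2]
    linear_combination (Complex.exp (Complex.I * (k * (a.angle θ : ℂ))) *
        Complex.exp (Complex.I * ((-(n * a.angle θ) : ℝ) : ℂ))) * e3
  simp_rw [h]
  rw [intervalIntegral.integral_const_mul, a.integral_inv_mul_exp]
  by_cases hnk : n = k
  · subst hnk
    have : ((2 * Real.pi : ℝ) : ℂ) ≠ 0 := Complex.ofReal_ne_zero.2 Real.two_pi_pos.ne'
    simp only [sub_self, if_true]
    exact inv_mul_cancel₀ this
  · rw [if_neg hnk, if_neg (by omega), mul_zero]

/-- The diffeomorphism `θ ↦ ∫₀^θ a⁻¹` of the circle. -/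
def angleMap : C(Circ, Circ) where
  toFun := Function.Periodic.lift (f := fun θ : ℝ => ((a.angle θ : ℝ) : Circ))
    (c := 2 * Real.pi) fun θ => by
      simp only [angle_add_two_pi, AddCircle.coe_add_period]
  continuous_toFun := continuous_quot_lift _ ((AddCircle.continuous_mk' _).comp a.continuous_angle)

theorem angleMap_coe (θ : ℝ) : a.angleMap (θ : Circ) = (a.angle θ : Circ) := rfl

theorem angle_mem_Ico {θ : ℝ} (h : θ ∈ Set.Ico 0 (0 + 2 * Real.pi)) :
    a.angle θ ∈ Set.Ico 0 (0 + 2 * Real.pi) := by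
  have h2 := a.angle_add_two_pi 0
  rw [angle_zero] at h2
  rw [← h2, ← a.angle_zero, a.angle_zero]
  exact ⟨by rw [← a.angle_zero]; exact a.strictMono_angle.monotone h.1, a.strictMono_angle h.2⟩

theorem bijective_angleMap : Function.Bijective a.angleMap := by
  constructor
  · intro x y hxy
    obtain ⟨x, hx, rfl⟩ : ∃ z ∈ Set.Ico 0 (0 + 2 * Real.pi), (z : Circ) = x :=
      ⟨_, (AddCircle.equivIco (2 * Real.pi) 0 x).2, (AddCircle.equivIco _ 0).symm_apply_apply x⟩
    obtain ⟨y, hy, rfl⟩ : ∃ z ∈ Set.Ico 0 (0 + 2 * Real.pi), (z : Circ) = y :=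
      ⟨_, (AddCircle.equivIco (2 * Real.pi) 0 y).2, (AddCircle.equivIco _ 0).symm_apply_apply y⟩
    rw [angleMap_coe, angleMap_coe, AddCircle.coe_eq_coe_iff_of_mem_Ico
      (a.angle_mem_Ico hx) (a.angle_mem_Ico hy)] at hxy
    rw [a.strictMono_angle.injective hxy]
  · intro y
    obtain ⟨y, hy, rfl⟩ : ∃ z ∈ Set.Ico 0 (0 + 2 * Real.pi), (z : Circ) = y :=
      ⟨_, (AddCircle.equivIco (2 * Real.pi) 0 y).2, (AddCircle.equivIco _ 0).symm_apply_apply y⟩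
    have h2 := a.angle_add_two_pi 0
    rw [angle_zero, zero_add] at h2
    rw [zero_add] at hy
    obtain ⟨x, -, hx⟩ := intermediate_value_Icc Real.two_pi_pos.le
      a.continuous_angle.continuousOn
      (show y ∈ Set.Icc (a.angle 0) (a.angle (2 * Real.pi)) by
        rw [angle_zero, h2]; exact Set.Ico_subset_Icc_self hy)
    exact ⟨(x : Circ), by rw [angleMap_coe, hx]⟩

/-- Composition with `angleMap`. -/
def compAngle : C(Circ, ℂ) →L[ℂ] C(Circ, ℂ) where
  toLinearMap := (ContinuousMap.compRightAlgHom ℂ ℂ a.angleMap).toLinearMap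
  cont := ContinuousMap.continuous_precomp a.angleMap

theorem compAngle_apply (f : C(Circ, ℂ)) (x : Circ) : a.compAngle f x = f (a.angleMap x) := rfl

theorem surjective_compAngle : Function.Surjective a.compAngle := by
  intro g
  let e : Circ ≃ₜ Circ := Continuous.homeoOfEquivCompactToT2
    (f := Equiv.ofBijective a.angleMap a.bijective_angleMap) a.angleMap.continuous
  refine ⟨g.comp ⟨e.symm, e.symm.continuous⟩, ?_⟩
  ext x
  rw [compAngle_apply]
  exact congrArg g (e.symm_apply_apply x)

theorem surjective_mulOp_invSqrt : Function.Surjective (mulOp a.invSqrtMap) := fun u =>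
  ⟨_, a.mulOp_invSqrt_sqrt u⟩

theorem compAngle_fourier (n : ℤ) (θ : ℝ) : a.compAngle (fourier n) (θ : Circ) =
    Complex.exp (Complex.I * (n * (a.angle θ : ℂ))) := by
  rw [compAngle_apply, angleMap_coe, fourier_coe_apply]
  congr 1
  have : (Real.pi : ℂ) ≠ 0 := Complex.ofReal_ne_zero.2 Real.pi_ne_zero
  push_cast
  field_simp

theorem circ_ext {f g : C(Circ, ℂ)} (h : ∀ θ : ℝ, f (θ : Circ) = g (θ : Circ)) : f = g := by
  ext x
  induction x using QuotientAddGroup.induction_on with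
  | H θ => exact h θ

theorem mulOp_invSqrt_compAngle (n : ℤ) :
    mulOp a.invSqrtMap (toL2 (a.compAngle (fourier n))) =
      ((Real.sqrt (2 * Real.pi) : ℝ) : ℂ) • a.phi n := by
  rw [mulOp_toL2, phi, toL2, toL2, ← map_smul]
  congr 1
  refine circ_ext fun θ => ?_
  have h1 : ((Real.sqrt (2 * Real.pi) : ℝ) : ℂ) ≠ 0 :=
    Complex.ofReal_ne_zero.2 (Real.sqrt_pos.2 Real.two_pi_pos).ne'
  rw [ContinuousMap.mul_apply, ContinuousMap.smul_apply, compAngle_fourier, phiMap_coe,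
    Real.sqrt_mul Real.two_pi_pos.le, smul_eq_mul]
  simp only [invSqrtMap, ContinuousMap.coe_mk]
  push_cast
  rw [mul_inv, mul_assoc, mul_inv_cancel_left₀ h1]

/-- Up to a constant, `φ_n` is the Fourier monomial composed with the homeomorphism `angleMap` and
multiplied by `a^{-1/2}`. Both operations are continuous and surjective, so they carry a dense span
to a dense span. -/
theorem span_phi_dense : ⊤ ≤ (Submodule.span ℂ (Set.range a.phi)).topologicalClosure := by
  let Ψ : C(Circ, ℂ) →L[ℂ] L2 :=
    (mulOp a.invSqrtMap).comp ((ContinuousMap.toLp 2 volume ℂ).comp a.compAngle)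
  have hΨ : ∀ n, Ψ (fourier n) = ((Real.sqrt (2 * Real.pi) : ℝ) : ℂ) • a.phi n :=
    a.mulOp_invSqrt_compAngle
  have hdense : DenseRange Ψ := by
    have h1 : DenseRange (ContinuousMap.toLp (E := ℂ) 2 (volume : Measure Circ) ℂ) :=
      ContinuousMap.toLp_denseRange ℂ volume ℂ (by simp)
    have h2 := h1.comp a.surjective_compAngle.denseRange
      (ContinuousMap.toLp (E := ℂ) 2 (volume : Measure Circ) ℂ).continuous
    exact a.surjective_mulOp_invSqrt.denseRange.comp h2 (mulOp a.invSqrtMap).continuous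
  have h := hdense.topologicalClosure_map_submodule
    (span_fourier_closure_eq_top (T := 2 * Real.pi))
  rw [← h]
  refine Submodule.topologicalClosure_mono ?_
  rw [Submodule.map_span, Submodule.span_le]
  rintro _ ⟨_, ⟨n, rfl⟩, rfl⟩
  change Ψ (fourier n) ∈ _
  rw [hΨ]
  exact Submodule.smul_mem _ _ (Submodule.subset_span ⟨n, rfl⟩)

/-- The Hilbert basis `φ_n`. -/
def basis : HilbertBasis ℤ ℂ L2 := HilbertBasis.mk a.orthonormal_phi a.span_phi_dense

theorem coe_basis : ⇑a.basis = a.phi := HilbertBasis.coe_mk _ _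

/-- The constant weight. -/
def one : Weight where
  toFun _ := 1
  smooth := contDiff_const
  pos _ := one_pos
  normalized := by simp

theorem angle_one (θ : ℝ) : one.angle θ = θ := by simp [angle, one]

theorem toL2_fourier (n : ℤ) :
    toL2 (fourier n) = ((Real.sqrt (2 * Real.pi) : ℝ) : ℂ) • one.phi n := by
  rw [← mulOp_invSqrt_compAngle, mulOp_toL2]
  congr 1
  refine circ_ext fun θ => ?_
  rw [ContinuousMap.mul_apply, compAngle_fourier, angle_one, fourier_coe_apply]
  have : (Real.pi : ℂ) ≠ 0 := Complex.ofReal_ne_zero.2 Real.pi_ne_zero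
  simp only [invSqrtMap, one, ContinuousMap.coe_mk, Real.sqrt_one, inv_one, Complex.ofReal_one,
    one_mul]
  congr 1
  push_cast
  field_simp

theorem isLambda_iff (u w : L2) : IsLambda u w ↔
    ∀ n : ℤ, inner ℂ (one.phi n) w = (|n| : ℤ) * inner ℂ (one.phi n) u := by
  have h1 : ((Real.sqrt (2 * Real.pi) : ℝ) : ℂ) ≠ 0 :=
    Complex.ofReal_ne_zero.2 (Real.sqrt_pos.2 Real.two_pi_pos).ne'
  refine forall_congr' fun n => ?_
  rw [pairing, pairing, toL2_fourier, inner_smul_left, inner_smul_left, mul_left_comm]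
  refine (mul_right_injective₀ ?_).eq_iff
  rwa [Complex.conj_ofReal]

/-! ### Fourier coefficients of `a^{1/2} φ_n` and `a^{-1/2} φ_n`. -/

theorem inner_one_phi_sqrt_phi (n j : ℤ) :
    inner ℂ (one.phi j) (mulOp a.sqrtMap (a.phi n)) = a.coef n (-j) := by
  rw [phi, phi, mulOp_toL2, inner_toL2, coef, ← intervalIntegral.integral_const_mul]
  refine intervalIntegral.integral_congr fun θ _ => ?_
  simp only [ContinuousMap.mul_apply, phiMap_coe, map_mul, Complex.conj_ofReal, angle_one]
  have e1 : (j : ℂ) * (θ : ℂ) = ((j * θ : ℝ) : ℂ) := by push_cast; ring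
  rw [e1, conj_exp_I_mul_ofReal]
  have e2 : Complex.exp (Complex.I * (n * (a.angle θ : ℂ) + (-j : ℤ) * (θ : ℂ))) =
      Complex.exp (Complex.I * (n * (a.angle θ : ℂ))) *
        Complex.exp (Complex.I * ((-(j * θ) : ℝ) : ℂ)) := by
    rw [← Complex.exp_add]
    congr 1
    push_cast
    ring
  have e3 : a.sqrtMap (θ : Circ) * ((((Real.sqrt (2 * Real.pi * a (θ : Circ)))⁻¹ : ℝ) : ℂ)) *
      (((Real.sqrt (2 * Real.pi * one (θ : Circ)))⁻¹ : ℝ) : ℂ) = ((2 * Real.pi : ℝ) : ℂ)⁻¹ := by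
    simp only [sqrtMap, ContinuousMap.coe_mk, one, mul_one]
    rw [← Complex.ofReal_mul, ← Complex.ofReal_mul, ← Complex.ofReal_inv,
      sqrt_mul_inv_sqrt_mul Real.two_pi_pos (a.pos _)]
  rw [e2]
  linear_combination Complex.exp (Complex.I * (n * (a.angle θ : ℂ))) *
        Complex.exp (Complex.I * ((-(j * θ) : ℝ) : ℂ)) * e3

/-- Integration by parts, since `n a⁻¹ e^{int}` is a constant times the derivative of `e^{int}`.
Keeping the factor `n` on the left includes `n = 0`. -/
theorem inner_one_phi_invSqrt_phi (n j : ℤ) :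
    n * inner ℂ (one.phi j) (mulOp a.invSqrtMap (a.phi n)) = j * a.coef n (-j) := by
  have h0 := a.integral_inv_mul_exp_add n (-j)
  have h1 : inner ℂ (one.phi j) (mulOp a.invSqrtMap (a.phi n)) =
      ((2 * Real.pi : ℝ) : ℂ)⁻¹ * ∫ θ in (0 : ℝ)..(2 * Real.pi), (((a (θ : Circ))⁻¹ : ℝ) : ℂ) *
        Complex.exp (Complex.I * (n * (a.angle θ : ℂ) + (-j : ℤ) * (θ : ℂ))) := by
    rw [phi, phi, mulOp_toL2, inner_toL2, ← intervalIntegral.integral_const_mul]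
    refine intervalIntegral.integral_congr fun θ _ => ?_
    simp only [ContinuousMap.mul_apply, phiMap_coe, map_mul, Complex.conj_ofReal, angle_one]
    have e1 : (j : ℂ) * (θ : ℂ) = ((j * θ : ℝ) : ℂ) := by push_cast; ring
    rw [e1, conj_exp_I_mul_ofReal]
    have e2 : Complex.exp (Complex.I * (n * (a.angle θ : ℂ) + (-j : ℤ) * (θ : ℂ))) =
        Complex.exp (Complex.I * (n * (a.angle θ : ℂ))) *
          Complex.exp (Complex.I * ((-(j * θ) : ℝ) : ℂ)) := by
      rw [← Complex.exp_add]
      congr 1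
      push_cast
      ring
    have e3 : a.invSqrtMap (θ : Circ) *
        ((((Real.sqrt (2 * Real.pi * a (θ : Circ)))⁻¹ : ℝ) : ℂ)) *
        (((Real.sqrt (2 * Real.pi * one (θ : Circ)))⁻¹ : ℝ) : ℂ) =
        ((2 * Real.pi : ℝ) : ℂ)⁻¹ * (((a (θ : Circ))⁻¹ : ℝ) : ℂ) := by
      simp only [invSqrtMap, ContinuousMap.coe_mk, one, mul_one]
      rw [← Complex.ofReal_mul, ← Complex.ofReal_mul, ← Complex.ofReal_inv, ← Complex.ofReal_mul,
        inv_sqrt_mul_inv_sqrt_mul Real.two_pi_pos (a.pos _)]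
    rw [e2]
    linear_combination Complex.exp (Complex.I * (n * (a.angle θ : ℂ))) *
          Complex.exp (Complex.I * ((-(j * θ) : ℝ) : ℂ)) * e3
  rw [h1, coef]
  have c1 : Continuous fun θ : ℝ => (((a (θ : Circ))⁻¹ : ℝ) : ℂ) *
        Complex.exp (Complex.I * (n * (a.angle θ : ℂ) + (-j : ℤ) * (θ : ℂ))) :=
    a.continuous_inv_ofReal.mul (a.continuous_exp n (-j))
  simp only [add_mul, mul_assoc] at h0
  rw [intervalIntegral.integral_add ((c1.const_mul _).intervalIntegrable _ _)
    (((a.continuous_exp n (-j)).const_mul _).intervalIntegrable _ _),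
    intervalIntegral.integral_const_mul, intervalIntegral.integral_const_mul] at h0
  simp only [Int.cast_neg] at h0 ⊢
  linear_combination ((2 * Real.pi : ℝ) : ℂ)⁻¹ * h0

end Weight

/-! ### Orthogonal families of subspaces -/

section OrthogonalFamily

theorem summable_of_mem_of_norm_sq {E ι : Type*} [NormedAddCommGroup E] [InnerProductSpace ℂ E]
    [CompleteSpace E] {K : ι → Submodule ℂ E}
    (hK : OrthogonalFamily ℂ (fun i => K i) fun i => (K i).subtypeₗᵢ) {f : ι → E}
    (hf : ∀ i, f i ∈ K i) (hs : Summable fun i => ‖f i‖ ^ 2) : Summable f :=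
  (hK.summable_iff_norm_sq_summable fun i => (⟨f i, hf i⟩ : K i)).2 hs

variable {E ι : Type*} [NormedAddCommGroup E] [InnerProductSpace ℂ E] {K : ι → Submodule ℂ E}
  [∀ i, (K i).HasOrthogonalProjection]

/-- Bessel's inequality: the partial sum `y` satisfies `‖y‖² = ⟨y, x⟩ ≤ ‖y‖ ‖x‖`. -/
theorem sum_norm_sq_starProjection_le
    (hK : OrthogonalFamily ℂ (fun i => K i) fun i => (K i).subtypeₗᵢ) (x : E) (s : Finset ι) :
    ∑ i ∈ s, ‖(K i).starProjection x‖ ^ 2 ≤ ‖x‖ ^ 2 := by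
  set y := ∑ i ∈ s, (K i).starProjection x with hy
  have h1 : ‖y‖ ^ 2 = ∑ i ∈ s, ‖(K i).starProjection x‖ ^ 2 :=
    hK.norm_sum (fun i => (K i).orthogonalProjectionOnto x) s
  have h2 : (inner ℂ y x : ℂ) = ((‖y‖ ^ 2 : ℝ) : ℂ) := by
    rw [h1, hy, sum_inner, Complex.ofReal_sum]
    refine Finset.sum_congr rfl fun i _ => ?_
    have e := inner_self_eq_norm_sq_to_K (𝕜 := ℂ) ((K i).starProjection x)
    rw [← (K i).inner_starProjection_left_eq_right,
      Submodule.starProjection_eq_self_iff.2 ((K i).starProjection_apply_mem x)] at e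
    rw [e, Complex.ofReal_pow]
    rfl
  have h3 := norm_inner_le_norm (𝕜 := ℂ) y x
  rw [h2, Complex.norm_real, Real.norm_of_nonneg (sq_nonneg _), sq] at h3
  rw [← h1]
  rcases (norm_nonneg y).eq_or_lt with h | h
  · rw [← h, zero_pow two_ne_zero]; exact sq_nonneg _
  · exact pow_le_pow_left₀ (norm_nonneg _) (le_of_mul_le_mul_left h3 h) 2

theorem summable_norm_sq_starProjection
    (hK : OrthogonalFamily ℂ (fun i => K i) fun i => (K i).subtypeₗᵢ) (x : E) :
    Summable fun i => ‖(K i).starProjection x‖ ^ 2 :=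
  summable_of_sum_le (fun _ => sq_nonneg _) (sum_norm_sq_starProjection_le hK x)

theorem hasSum_starProjection [CompleteSpace E]
    (hK : OrthogonalFamily ℂ (fun i => K i) fun i => (K i).subtypeₗᵢ) (hbot : (⨆ i, K i)ᗮ = ⊥)
    (x : E) : HasSum (fun i => (K i).starProjection x) x := by
  have hs : Summable fun i => (K i).starProjection x :=
    summable_of_mem_of_norm_sq hK (fun i => (K i).starProjection_apply_mem x)
      (summable_norm_sq_starProjection hK x)
  obtain ⟨y, hy⟩ := hs
  suffices h : x - y ∈ (⨆ i, K i)ᗮ by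
    rw [hbot, Submodule.mem_bot, sub_eq_zero] at h
    exact h.symm ▸ hy
  rw [← Submodule.iInf_orthogonal, Submodule.mem_iInf]
  intro i
  rw [Submodule.mem_orthogonal]
  intro u hu
  have h1 : HasSum (fun j => inner ℂ u ((K j).starProjection x)) (inner ℂ u y) :=
    (innerSL ℂ u).hasSum hy
  have h2 : HasSum (fun j => inner ℂ u ((K j).starProjection x))
      (inner ℂ u ((K i).starProjection x)) := by
    refine hasSum_single i fun j hj => ?_
    exact hK hj.symm ⟨u, hu⟩ ((K j).orthogonalProjectionOnto x)
  rw [inner_sub_right, h1.unique h2, ← (K i).inner_starProjection_left_eq_right,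
    Submodule.starProjection_eq_self_iff.2 hu, sub_self]

end OrthogonalFamily

/-! ### The operator in the basis `φ_n` -/

namespace Weight

variable (a : Weight)

theorem coef_neg (n j : ℤ) : a.coef (-n) (-j) = (starRingEnd ℂ) (a.coef n j) := by
  rw [coef, coef, map_mul, map_inv₀, Complex.conj_ofReal]
  congr 1
  rw [intervalIntegral.integral_of_le Real.two_pi_pos.le,
    intervalIntegral.integral_of_le Real.two_pi_pos.le, ← integral_conj,
    ← intervalIntegral.integral_of_le Real.two_pi_pos.le,
    ← intervalIntegral.integral_of_le Real.two_pi_pos.le]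
  refine intervalIntegral.integral_congr fun θ _ => ?_
  have e1 : (n * (a.angle θ : ℂ) + j * (θ : ℂ)) = ((n * a.angle θ + j * θ : ℝ) : ℂ) := by
    push_cast; ring
  simp only [e1, conj_exp_I_mul_ofReal]
  congr 1
  push_cast
  ring

/-- This puts `a^{1/2} φ_n` in the domain of `Λ`: the numbers `j c(n, -j)` are the coefficients of
`n a^{-1/2} φ_n`, which is in `L²`, and `|j|` in place of `j` changes no modulus. -/
theorem exists_lambda_phi (n : ℤ) :
    ∃ w : L2, ∀ j : ℤ, inner ℂ (one.phi j) w = (|j| : ℤ) * a.coef n (-j) := by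
  set x := one.basis.repr ((n : ℂ) • mulOp a.invSqrtMap (a.phi n)) with hx
  have hxj : ∀ j : ℤ, x j = j * a.coef n (-j) := by
    intro j
    rw [hx, HilbertBasis.repr_apply_apply, coe_basis, inner_smul_right,
      inner_one_phi_invSqrt_phi]
  have hmem : Memℓp (fun j : ℤ => ((|j| : ℤ) : ℂ) * a.coef n (-j)) 2 := by
    refine memℓp_gen (((lp.memℓp x).summable (by simp)).congr fun j => ?_)
    rw [hxj, norm_mul, norm_mul, Complex.norm_intCast, Complex.norm_intCast]
    simp
  refine ⟨one.basis.repr.symm ⟨_, hmem⟩, fun j => ?_⟩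
  rw [← coe_basis, ← HilbertBasis.repr_apply_apply, LinearIsometryEquiv.apply_symm_apply]

/-- `Λ (a^{1/2} φ_n)`. -/
def lambdaPhi (n : ℤ) : L2 := (a.exists_lambda_phi n).choose

theorem inner_one_phi_lambdaPhi (n j : ℤ) :
    inner ℂ (one.phi j) (a.lambdaPhi n) = (|j| : ℤ) * a.coef n (-j) :=
  (a.exists_lambda_phi n).choose_spec j

theorem isLambda_lambdaPhi (n : ℤ) : IsLambda (mulOp a.sqrtMap (a.phi n)) (a.lambdaPhi n) := by
  rw [isLambda_iff]
  intro j
  rw [inner_one_phi_lambdaPhi, inner_one_phi_sqrt_phi]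

/-- `Λ_a φ_n`. -/
def steklovPhi (n : ℤ) : L2 := mulOp a.sqrtMap (a.lambdaPhi n)

theorem isSteklov_steklovPhi (n : ℤ) : a.IsSteklov (a.phi n) (a.steklovPhi n) :=
  ⟨_, a.isLambda_lambdaPhi n, rfl⟩

theorem hasSum_inner_steklovPhi (k n : ℤ) :
    HasSum (fun j : ℤ => (starRingEnd ℂ) (a.coef k (-j)) * ((|j| : ℤ) * a.coef n (-j)))
      (inner ℂ (a.phi k) (a.steklovPhi n)) := by
  rw [steklovPhi, ← inner_mulOp_sqrt]
  refine (one.basis.hasSum_inner_mul_inner _ _).congr_fun ?_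
  intro j
  rw [coe_basis, inner_one_phi_lambdaPhi, ← inner_conj_symm, inner_one_phi_sqrt_phi]

/-- Parseval for `⟨a^{1/2} φ_k, n a^{-1/2} φ_n⟩`, in which the weights cancel. -/
theorem hasSum_coef_mul_coef (k n : ℤ) :
    HasSum (fun j : ℤ => (starRingEnd ℂ) (a.coef k (-j)) * (j * a.coef n (-j)))
      (if k = n then (n : ℂ) else 0) := by
  have h : inner ℂ (mulOp a.sqrtMap (a.phi k)) ((n : ℂ) • mulOp a.invSqrtMap (a.phi n)) =
      if k = n then (n : ℂ) else 0 := by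
    rw [inner_smul_right, inner_mulOp_sqrt, mulOp_sqrt_invSqrt,
      orthonormal_iff_ite.1 a.orthonormal_phi, mul_ite, mul_one, mul_zero]
  rw [← h]
  refine (one.basis.hasSum_inner_mul_inner _ _).congr_fun ?_
  intro j
  rw [coe_basis, inner_smul_right, inner_one_phi_invSqrt_phi, ← inner_conj_symm,
    inner_one_phi_sqrt_phi]

/-- The factor `|j| - j` kills all `j ≥ 0`, and the negative indices are renamed `-(j + 1)`. For `n
> 0` the surviving `c(n, j + 1)` have a phase without stationary points;
`hasSum_inner_steklovPhi_neg`, with `|j| + j`, serves `n < 0`. -/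
theorem hasSum_inner_steklovPhi_pos (k n : ℤ) :
    HasSum (fun j : ℕ => 2 * (j + 1 : ℂ) * a.coef n (j + 1) *
        (starRingEnd ℂ) (a.coef k (j + 1)))
      (inner ℂ (a.phi k) (a.steklovPhi n) - if k = n then (n : ℂ) else 0) := by
  have h := (a.hasSum_inner_steklovPhi k n).sub (a.hasSum_coef_mul_coef k n)
  have hinj : Function.Injective fun j : ℕ => -((j : ℤ) + 1) := fun i j hij => by
    simpa using hij
  rw [← hinj.hasSum_iff] at h
  · refine h.congr_fun fun j => ?_
    simp only [Function.comp_apply, neg_neg, abs_neg]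
    rw [abs_of_nonneg (by positivity)]
    push_cast
    ring
  · intro j hj
    have hj0 : 0 ≤ j := by
      by_contra hneg
      exact hj ⟨(-j - 1).toNat, by simp only; omega⟩
    rw [abs_of_nonneg hj0, sub_self]

theorem hasSum_inner_steklovPhi_neg (k n : ℤ) :
    HasSum (fun j : ℕ => 2 * (j + 1 : ℂ) * a.coef n (-(j + 1)) *
        (starRingEnd ℂ) (a.coef k (-(j + 1))))
      (inner ℂ (a.phi k) (a.steklovPhi n) + if k = n then (n : ℂ) else 0) := by
  have h := (a.hasSum_inner_steklovPhi k n).add (a.hasSum_coef_mul_coef k n)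
  have hinj : Function.Injective fun j : ℕ => ((j : ℤ) + 1) := fun i j hij => by
    simpa using hij
  rw [← hinj.hasSum_iff] at h
  · refine h.congr_fun fun j => ?_
    simp only [Function.comp_apply]
    rw [abs_of_nonneg (by positivity)]
    push_cast
    ring
  · intro j hj
    have hj0 : j ≤ 0 := by
      by_contra hneg
      exact hj ⟨(j - 1).toNat, by simp only; omega⟩
    rw [abs_of_nonpos hj0]
    push_cast
    ring

/-! ### Symmetry and the eigenspaces -/

theorem isLambda_symm {u u' w w' : L2} (h : IsLambda u w) (h' : IsLambda u' w') :
    inner ℂ w u' = inner ℂ u w' := by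
  rw [isLambda_iff] at h h'
  rw [← one.basis.tsum_inner_mul_inner w u', ← one.basis.tsum_inner_mul_inner u w']
  refine tsum_congr fun j => ?_
  rw [coe_basis, ← inner_conj_symm, h, h', map_mul, inner_conj_symm, map_intCast]
  ring

theorem isSteklov_symm {u u' v v' : L2} (h : a.IsSteklov u v) (h' : a.IsSteklov u' v') :
    inner ℂ v u' = inner ℂ u v' := by
  obtain ⟨w, hw, rfl⟩ := h
  obtain ⟨w', hw', rfl⟩ := h'
  rw [inner_mulOp_sqrt, isLambda_symm hw hw', inner_mulOp_sqrt]

theorem P0_apply (u : L2) : a.P0 u = inner ℂ (a.phi 0) u • a.phi 0 :=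
  Submodule.starProjection_unit_singleton ℂ (a.orthonormal_phi.1 0) u

theorem inner_P0_left (u v : L2) : inner ℂ (a.P0 u) v = inner ℂ u (a.P0 v) :=
  Submodule.inner_starProjection_left_eq_right _ u v

theorem inner_eigenspace {lam : ℝ} {u x v : L2} (hu : u ∈ a.eigenspace lam)
    (hx : a.IsSteklov x v) : inner ℂ u (v + a.P0 x) = lam * inner ℂ u x := by
  obtain ⟨v', hv', e⟩ := hu
  rw [inner_add_right, ← a.isSteklov_symm hv' hx, ← inner_P0_left, ← inner_add_left, e,
    inner_smul_left, Complex.conj_ofReal]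

theorem starProjection_steklov (lam : ℝ) {x v : L2} (hx : a.IsSteklov x v) :
    (a.eigenspace lam).starProjection (v + a.P0 x) =
      (lam : ℂ) • (a.eigenspace lam).starProjection x := by
  rw [← map_smul, ← sub_eq_zero, ← map_sub, Submodule.starProjection_apply_eq_zero_iff,
    Submodule.mem_orthogonal]
  intro u hu
  rw [inner_sub_right, inner_smul_right, a.inner_eigenspace hu hx, sub_self]

theorem orthogonalFamily_eigenspace : OrthogonalFamily ℂ (fun lam : ℝ => a.eigenspace lam)
    fun lam => (a.eigenspace lam).subtypeₗᵢ := by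
  rintro lam mu hne ⟨u, hu⟩ ⟨u', hu'⟩
  obtain ⟨v', hv', e⟩ := hu'
  have h := a.inner_eigenspace hu hv'
  rw [e, inner_smul_right] at h
  have h2 : ((mu : ℂ) - lam) * inner ℂ u u' = 0 := by rw [sub_mul, h, sub_self]
  refine (mul_eq_zero.1 h2).resolve_left ?_
  rw [← Complex.ofReal_sub]
  exact Complex.ofReal_ne_zero.2 (sub_ne_zero.2 hne.symm)

theorem mulOp_invSqrt_one_phi_zero : mulOp a.invSqrtMap (one.phi 0) = a.phi 0 := by
  rw [phi, mulOp_toL2, phi]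
  congr 1
  refine circ_ext fun θ => ?_
  rw [ContinuousMap.mul_apply, phiMap_coe, phiMap_coe, Real.sqrt_mul Real.two_pi_pos.le]
  simp only [one, invSqrtMap, ContinuousMap.coe_mk, mul_one, Int.cast_zero, zero_mul, mul_zero,
    Complex.exp_zero]
  rw [← Complex.ofReal_mul, Real.sqrt_one, mul_one, Real.sqrt_mul Real.two_pi_pos.le,
    mul_inv, mul_comm]

/-- Let `g = a^{1/2} u` and let `g'` be `g` without its constant mode `g₀`. Since `|j| ≥ 1` off the
constant mode, `λ ‖u‖² ≥ ‖g'‖² + |⟨φ₀, u⟩|²`. The right side controls `u = g₀ φ₀ + a^{-1/2} g'`,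
because `g₀` differs from `⟨φ₀, u⟩` by at most `K ‖g'‖`. -/
theorem exists_eigenvalue_lower_bound :
    ∃ c : ℝ, 0 < c ∧ ∀ lam : ℝ, a.eigenspace lam ≠ ⊥ → c ≤ lam := by
  set K := ‖mulOp a.invSqrtMap‖ with hK
  -- The constant comes from `‖u‖ ≤ ‖p‖ + 2K ‖g'‖`, hence `‖u‖² ≤ 2 ‖p‖² + 8K² ‖g'‖²`.
  refine ⟨(2 + 8 * K ^ 2)⁻¹, by positivity, fun lam hlam => ?_⟩
  obtain ⟨u, hu, hu0⟩ := (Submodule.ne_bot_iff _).1 hlam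
  obtain ⟨v, hv, e⟩ := id hu
  obtain ⟨w, hw, rfl⟩ := id hv
  set g := mulOp a.sqrtMap u with hg
  set g₀ : ℂ := inner ℂ (one.phi 0) g with hg₀
  set g' := g - g₀ • one.phi 0 with hg'
  have huw : inner ℂ u (mulOp a.sqrtMap w) = inner ℂ g w := by rw [hg, inner_mulOp_sqrt]
  have hw' := (isLambda_iff _ _).1 hw
  have hsum := one.basis.hasSum_inner_mul_inner g w
  have hsum' := one.basis.hasSum_inner_mul_inner g' g'
  have hA : ‖g'‖ ^ 2 ≤ (inner ℂ g w : ℂ).re := by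
    have e1 := Complex.hasSum_re hsum
    have e2 := Complex.hasSum_re hsum'
    rw [inner_self_eq_norm_sq_to_K] at e2
    have e3 : ((‖g'‖ : ℂ) ^ 2).re = ‖g'‖ ^ 2 := by
      rw [← Complex.ofReal_pow, Complex.ofReal_re]
    rw [← e3]
    refine hasSum_le ?_ e2 e1
    intro j
    have e4 : inner ℂ (one.phi j) g' = if j = 0 then 0 else inner ℂ (one.phi j) g := by
      rw [hg', inner_sub_right, inner_smul_right, orthonormal_iff_ite.1 one.orthonormal_phi]
      split_ifs with h
      · rw [h, ← hg₀]; simp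
      · simp
    rw [coe_basis, ← inner_conj_symm g', ← inner_conj_symm g, hw', e4]
    split_ifs with h
    · simp [h]
    · set z : ℂ := inner ℂ (one.phi j) g
      have e5 : (starRingEnd ℂ) z * ((|j| : ℤ) * z) = ((|j| : ℤ) : ℝ) * ((‖z‖ ^ 2 : ℝ) : ℂ) := by
        rw [mul_left_comm, ← Complex.normSq_eq_conj_mul_self, Complex.normSq_eq_norm_sq,
          Complex.ofReal_intCast]
      have e6 : (starRingEnd ℂ) z * z = ((‖z‖ ^ 2 : ℝ) : ℂ) := by
        rw [← Complex.normSq_eq_conj_mul_self, Complex.normSq_eq_norm_sq]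
      rw [e5, e6, ← Complex.ofReal_mul, Complex.ofReal_re, Complex.ofReal_re]
      have : (1 : ℝ) ≤ ((|j| : ℤ) : ℝ) := by exact_mod_cast Int.one_le_abs h
      nlinarith [sq_nonneg ‖z‖]
  set p : ℂ := inner ℂ (a.phi 0) u with hp
  have hE : lam * ‖u‖ ^ 2 = (inner ℂ g w : ℂ).re + ‖p‖ ^ 2 := by
    have e1 : inner ℂ u (mulOp a.sqrtMap w + a.P0 u) = (lam : ℂ) * inner ℂ u u := by
      rw [e, inner_smul_right]
    rw [inner_add_right, huw, P0_apply, inner_smul_right, inner_self_eq_norm_sq_to_K,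
      ← inner_conj_symm u (a.phi 0), ← hp, mul_comm p, ← Complex.normSq_eq_conj_mul_self,
      Complex.normSq_eq_norm_sq] at e1
    have e2 := congrArg Complex.re e1
    rw [Complex.add_re, Complex.ofReal_re] at e2
    rw [e2]
    have : ((lam : ℂ) * ((‖u‖ : ℝ) : ℂ) ^ 2) = ((lam * ‖u‖ ^ 2 : ℝ) : ℂ) := by push_cast; ring
    exact (congrArg Complex.re this).symm
  have hu1 : u = g₀ • a.phi 0 + mulOp a.invSqrtMap g' := by
    rw [hg', map_sub, map_smul, mulOp_invSqrt_one_phi_zero, hg, mulOp_invSqrt_sqrt]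
    abel
  have hK1 : ‖mulOp a.invSqrtMap g'‖ ≤ K * ‖g'‖ := (mulOp a.invSqrtMap).le_opNorm _
  have hφ : ‖a.phi 0‖ = 1 := a.orthonormal_phi.1 0
  have hp1 : g₀ = p - inner ℂ (a.phi 0) (mulOp a.invSqrtMap g') := by
    have e1 : p = inner ℂ (a.phi 0) (g₀ • a.phi 0 + mulOp a.invSqrtMap g') := by rw [← hu1]
    rw [e1, inner_add_right, inner_smul_right, inner_self_eq_norm_sq_to_K, hφ]
    simp only [Complex.coe_algebraMap, Complex.ofReal_one, one_pow, mul_one, add_sub_cancel_right]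
  have hg0 : ‖g₀‖ ≤ ‖p‖ + K * ‖g'‖ := by
    rw [hp1]
    refine (norm_sub_le _ _).trans (add_le_add le_rfl ?_)
    refine (norm_inner_le_norm _ _).trans ?_
    rwa [hφ, one_mul]
  have hun : ‖u‖ ≤ ‖p‖ + 2 * (K * ‖g'‖) := by
    rw [hu1]
    refine (norm_add_le _ _).trans ?_
    rw [norm_smul, hφ, mul_one]
    linarith
  have hu2 : ‖u‖ ^ 2 ≤ (2 + 8 * K ^ 2) * (lam * ‖u‖ ^ 2) := by
    rw [hE]
    have h1 : ‖u‖ ^ 2 ≤ (‖p‖ + 2 * (K * ‖g'‖)) ^ 2 := pow_le_pow_left₀ (norm_nonneg _) hun 2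
    have h2 : 0 ≤ K ^ 2 * ((inner ℂ g w : ℂ).re - ‖g'‖ ^ 2) :=
      mul_nonneg (sq_nonneg _) (sub_nonneg.2 hA)
    have h3 : 0 ≤ (inner ℂ g w : ℂ).re := (sq_nonneg _).trans hA
    nlinarith [sq_nonneg (‖p‖ - 2 * (K * ‖g'‖)), sq_nonneg (K * ‖p‖)]
  have hpos : 0 < ‖u‖ ^ 2 := by positivity
  rw [inv_le_iff_one_le_mul₀' (by positivity)]
  by_contra hlt
  rw [not_le] at hlt
  nlinarith

/-- The series that defines `ln(Λ_a + P₀) u` converges for `u` in the domain of `Λ_a`. -/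
theorem summable_lnTerm {u v : L2} (huv : a.IsSteklov u v) : Summable (a.lnTerm u) := by
  obtain ⟨c, hc, hbd⟩ := a.exists_eigenvalue_lower_bound
  have hK := a.orthogonalFamily_eigenspace
  refine summable_of_mem_of_norm_sq hK (fun lam =>
    Submodule.smul_mem _ _ (Submodule.starProjection_apply_mem _ _)) ?_
  have s1 := summable_norm_sq_starProjection hK u
  have s2 := summable_norm_sq_starProjection hK (v + a.P0 u)
  refine Summable.of_nonneg_of_le (fun _ => sq_nonneg _) (fun lam => ?_)
    ((s2.mul_left 2).add (s1.mul_left (2 * (c⁻¹) ^ 2)))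
  rw [a.starProjection_steklov lam huv, lnTerm, norm_smul, norm_smul, Complex.norm_real,
    Complex.norm_real]
  set z := ‖(a.eigenspace lam).starProjection u‖ with hz
  by_cases hbot : a.eigenspace lam = ⊥
  · have hz0 : z = 0 := by
      rw [hz, norm_eq_zero, Submodule.starProjection_apply_eq_zero_iff, hbot]
      simp
    simp [hz0]
  have hl := hbd lam hbot
  have hl0 : 0 < lam := hc.trans_le hl
  -- Thus each term is dominated by the projections of `(Λ_a + P₀) u` and of `u`, whose norms are
  -- square summable by Bessel.
  have h1 : |Real.log lam| ≤ lam + c⁻¹ := by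
    rw [abs_le]
    constructor
    · have h2 := Real.log_le_self (inv_pos.2 hl0).le
      rw [Real.log_inv] at h2
      have h3 : lam⁻¹ ≤ c⁻¹ := inv_anti₀ hc hl
      linarith
    · have h2 := Real.log_le_self hl0.le
      have : 0 < c⁻¹ := inv_pos.2 hc
      linarith
  rw [Real.norm_eq_abs, Real.norm_eq_abs, abs_of_pos hl0]
  have hz0 : 0 ≤ z := norm_nonneg _
  calc (|Real.log lam| * z) ^ 2 ≤ ((lam + c⁻¹) * z) ^ 2 := by gcongr
    _ ≤ 2 * (lam * z) ^ 2 + 2 * c⁻¹ ^ 2 * z ^ 2 := by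
      nlinarith [sq_nonneg (lam * z - c⁻¹ * z)]

end Weight

/-! ### Diagonal operators on `ℓ²(ℤ)` -/

/-- The space `ℓ²(ℤ)`. -/
abbrev Seq : Type := lp (fun _ : ℤ => ℂ) 2

/-- The standard basis vectors of `ℓ²(ℤ)`. -/
def unitVec (n : ℤ) : Seq := lp.single 2 n 1

theorem inner_unitVec (n : ℤ) (x : Seq) : inner ℂ (unitVec n) x = x n := by
  rw [unitVec, lp.inner_single_left]
  simp

theorem unitVec_apply (n k : ℤ) : unitVec n k = if k = n then 1 else 0 := by
  rw [unitVec, lp.single_apply, Pi.single_apply]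

theorem norm_unitVec (n : ℤ) : ‖unitVec n‖ = 1 := by
  rw [unitVec, lp.norm_single (by norm_num)]
  simp

theorem summable_norm_sq (x : Seq) : Summable fun n => ‖x n‖ ^ 2 := by
  have := (lp.memℓp x).summable (by simp)
  simpa using this

theorem hasSum_norm_sq (x : Seq) : HasSum (fun n => ‖x n‖ ^ 2) (‖x‖ ^ 2) := by
  have := lp.hasSum_norm (p := 2) (by simp) x
  simpa using this

/-- The operator on `ℓ²(ℤ)` of multiplication by a bounded sequence. -/
def diagOp (c : ℤ → ℝ) {C : ℝ} (hC : ∀ n, |c n| ≤ C) : Seq →L[ℂ] Seq :=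
  LinearMap.mkContinuous
    { toFun := fun x => ⟨fun n => (c n : ℂ) * x n, memℓp_gen (by
        refine Summable.of_nonneg_of_le (fun n => by positivity) (fun n => ?_)
          ((summable_norm_sq x).mul_left (C ^ 2))
        have : ‖(c n : ℂ) * x n‖ ≤ C * ‖x n‖ := by
          rw [norm_mul, Complex.norm_real]
          exact mul_le_mul_of_nonneg_right (hC n) (norm_nonneg _)
        have h2 := pow_le_pow_left₀ (norm_nonneg _) this 2
        rw [mul_pow] at h2
        simpa using h2)⟩
      map_add' := fun x y => by
        ext n
        exact mul_add _ _ _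
      map_smul' := fun r x => by
        ext n
        exact mul_left_comm _ _ _ }
    C fun x => by
      have hC0 : 0 ≤ C := (abs_nonneg _).trans (hC 0)
      refine abs_le_of_sq_le_sq' ?_ (by positivity) |>.2
      refine hasSum_le (fun n => ?_) (hasSum_norm_sq _)
        (by rw [mul_pow]; exact (hasSum_norm_sq x).mul_left (C ^ 2))
      have : ‖(c n : ℂ) * x n‖ ≤ C * ‖x n‖ := by
        rw [norm_mul, Complex.norm_real]
        exact mul_le_mul_of_nonneg_right (hC n) (norm_nonneg _)
      have h2 := pow_le_pow_left₀ (norm_nonneg _) this 2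
      rw [mul_pow] at h2
      exact h2

theorem diagOp_apply (c : ℤ → ℝ) {C : ℝ} (hC : ∀ n, |c n| ≤ C) (x : Seq) (n : ℤ) :
    diagOp c hC x n = c n * x n := rfl

theorem norm_diagOp_le (c : ℤ → ℝ) {C : ℝ} (hC : ∀ n, |c n| ≤ C) : ‖diagOp c hC‖ ≤ C :=
  LinearMap.mkContinuous_norm_le _ ((abs_nonneg _).trans (hC 0)) _

theorem norm_diagOp_sub_le {c c' : ℤ → ℝ} {C C' : ℝ} (hC : ∀ n, |c n| ≤ C)
    (hC' : ∀ n, |c' n| ≤ C') {D : ℝ} (hD : ∀ n, |c n - c' n| ≤ D) :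
    ‖diagOp c hC - diagOp c' hC'‖ ≤ D := by
  have : diagOp c hC - diagOp c' hC' = diagOp (fun n => c n - c' n) hD := by
    ext x n
    change (c n : ℂ) * x n - c' n * x n = ((c n - c' n : ℝ) : ℂ) * x n
    push_cast
    ring
  rw [this]
  exact norm_diagOp_le _ hD

theorem inner_diagOp_left (c : ℤ → ℝ) {C : ℝ} (hC : ∀ n, |c n| ≤ C) (x y : Seq) :
    inner ℂ (diagOp c hC x) y = inner ℂ x (diagOp c hC y) := by
  rw [lp.inner_eq_tsum, lp.inner_eq_tsum]
  refine tsum_congr fun n => ?_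
  rw [diagOp_apply, diagOp_apply]
  simp only [RCLike.inner_apply, map_mul, Complex.conj_ofReal]
  ring

theorem diagOp_unitVec (c : ℤ → ℝ) {C : ℝ} (hC : ∀ n, |c n| ≤ C) (n : ℤ) :
    diagOp c hC (unitVec n) = (c n : ℂ) • unitVec n := by
  ext k
  change (c k : ℂ) * unitVec n k = c n * unitVec n k
  rw [unitVec_apply]
  split_ifs with h
  · rw [h]
  · simp

/-- The operator is the norm limit of its finite rank truncations. -/
theorem isCompactOperator_diagOp (c : ℤ → ℝ) {C : ℝ} (hC : ∀ n, |c n| ≤ C)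
    (h0 : Tendsto c cofinite (𝓝 0)) : IsCompactOperator (diagOp c hC) := by
  have hC0 : 0 ≤ C := (abs_nonneg _).trans (hC 0)
  classical
  let cs : Finset ℤ → ℤ → ℝ := fun s n => if n ∈ s then c n else 0
  have hcs : ∀ s n, |cs s n| ≤ C := by
    intro s n
    simp only [cs]
    split_ifs
    · exact hC n
    · simpa using hC0
  have hlim : Tendsto (fun s : Finset ℤ => diagOp (cs s) (hcs s)) atTop (𝓝 (diagOp c hC)) := by
    rw [Metric.tendsto_nhds]
    intro ε hε
    have hfin : {n | ¬ |c n| < ε / 2}.Finite := by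
      have := Metric.tendsto_nhds.1 h0 (ε / 2) (by positivity)
      rw [Filter.eventually_cofinite] at this
      simpa [Real.dist_eq] using this
    filter_upwards [eventually_ge_atTop hfin.toFinset] with s hs
    rw [dist_eq_norm]
    refine (norm_diagOp_sub_le (hcs s) hC (D := ε / 2) fun n => ?_).trans_lt (by linarith)
    simp only [cs]
    split_ifs with hn
    · simp; positivity
    · rw [zero_sub, abs_neg]
      by_contra hcon
      exact hn (hs (hfin.mem_toFinset.2 fun hlt => hcon hlt.le))
  refine isCompactOperator_of_tendsto hlim (Eventually.of_forall fun s => ?_)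
  have hsum : diagOp (cs s) (hcs s) =
      ∑ n ∈ s, (c n : ℂ) • (InnerProductSpace.rankOne ℂ (unitVec n) (unitVec n)) := by
    ext x k
    rw [diagOp_apply]
    have : (∑ n ∈ s, (c n : ℂ) • (InnerProductSpace.rankOne ℂ (unitVec n) (unitVec n))) x =
        ∑ n ∈ s, (c n : ℂ) • (x n • unitVec n) := by
      rw [_root_.sum_apply]
      refine Finset.sum_congr rfl fun n _ => ?_
      rw [_root_.smul_apply, InnerProductSpace.rankOne_apply, inner_unitVec]
    rw [this, lp.coeFn_sum, Finset.sum_apply]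
    simp only [lp.coeFn_smul, Pi.smul_apply, unitVec_apply, smul_eq_mul, mul_ite, mul_one,
      mul_zero, Finset.sum_ite_eq, cs]
    split_ifs <;> simp
  rw [hsum]
  have key : (∑ n ∈ s, (c n : ℂ) • (InnerProductSpace.rankOne ℂ (unitVec n) (unitVec n)) :
      Seq →L[ℂ] Seq) ∈ compactOperator (RingHom.id ℂ) Seq Seq := by
    refine Submodule.sum_mem _ fun n _ => Submodule.smul_mem _ _ ?_
    have h1 : (InnerProductSpace.rankOne ℂ (unitVec n) (unitVec n) : Seq →L[ℂ] Seq) =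
        (ContinuousLinearMap.toSpanSingleton ℂ (unitVec n)).comp (innerSL ℂ (unitVec n)) := by
      ext x
      simp [InnerProductSpace.rankOne_apply]
    have h2 : IsCompactOperator (innerSL ℂ (unitVec n)) := by
      refine (isCompactOperator_iff_exists_mem_nhds_isCompact_closure_image _).2 ?_
      refine ⟨Metric.ball 0 1, Metric.ball_mem_nhds 0 one_pos, ?_⟩
      refine Metric.isCompact_of_isClosed_isBounded isClosed_closure
        (Bornology.IsBounded.closure ?_)
      exact (innerSL ℂ (unitVec n)).lipschitz.isBounded_image Metric.isBounded_ball
    rw [h1]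
    exact h2.clm_comp (ContinuousLinearMap.toSpanSingleton ℂ (unitVec n))
  exact key

/-! ### Perturbation of the diagonal operator -/

/-- The eigenvalues of the unperturbed operator. -/
def diagVal (n : ℤ) : ℝ := if n = 0 then 1 else |(n : ℝ)|

theorem one_le_diagVal (n : ℤ) : 1 ≤ diagVal n := by
  rw [diagVal]
  split_ifs with h
  · exact le_rfl
  · rw [← Int.cast_abs]
    exact_mod_cast Int.one_le_abs h

theorem diagVal_natCast {m : ℕ} (hm : 0 < m) : diagVal (m : ℤ) = m := by
  rw [diagVal, if_neg (by omega)]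
  simp

/-- The eigenspace of `diag(d) + R` for the real number `lam`. -/
def seqEigenspace (R : Seq →L[ℂ] Seq) (lam : ℝ) : Submodule ℂ Seq where
  carrier := {x | ∀ n, (diagVal n : ℂ) * x n + R x n = lam * x n}
  zero_mem' n := by simp
  add_mem' := by
    intro x y hx hy n
    rw [map_add]
    simp only [lp.coeFn_add, Pi.add_apply]
    linear_combination hx n + hy n
  smul_mem' := by
    intro c x hx n
    rw [map_smul]
    simp only [lp.coeFn_smul, Pi.smul_apply, smul_eq_mul]
    linear_combination c * hx n

theorem mem_seqEigenspace {R : Seq →L[ℂ] Seq} {lam : ℝ} {x : Seq} :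
    x ∈ seqEigenspace R lam ↔ ∀ n, (diagVal n : ℂ) * x n + R x n = lam * x n := Iff.rfl

theorem isClosed_seqEigenspace (R : Seq →L[ℂ] Seq) (lam : ℝ) :
    IsClosed (seqEigenspace R lam : Set Seq) := by
  have h : (seqEigenspace R lam : Set Seq) = ⋂ n : ℤ, {x : Seq |
      (diagVal n : ℂ) * inner ℂ (unitVec n) x + inner ℂ (unitVec n) (R x) =
        lam * inner ℂ (unitVec n) x} := by
    ext x
    simp only [SetLike.mem_coe, mem_seqEigenspace, Set.mem_iInter, Set.mem_ofPred_eq,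
      inner_unitVec]
  rw [h]
  refine isClosed_iInter fun n => isClosed_eq ?_ ?_ <;> fun_prop

instance completeSpace_seqEigenspace (R : Seq →L[ℂ] Seq) (lam : ℝ) :
    CompleteSpace (seqEigenspace R lam) :=
  (isClosed_seqEigenspace R lam).isComplete.completeSpace_coe

/-- Continuous paths of operators. -/
abbrev OpPath : Type := C(unitInterval, Seq →L[ℂ] Seq)

instance : NormedRing (Seq →L[ℂ] Seq) := ContinuousLinearMap.toNormedRing

instance : NormedRing OpPath := ContinuousMap.instNormedRing

instance : Ring OpPath := NormedRing.toRing

instance : MonoidWithZero OpPath := Semiring.toMonoidWithZero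

/-! ### Resolvents on the segment from `m` to `D + R`, and the spectral decomposition of `D + R`. -/

section Resolvent

variable (m : ℕ)

/-- The convex combinations `m + t (d_n - m)` of `m` and `d_n`. -/
def interp (t : unitInterval) (n : ℤ) : ℝ := m + t * (diagVal n - m)

variable {m}

theorem one_le_interp (hm : 0 < m) (t : unitInterval) (n : ℤ) : 1 ≤ interp m t n := by
  have h1 := one_le_diagVal n
  have h2 : (1 : ℝ) ≤ m := by exact_mod_cast hm
  have h3 := t.2.1
  have h4 := t.2.2
  rw [interp]
  nlinarith

theorem abs_inv_interp_le (hm : 0 < m) (t : unitInterval) (n : ℤ) :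
    |(interp m t n)⁻¹| ≤ 1 := by
  have h := one_le_interp hm t n
  rw [abs_of_nonneg (by positivity)]
  exact inv_le_one_of_one_le₀ h

theorem abs_mul_inv_interp_le (hm : 0 < m) (t : unitInterval) (n : ℤ) :
    |(t : ℝ) * (interp m t n)⁻¹| ≤ 1 := by
  rw [abs_mul, abs_of_nonneg t.2.1]
  exact mul_le_one₀ t.2.2 (abs_nonneg _) (abs_inv_interp_le hm t n)

/-- The resolvent `(m + t (d - m))⁻¹`. -/
def resolv (hm : 0 < m) (t : unitInterval) : Seq →L[ℂ] Seq :=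
  diagOp (fun n => (interp m t n)⁻¹) (abs_inv_interp_le hm t)

/-- The operator `t (m + t (d - m))⁻¹`. -/
def scaledResolv (hm : 0 < m) (t : unitInterval) : Seq →L[ℂ] Seq :=
  diagOp (fun n => (t : ℝ) * (interp m t n)⁻¹) (abs_mul_inv_interp_le hm t)

theorem scaledResolv_eq (hm : 0 < m) (t : unitInterval) :
    scaledResolv hm t = ((t : ℝ) : ℂ) • resolv hm t := by
  ext x n
  change (((t : ℝ) * (interp m t n)⁻¹ : ℝ) : ℂ) * x n =
    ((t : ℝ) : ℂ) * ((((interp m t n)⁻¹ : ℝ) : ℂ) * x n)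
  push_cast
  ring

/-- The resolvent without the factor `t` is not norm continuous at `t = 0`: its entries are all
`1/m` there, but tend to `0` as `|n| → ∞` for `t > 0`. The factor `t` repairs this, and only the
scaled resolvent enters the inverse `(1 + R Q_t)⁻¹`. -/
theorem norm_scaledResolv_sub_le (hm : 0 < m) (s t : unitInterval) :
    ‖scaledResolv hm s - scaledResolv hm t‖ ≤ m * |(s : ℝ) - t| := by
  refine norm_diagOp_sub_le _ _ fun n => ?_
  have h1 := one_le_interp hm s n
  have h2 := one_le_interp hm t n
  have h3 : (s : ℝ) * (interp m s n)⁻¹ - t * (interp m t n)⁻¹ =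
      (m * ((s : ℝ) - t)) * ((interp m s n)⁻¹ * (interp m t n)⁻¹) := by
    have e1 : interp m s n ≠ 0 := by positivity
    have e2 : interp m t n ≠ 0 := by positivity
    field_simp
    rw [interp, interp]
    ring
  rw [h3, abs_mul, abs_mul, Nat.abs_cast, abs_mul]
  refine mul_le_of_le_one_right (by positivity) ?_
  exact mul_le_one₀ (abs_inv_interp_le hm s n) (abs_nonneg _) (abs_inv_interp_le hm t n)

/-- `scaledResolv` as a continuous path of operators. -/
def resolvPath (hm : 0 < m) : OpPath where
  toFun := scaledResolv hm
  continuous_toFun := by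
    refine (LipschitzWith.of_dist_le_mul (K := (m : NNReal)) fun s t => ?_).continuous
    rw [dist_eq_norm]
    exact norm_scaledResolv_sub_le hm s t

theorem norm_resolvPath_le (hm : 0 < m) : ‖resolvPath hm‖ ≤ 1 :=
  (ContinuousMap.norm_le _ zero_le_one).2 fun t => norm_diagOp_le _ (abs_mul_inv_interp_le hm t)

/-- The path `(1 + R Q_t)⁻¹`, where `Q_t = scaledResolv t`. -/
def invPath (hm : 0 < m) (R : Seq →L[ℂ] Seq) : OpPath :=
  Ring.inverse (1 + (ContinuousMap.const unitInterval R : OpPath) * resolvPath hm)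

theorem norm_const_mul_resolvPath_le (hm : 0 < m) (R : Seq →L[ℂ] Seq) :
    ‖(ContinuousMap.const unitInterval R : OpPath) * resolvPath hm‖ ≤ ‖R‖ := by
  refine (norm_mul_le (α := OpPath) _ _).trans ?_
  refine (mul_le_of_le_one_right (norm_nonneg _) (norm_resolvPath_le hm)).trans ?_
  exact (ContinuousMap.norm_le _ (norm_nonneg _)).2 fun _ => le_rfl

theorem isUnit_one_add_path (hm : 0 < m) {R : Seq →L[ℂ] Seq} (hR : ‖R‖ < 1) :
    IsUnit (1 + (ContinuousMap.const unitInterval R : OpPath) * resolvPath hm) := by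
  have := isUnit_one_sub_of_norm_lt_one (x := -((ContinuousMap.const unitInterval R : OpPath) *
    resolvPath hm)) (by
      rw [norm_neg]; exact (norm_const_mul_resolvPath_le hm R).trans_lt hR)
  rwa [sub_neg_eq_add] at this

variable {R : Seq →L[ℂ] Seq}

theorem invPath_left (hm : 0 < m) (hR : ‖R‖ < 1) (t : unitInterval) (x : Seq) :
    invPath hm R t (x + R (scaledResolv hm t x)) = x := by
  have h := Ring.inverse_mul_cancel _ (isUnit_one_add_path hm hR)
  have h2 := DFunLike.congr_fun h t
  exact DFunLike.congr_fun h2 x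

theorem invPath_right (hm : 0 < m) (hR : ‖R‖ < 1) (t : unitInterval) (x : Seq) :
    invPath hm R t x + R (scaledResolv hm t (invPath hm R t x)) = x := by
  have h := Ring.mul_inverse_cancel _ (isUnit_one_add_path hm hR)
  have h2 := DFunLike.congr_fun h t
  exact DFunLike.congr_fun h2 x

/-- The resolvent `(m + t (d + R - m))⁻¹`. -/
def pertResolv (hm : 0 < m) (R : Seq →L[ℂ] Seq) (t : unitInterval) : Seq →L[ℂ] Seq :=
  (resolv hm t).comp (invPath hm R t)

/-- With `G = resolv hm t`, writing `x = (1 + t R G) x'`, and likewise for `y`, reduces the claim to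
the symmetry of `G` and of `t G R G`. -/
theorem pertResolv_symm (hm : 0 < m) (hR : ‖R‖ < 1)
    (hsymm : ∀ x y, inner ℂ (R x) y = inner ℂ x (R y)) (t : unitInterval) (x y : Seq) :
    inner ℂ (pertResolv hm R t x) y = inner ℂ x (pertResolv hm R t y) := by
  have hx := invPath_right hm hR t x
  have hy := invPath_right hm hR t y
  rw [pertResolv, ContinuousLinearMap.comp_apply, ContinuousLinearMap.comp_apply]
  set x' := invPath hm R t x
  set y' := invPath hm R t y
  rw [← hx, ← hy]
  have hG : inner ℂ (resolv hm t x') y' = inner ℂ x' (resolv hm t y') :=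
    inner_diagOp_left _ _ x' y'
  rw [inner_add_left, inner_add_right, hG, hsymm, scaledResolv_eq, _root_.smul_apply,
    _root_.smul_apply, map_smul, inner_smul_right, inner_smul_left, Complex.conj_ofReal]

theorem pertResolv_of_mem (hm : 0 < m) (hR : ‖R‖ < 1) {lam : ℝ} (t : unitInterval)
    (hne : (m : ℝ) + t * (lam - m) ≠ 0) {z : Seq} (hz : z ∈ seqEigenspace R lam) :
    pertResolv hm R t z = (((m + t * (lam - m))⁻¹ : ℝ) : ℂ) • z := by
  -- For an eigenvector `z` this is `(m + t(D - m)) z`, expressed without the unbounded `D`.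
  set y : Seq := ((m + t * (lam - m) : ℝ) : ℂ) • z - ((t : ℝ) : ℂ) • R z with hy
  have hGy : resolv hm t y = z := by
    ext n
    have h1 : y n = ((m + t * (lam - m) : ℝ) : ℂ) * z n - ((t : ℝ) : ℂ) * R z n := rfl
    have h2 := hz n
    have h3 : ((interp m t n : ℝ) : ℂ) ≠ 0 := by
      have := one_le_interp hm t n
      exact Complex.ofReal_ne_zero.2 (by positivity)
    change (((interp m t n)⁻¹ : ℝ) : ℂ) * y n = z n
    rw [Complex.ofReal_inv, inv_mul_eq_iff_eq_mul₀ h3, h1, interp]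
    push_cast
    linear_combination (-((t : ℝ) : ℂ)) * h2
  have h4 : y + R (scaledResolv hm t y) = ((m + t * (lam - m) : ℝ) : ℂ) • z := by
    rw [scaledResolv_eq, _root_.smul_apply, hGy, map_smul, hy, sub_add_cancel]
  have h5 := invPath_left hm hR t y
  rw [h4, map_smul] at h5
  have h6 : ((m + t * (lam - m) : ℝ) : ℂ) ≠ 0 := Complex.ofReal_ne_zero.2 hne
  rw [pertResolv, ContinuousLinearMap.comp_apply, Complex.ofReal_inv, eq_inv_smul_iff₀ h6,
    ← map_smul, h5, hGy]

/-- `D ≥ 1` and `‖R‖ < 1`, so `D + R` is positive. -/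
theorem eigenvalue_pos (hR : ‖R‖ < 1) {lam : ℝ} {z : Seq} (hz : z ∈ seqEigenspace R lam)
    (hz0 : z ≠ 0) : 0 < lam := by
  have h1 := lp.hasSum_inner (𝕜 := ℂ) z ((lam : ℂ) • z - R z)
  have h2 := Complex.hasSum_re h1
  have h3 : ‖z‖ ^ 2 ≤ (inner ℂ z ((lam : ℂ) • z - R z) : ℂ).re := by
    refine hasSum_le (fun n => ?_) (hasSum_norm_sq z) h2
    have e1 : ((lam : ℂ) • z - R z : Seq) n = diagVal n * z n := by
      have e2 : ((lam : ℂ) • z - R z : Seq) n = lam * z n - R z n := rfl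
      rw [e2]
      linear_combination -(hz n)
    rw [e1, RCLike.inner_apply, mul_assoc, Complex.mul_conj, Complex.normSq_eq_norm_sq,
      ← Complex.ofReal_mul, Complex.ofReal_re]
    nlinarith [one_le_diagVal n, sq_nonneg ‖z n‖]
  have h4 : (inner ℂ z ((lam : ℂ) • z - R z) : ℂ).re =
      lam * ‖z‖ ^ 2 - (inner ℂ z (R z) : ℂ).re := by
    rw [inner_sub_right, inner_smul_right, Complex.sub_re, inner_self_eq_norm_sq_to_K]
    congr 1
    have : ((lam : ℂ) * ((‖z‖ : ℝ) : ℂ) ^ 2) = ((lam * ‖z‖ ^ 2 : ℝ) : ℂ) := by push_cast; ring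
    exact congrArg Complex.re this
  have h5 : |(inner ℂ z (R z) : ℂ).re| ≤ ‖R‖ * ‖z‖ ^ 2 := by
    refine (Complex.abs_re_le_norm _).trans ((norm_inner_le_norm _ _).trans ?_)
    have := R.le_opNorm z
    nlinarith [norm_nonneg z]
  have h6 : 0 < ‖z‖ ^ 2 := by positivity
  have h7 := (abs_le.1 h5).1
  by_contra hle
  rw [not_lt] at hle
  nlinarith

/-- The eigenvectors of `D + R` are eigenvectors of its bounded symmetric inverse `pertResolv hm R
1`, with reciprocal eigenvalues. -/
theorem orthogonalFamily_seqEigenspace (hm : 0 < m) (hR : ‖R‖ < 1)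
    (hsymm : ∀ x y, inner ℂ (R x) y = inner ℂ x (R y)) :
    OrthogonalFamily ℂ (fun lam : ℝ => seqEigenspace R lam)
      fun lam => (seqEigenspace R lam).subtypeₗᵢ := by
  rintro lam mu hne ⟨u, hu⟩ ⟨v, hv⟩
  change inner ℂ u v = 0
  by_cases hu0 : u = 0
  · rw [hu0, inner_zero_left]
  by_cases hv0 : v = 0
  · rw [hv0, inner_zero_right]
  have hl := eigenvalue_pos hR hu hu0
  have hmu := eigenvalue_pos hR hv hv0
  have h := pertResolv_symm hm hR hsymm 1 u v
  rw [pertResolv_of_mem hm hR 1 (by simpa using hl.ne') hu,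
    pertResolv_of_mem hm hR 1 (by simpa using hmu.ne') hv, inner_smul_left, inner_smul_right,
    Complex.conj_ofReal, ← sub_eq_zero, ← sub_mul, ← Complex.ofReal_sub] at h
  refine (mul_eq_zero.1 h).resolve_left (Complex.ofReal_ne_zero.2 (sub_ne_zero.2 ?_))
  simpa using hne

theorem tendsto_inv_diagVal : Tendsto (fun n => (diagVal n)⁻¹) cofinite (𝓝 0) := by
  refine Tendsto.inv_tendsto_atTop ?_
  have h1 : Tendsto (fun n : ℤ => |(n : ℝ)|) cofinite atTop := by
    have := tendsto_norm_cocompact_atTop (E := ℤ)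
    rw [cocompact_eq_cofinite] at this
    refine this.congr fun n => ?_
    rw [Int.norm_eq_abs]
  refine tendsto_atTop_mono (fun n => ?_) h1
  rw [diagVal]
  split_ifs with h
  · simp [h]
  · exact le_rfl

theorem isCompactOperator_pertResolv_one (hm : 0 < m) (R : Seq →L[ℂ] Seq) :
    IsCompactOperator (pertResolv hm R 1) := by
  refine IsCompactOperator.comp_clm (f := resolv hm 1) ?_ (invPath hm R 1)
  refine isCompactOperator_diagOp _ _ ?_
  simpa [interp] using tendsto_inv_diagVal

/-- The spectral theorem for the compact symmetric operator `(D + R)⁻¹`. An eigenvalue `r ≠ 0` of it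
gives the eigenvalue `r⁻¹` of `D + R`, and `r = 0` has no eigenvector. -/
theorem iSup_seqEigenspace_orthogonal (hm : 0 < m) (hR : ‖R‖ < 1)
    (hsymm : ∀ x y, inner ℂ (R x) y = inner ℂ x (R y)) :
    (⨆ lam : ℝ, seqEigenspace R lam)ᗮ = ⊥ := by
  have hs : (pertResolv hm R 1).IsSymmetric := pertResolv_symm hm hR hsymm 1
  have h := ContinuousLinearMap.orthogonalComplement_iSup_eigenspaces_eq_bot
    (isCompactOperator_pertResolv_one hm R) hs
  rw [eq_bot_iff, ← h]
  refine Submodule.orthogonal_le (iSup_le fun mu => ?_)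
  by_cases hbot : Module.End.eigenspace (pertResolv hm R 1 : Module.End ℂ Seq) mu = ⊥
  · rw [hbot]; exact bot_le
  have hreal : (starRingEnd ℂ) mu = mu :=
    LinearMap.IsSymmetric.conj_eigenvalue_eq_self hs (Module.End.hasEigenvalue_iff.2 hbot)
  obtain ⟨r, rfl⟩ := Complex.conj_eq_iff_real.1 hreal
  intro z hz
  rw [Module.End.mem_eigenspace_iff] at hz
  have hzero : resolv hm 1 (invPath hm R 1 z) = (r : ℂ) • z := hz
  have hy := invPath_right hm hR 1 z
  set y := invPath hm R 1 z
  rw [scaledResolv_eq, _root_.smul_apply, hzero, Set.Icc.coe_one, Complex.ofReal_one, one_smul,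
    map_smul] at hy
  have hyn : ∀ n, y n = r * (diagVal n * z n) := by
    intro n
    have h3 : ((diagVal n : ℝ) : ℂ) ≠ 0 := by
      have := one_le_diagVal n
      exact Complex.ofReal_ne_zero.2 (by positivity)
    have h4 : (((interp m 1 n)⁻¹ : ℝ) : ℂ) * y n = r * z n := congrArg (fun x : Seq => x n) hzero
    rw [interp, Set.Icc.coe_one, one_mul, add_sub_cancel, Complex.ofReal_inv,
      inv_mul_eq_iff_eq_mul₀ h3] at h4
    rw [h4]
    ring
  have hzn : ∀ n, (r : ℂ) * (diagVal n * z n + R z n) = z n := by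
    intro n
    have h5 : y n + r * R z n = z n := congrArg (fun x : Seq => x n) hy
    rw [hyn] at h5
    linear_combination h5
  by_cases hr : r = 0
  · have : z = 0 := by
      ext n
      rw [← hzn n, hr]
      simp
    rw [this]
    exact zero_mem _
  · refine Submodule.mem_iSup_of_mem r⁻¹ fun n => ?_
    have hr' : (r : ℂ) ≠ 0 := Complex.ofReal_ne_zero.2 hr
    rw [Complex.ofReal_inv, eq_inv_mul_iff_mul_eq₀ hr']
    exact hzn n

end Resolvent

/-! ### The logarithm of the perturbed operator -/

/-- The retraction of the real line onto the unit interval. -/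
def clamp (t : ℝ) : unitInterval := Set.projIcc 0 1 zero_le_one t

theorem continuous_clamp : Continuous clamp :=
  continuous_projIcc (h := zero_le_one)

theorem clamp_coe {t : ℝ} (ht : t ∈ Set.Icc (0 : ℝ) 1) : (clamp t : ℝ) = t := by
  rw [clamp, Set.projIcc_of_mem zero_le_one ht]

theorem sub_mul_integral_inv {m lam : ℝ} (hm : 0 < m) (hl : 0 < lam) :
    (lam - m) * ∫ t in (0 : ℝ)..1, (m + t * (lam - m))⁻¹ = Real.log lam - Real.log m := by
  have hpos : ∀ t ∈ Set.uIcc (0 : ℝ) 1, 0 < m + t * (lam - m) := by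
    intro t ht
    rw [Set.uIcc_of_le zero_le_one] at ht
    rcases ht.1.eq_or_lt with h | h
    · rw [← h]; simpa using hm
    · nlinarith [mul_nonneg (sub_nonneg.2 ht.2) hm.le, mul_pos h hl]
  rw [← intervalIntegral.integral_const_mul]
  have h : ∀ t ∈ Set.uIcc (0 : ℝ) 1, HasDerivAt (fun t : ℝ => Real.log (m + t * (lam - m)))
      ((lam - m) * (m + t * (lam - m))⁻¹) t := by
    intro t ht
    have h1 : HasDerivAt (fun t : ℝ => m + t * (lam - m)) (lam - m) t := by
      simpa using ((hasDerivAt_id t).mul_const (lam - m)).const_add m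
    exact h1.log (hpos t ht).ne'
  rw [intervalIntegral.integral_eq_sub_of_hasDerivAt h]
  · simp
  · refine ContinuousOn.intervalIntegrable (ContinuousOn.mul continuousOn_const ?_)
    exact ContinuousOn.inv₀ (by fun_prop) fun t ht => (hpos t ht).ne'

section LogVec

variable {m : ℕ} {R : Seq →L[ℂ] Seq}

theorem starProjection_pertResolv (hm : 0 < m) (hR : ‖R‖ < 1)
    (hsymm : ∀ x y, inner ℂ (R x) y = inner ℂ x (R y)) {lam : ℝ} (t : unitInterval)
    (hne : (m : ℝ) + t * (lam - m) ≠ 0) (x : Seq) :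
    (seqEigenspace R lam).starProjection (pertResolv hm R t x) =
      (((m + t * (lam - m))⁻¹ : ℝ) : ℂ) • (seqEigenspace R lam).starProjection x := by
  rw [← map_smul, ← sub_eq_zero, ← map_sub, Submodule.starProjection_apply_eq_zero_iff,
    Submodule.mem_orthogonal]
  intro z hz
  rw [inner_sub_right, inner_smul_right, ← pertResolv_symm hm hR hsymm,
    pertResolv_of_mem hm hR t hne hz, inner_smul_left, Complex.conj_ofReal, sub_self]

/-- Because `D e_m = m e_m`, the vector `R e_m` is `(D + R - m) e_m`. -/
theorem starProjection_pert_unitVec (hm : 0 < m)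
    (hsymm : ∀ x y, inner ℂ (R x) y = inner ℂ x (R y)) (lam : ℝ) :
    (seqEigenspace R lam).starProjection (R (unitVec m)) =
      ((lam - m : ℝ) : ℂ) • (seqEigenspace R lam).starProjection (unitVec m) := by
  rw [← map_smul, ← sub_eq_zero, ← map_sub, Submodule.starProjection_apply_eq_zero_iff,
    Submodule.mem_orthogonal]
  intro z hz
  have h1 := hz m
  rw [inner_sub_right, inner_smul_right, ← hsymm, ← inner_conj_symm, ← inner_conj_symm z,
    inner_unitVec, inner_unitVec]
  have h2 : R z m = ((lam - m : ℝ) : ℂ) * z m := by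
    rw [diagVal_natCast hm] at h1
    push_cast at h1 ⊢
    linear_combination h1
  rw [h2, map_mul, Complex.conj_ofReal, sub_self]

theorem integrable_pertResolv (hm : 0 < m) (R : Seq →L[ℂ] Seq) (v : Seq) :
    IntervalIntegrable (fun t => pertResolv hm R (clamp t) v) volume 0 1 := by
  rw [intervalIntegrable_iff_integrableOn_Ioc_of_le zero_le_one]
  refine IntegrableOn.of_bound (C := ‖invPath hm R‖ * ‖v‖) (by simp) ?_ ?_
  · have hc : Continuous fun t : ℝ => resolvPath hm (clamp t) (invPath hm R (clamp t) v) :=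
      ((resolvPath hm).continuous.comp continuous_clamp).clm_apply
        (((invPath hm R).continuous.comp continuous_clamp).clm_apply continuous_const)
    -- Norm continuity is available only for the scaled resolvent, so measurability is checked on
    -- `(0, 1]`, where division by `t` is harmless.
    have h1 : ContinuousOn (fun t : ℝ => ((t⁻¹ : ℝ) : ℂ) •
        resolvPath hm (clamp t) (invPath hm R (clamp t) v)) (Set.Ioc 0 1) := by
      have hinv : ContinuousOn (fun t : ℝ => ((t⁻¹ : ℝ) : ℂ)) (Set.Ioc 0 1) :=
        Complex.continuous_ofReal.comp_continuousOn
          (continuousOn_inv₀.mono fun t ht => ht.1.ne')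
      exact hinv.smul hc.continuousOn
    refine (h1.congr fun t ht => ?_).aestronglyMeasurable measurableSet_Ioc
    have h2 : resolvPath hm (clamp t) = ((t : ℝ) : ℂ) • resolv hm (clamp t) := by
      rw [← clamp_coe (Set.Ioc_subset_Icc_self ht)]
      simp only [clamp_coe (Set.Ioc_subset_Icc_self ht)]
      exact (scaledResolv_eq hm (clamp t)).trans
        (by rw [clamp_coe (Set.Ioc_subset_Icc_self ht)])
    have h3 : (t : ℂ) ≠ 0 := Complex.ofReal_ne_zero.2 ht.1.ne'
    rw [h2, _root_.smul_apply, smul_smul, Complex.ofReal_inv, inv_mul_cancel₀ h3, one_smul]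
    rfl
  · refine (ae_restrict_iff' measurableSet_Ioc).2 (Eventually.of_forall fun t _ => ?_)
    rw [pertResolv, ContinuousLinearMap.comp_apply]
    refine ((resolv hm (clamp t)).le_opNorm _).trans ?_
    have h1 : ‖resolv hm (clamp t)‖ ≤ 1 := norm_diagOp_le _ _
    refine (mul_le_of_le_one_left (norm_nonneg _) h1).trans ?_
    refine ((invPath hm R (clamp t)).le_opNorm _).trans ?_
    gcongr
    exact (invPath hm R).norm_coe_le_norm _

/-- The vector `ln(diag(d) + R) e_m`. -/
def logVec (hm : 0 < m) (R : Seq →L[ℂ] Seq) : Seq :=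
  (Real.log m : ℂ) • unitVec m + ∫ t in (0 : ℝ)..1, pertResolv hm R (clamp t) (R (unitVec m))

/-- On the eigenspace of `λ` the integrand becomes `(λ - m)(m + t(λ - m))⁻¹`, whose integral is `ln
λ - ln m`. Since the eigenspaces span, this identifies `logVec` with the spectral series. -/
theorem starProjection_logVec (hm : 0 < m) (hR : ‖R‖ < 1)
    (hsymm : ∀ x y, inner ℂ (R x) y = inner ℂ x (R y)) (lam : ℝ) :
    (seqEigenspace R lam).starProjection (logVec hm R) =
      (Real.log lam : ℂ) • (seqEigenspace R lam).starProjection (unitVec m) := by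
  by_cases hbot : seqEigenspace R lam = ⊥
  · have h0 : ∀ x, (seqEigenspace R lam).starProjection x = 0 := fun x => by
      rw [Submodule.starProjection_apply_eq_zero_iff, hbot]
      simp
    rw [h0, h0, smul_zero]
  obtain ⟨z, hz, hz0⟩ := (Submodule.ne_bot_iff _).1 hbot
  have hl := eigenvalue_pos hR hz hz0
  have hm' : (0 : ℝ) < m := by exact_mod_cast hm
  set Pr := (seqEigenspace R lam).starProjection
  have hIntegral : Pr (∫ t in (0 : ℝ)..1, pertResolv hm R (clamp t) (R (unitVec m))) =
      ((Real.log lam - Real.log m : ℝ) : ℂ) • Pr (unitVec m) := by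
    rw [← ContinuousLinearMap.intervalIntegral_comp_comm _ (integrable_pertResolv hm R _)]
    have e1 : ∀ t ∈ Set.uIcc (0 : ℝ) 1, Pr (pertResolv hm R (clamp t) (R (unitVec m))) =
        (((m + t * (lam - m))⁻¹ : ℝ) : ℂ) • (((lam - m : ℝ) : ℂ) • Pr (unitVec m)) := by
      intro t ht
      rw [Set.uIcc_of_le zero_le_one] at ht
      have hne : (m : ℝ) + (clamp t : ℝ) * (lam - m) ≠ 0 := by
        rw [clamp_coe ht]
        refine ne_of_gt ?_
        rcases ht.1.eq_or_lt with h | h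
        · rw [← h]; simpa using hm'
        · nlinarith [mul_nonneg (sub_nonneg.2 ht.2) hm'.le, mul_pos h hl]
      rw [starProjection_pertResolv hm hR hsymm _ hne, starProjection_pert_unitVec hm hsymm,
        clamp_coe ht]
    rw [intervalIntegral.integral_congr e1, intervalIntegral.integral_smul_const,
      intervalIntegral.integral_ofReal, smul_smul, ← Complex.ofReal_mul, mul_comm,
      sub_mul_integral_inv hm' hl]
  rw [logVec, map_add, map_smul, hIntegral, ← add_smul]
  push_cast
  rw [add_sub_cancel]

theorem hasSum_log_starProjection (hm : 0 < m) (hR : ‖R‖ < 1)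
    (hsymm : ∀ x y, inner ℂ (R x) y = inner ℂ x (R y)) :
    HasSum (fun lam : ℝ => (Real.log lam : ℂ) •
      (seqEigenspace R lam).starProjection (unitVec m)) (logVec hm R) := by
  have h := hasSum_starProjection (orthogonalFamily_seqEigenspace hm hR hsymm)
    (iSup_seqEigenspace_orthogonal hm hR hsymm) (logVec hm R)
  simpa only [starProjection_logVec hm hR hsymm] using h

variable (m) in
/-- The functional `X ↦ ∫₀¹ ⟨e_m, X_t e_m⟩ dt` on paths of operators. -/
def meanEntry : OpPath →L[ℂ] ℂ :=
  LinearMap.mkContinuous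
    { toFun := fun X => ∫ t in (0 : ℝ)..1, inner ℂ (unitVec m) (X (clamp t) (unitVec m))
      map_add' := fun X Y => by
        rw [← intervalIntegral.integral_add]
        · simp
        all_goals
          refine Continuous.intervalIntegrable ?_ _ _
          refine continuous_const.inner (Continuous.clm_apply ?_ continuous_const)
          exact (ContinuousMap.continuous _).comp continuous_clamp
      map_smul' := fun c X => by
        simp }
    1 fun X => by
      have := intervalIntegral.norm_integral_le_of_norm_le_const (a := 0) (b := 1) (C := ‖X‖)
        (f := fun t => inner ℂ (unitVec m) (X (clamp t) (unitVec m))) fun t _ => by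
        refine (norm_inner_le_norm _ _).trans ?_
        rw [norm_unitVec, one_mul]
        refine ((X (clamp t)).le_opNorm _).trans ?_
        rw [norm_unitVec, mul_one]
        exact X.norm_coe_le_norm _
      simpa using this

theorem meanEntry_apply (X : OpPath) : meanEntry m X =
    ∫ t in (0 : ℝ)..1, inner ℂ (unitVec m) (X (clamp t) (unitVec m)) := rfl

/-- The path with constant value `R`. -/
def constPath : (Seq →L[ℂ] Seq) →L[ℂ] OpPath :=
  LinearMap.mkContinuous
    { toFun := fun R => ContinuousMap.const unitInterval R
      map_add' := fun _ _ => rfl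
      map_smul' := fun _ _ => rfl }
    1 fun R => by
      rw [one_mul]
      exact (ContinuousMap.norm_le _ (norm_nonneg _)).2 fun _ => le_rfl

theorem constPath_apply (R : Seq →L[ℂ] Seq) (t : unitInterval) : constPath R t = R := rfl

/-- `⟨ln(diag(d) + R) e_m, e_m⟩` as a function of `R`. -/
def logEntry (hm : 0 < m) (R : Seq →L[ℂ] Seq) : ℂ :=
  Real.log m + (m : ℂ)⁻¹ * meanEntry m (Ring.inverse (1 + constPath R * resolvPath hm) *
    constPath R)

/-- The left factor `resolv` of the perturbed resolvent is moved onto `e_m`, where it acts as `m⁻¹`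
for every `t`; what remains is norm continuous in `t`. -/
theorem inner_logVec (hm : 0 < m) (R : Seq →L[ℂ] Seq) :
    inner ℂ (unitVec m) (logVec hm R) = logEntry hm R := by
  have h1 : inner ℂ (unitVec m) (∫ t in (0 : ℝ)..1, pertResolv hm R (clamp t) (R (unitVec m))) =
      ∫ t in (0 : ℝ)..1, inner ℂ (unitVec m) (pertResolv hm R (clamp t) (R (unitVec m))) :=
    ((innerSL ℂ (unitVec m)).intervalIntegral_comp_comm (integrable_pertResolv hm R _)).symm
  rw [logVec, inner_add_right, inner_smul_right, h1, inner_self_eq_norm_sq_to_K, norm_unitVec,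
    logEntry, meanEntry_apply, ← intervalIntegral.integral_const_mul]
  congr 1
  · simp
  · refine intervalIntegral.integral_congr fun t _ => ?_
    have h2 : inner ℂ (unitVec m) (resolv hm (clamp t) (invPath hm R (clamp t) (R (unitVec m)))) =
        inner ℂ (resolv hm (clamp t) (unitVec m)) (invPath hm R (clamp t) (R (unitVec m))) :=
      (inner_diagOp_left _ _ _ _).symm
    simp only [pertResolv, ContinuousLinearMap.comp_apply]
    rw [h2, resolv, diagOp_unitVec, inner_smul_left, interp, diagVal_natCast hm, sub_self,
      mul_zero, add_zero, Complex.conj_ofReal, Complex.ofReal_inv, Complex.ofReal_natCast]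
    rfl

/-- The inverse is taken once, in the Banach algebra of continuous operator paths. Its smoothness
there replaces differentiation under the integral over `t`. -/
theorem contDiffAt_logEntry (hm : 0 < m) (hR : ‖R‖ < 1) :
    ContDiffAt ℂ ∞ (logEntry hm) R := by
  have h1 : ContDiff ℂ ∞ fun R => 1 + constPath R * resolvPath hm :=
    contDiff_const.add (constPath.contDiff.mul contDiff_const)
  obtain ⟨u, hu⟩ := isUnit_one_add_path hm hR
  have h2 : ContDiffAt ℂ ∞ Ring.inverse (1 + constPath R * resolvPath hm) := by
    have := contDiffAt_ringInverse ℂ u (n := ∞)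
    rwa [hu] at this
  have h3 := h2.comp R h1.contDiffAt
  have h4 := (meanEntry m).contDiff.contDiffAt.comp R (h3.mul constPath.contDiff.contDiffAt)
  exact contDiffAt_const.add (contDiffAt_const.mul h4)

/-- The second order term in the expansion of `logEntry`. -/
def quadTerm (hm : 0 < m) (R : Seq →L[ℂ] Seq) : ℂ :=
  meanEntry m (constPath R * resolvPath hm * constPath R)

theorem quadTerm_smul (hm : 0 < m) (c : ℂ) (R : Seq →L[ℂ] Seq) :
    quadTerm hm (c • R) = c ^ 2 * quadTerm hm R := by
  rw [quadTerm, quadTerm, map_smul, smul_mul_assoc, smul_mul_smul_comm, map_smul, smul_eq_mul, sq]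

theorem continuous_quadTerm (hm : 0 < m) : Continuous (quadTerm hm) :=
  (meanEntry m).continuous.comp
    ((constPath.continuous.mul continuous_const).mul constPath.continuous)

theorem meanEntry_constPath (R : Seq →L[ℂ] Seq) : meanEntry m (constPath R) = R (unitVec m) m := by
  rw [meanEntry_apply]
  simp [constPath_apply, inner_unitVec]

/-- This is `(1 + X)⁻¹ = 1 - X + O(‖X‖²)` for `X = R Q_t`, multiplied by `R` on the right. -/
theorem logEntry_expansion (hm : 0 < m) :
    (fun R : Seq →L[ℂ] Seq => logEntry hm R - (Real.log m + (m : ℂ)⁻¹ * (R (unitVec m) m -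
      quadTerm hm R))) =O[𝓝 0] fun R : Seq →L[ℂ] Seq => ‖R‖ ^ 3 := by
  have h1 := NormedRing.inverse_add_norm_diff_second_order (1 : OpPathˣ)
  have h2 : Tendsto (fun R : Seq →L[ℂ] Seq => constPath R * resolvPath hm) (𝓝 0) (𝓝 0) := by
    have : Continuous fun R : Seq →L[ℂ] Seq => constPath R * resolvPath hm :=
      constPath.continuous.mul continuous_const
    simpa using this.tendsto 0
  have h3 := h1.comp_tendsto h2
  have h4 : (fun R : Seq →L[ℂ] Seq => ‖constPath R * resolvPath hm‖ ^ 2) =O[𝓝 0]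
      fun R : Seq →L[ℂ] Seq => ‖R‖ ^ 2 := by
    refine IsBigO.of_bound 1 (Eventually.of_forall fun R => ?_)
    rw [one_mul, norm_pow, norm_pow, norm_norm, norm_norm]
    exact pow_le_pow_left₀ (norm_nonneg _) (norm_const_mul_resolvPath_le hm R) 2
  have h5 : (fun R : Seq →L[ℂ] Seq => constPath R) =O[𝓝 0] fun R : Seq →L[ℂ] Seq => ‖R‖ :=
    (constPath.isBigO_id _).norm_right
  have h6 := (h3.trans h4).mul h5
  have h7 := (((meanEntry m).isBigO_comp _ (𝓝 0)).trans h6).const_mul_left ((m : ℂ)⁻¹)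
  refine h7.congr (fun R => ?_) fun R => ?_
  · simp only [Function.comp_apply, Units.val_one, inv_one, one_mul, mul_one]
    rw [add_mul, sub_mul, one_mul, map_add, map_sub, logEntry, meanEntry_constPath, quadTerm]
    ring
  · ring

/-- The averages of `t / (m + t (d_k - m))` over the unit interval. -/
def meanResolv (m : ℕ) (k : ℤ) : ℝ := ∫ t in (0 : ℝ)..1, t * (m + t * (diagVal k - m))⁻¹

/-- By symmetry the integrand is `⟨R e_m, Q_t R e_m⟩` with `Q_t` diagonal. The entries of `Q_t` are
at most `1`, so the series is integrated termwise by domination. -/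
theorem hasSum_quadTerm (hm : 0 < m) (hsymm : ∀ x y, inner ℂ (R x) y = inner ℂ x (R y)) :
    HasSum (fun k : ℤ => ((meanResolv m k * ‖R (unitVec m) k‖ ^ 2 : ℝ) : ℂ)) (quadTerm hm R) := by
  set v := R (unitVec m) with hv
  have h1 : quadTerm hm R = ∫ t in (0 : ℝ)..1, inner ℂ v (scaledResolv hm (clamp t) v) := by
    rw [quadTerm, meanEntry_apply]
    refine intervalIntegral.integral_congr fun t _ => ?_
    change inner ℂ (unitVec m) (R (scaledResolv hm (clamp t) v)) = _
    rw [← hsymm]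
  have h2 : ∀ k, ((meanResolv m k * ‖v k‖ ^ 2 : ℝ) : ℂ) =
      ∫ t in (0 : ℝ)..1, inner ℂ (v k) (scaledResolv hm (clamp t) v k) := by
    intro k
    rw [meanResolv, ← intervalIntegral.integral_mul_const, ← intervalIntegral.integral_ofReal]
    refine intervalIntegral.integral_congr fun t ht => ?_
    rw [Set.uIcc_of_le zero_le_one] at ht
    rw [scaledResolv, diagOp_apply, clamp_coe ht, interp, clamp_coe ht, RCLike.inner_apply,
      mul_assoc _ (v k), Complex.mul_conj, Complex.normSq_eq_norm_sq, ← Complex.ofReal_mul]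
  rw [h1]
  simp_rw [h2]
  refine intervalIntegral.hasSum_integral_of_dominated_convergence (fun k _ => ‖v k‖ ^ 2)
    (fun k => ?_) (fun k => ?_) ?_ ?_ ?_
  · refine Continuous.aestronglyMeasurable ?_
    have : Continuous fun t : ℝ => inner ℂ (unitVec k) (resolvPath hm (clamp t) v) :=
      continuous_const.inner
        (((resolvPath hm).continuous.comp continuous_clamp).clm_apply continuous_const)
    simp only [inner_unitVec] at this
    exact continuous_const.inner this
  · refine Eventually.of_forall fun t _ => ?_
    refine (norm_inner_le_norm _ _).trans ?_
    rw [scaledResolv, diagOp_apply, norm_mul, Complex.norm_real, sq]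
    refine mul_le_mul_of_nonneg_left ?_ (norm_nonneg _)
    exact mul_le_of_le_one_left (norm_nonneg _) (abs_mul_inv_interp_le hm _ k)
  · exact Eventually.of_forall fun t _ => summable_norm_sq v
  · exact intervalIntegrable_const
  · exact Eventually.of_forall fun t _ => lp.hasSum_inner v _

end LogVec

/-! ### The matrix of `Λ_a` in the basis `φ_n` -/

/-- Symmetry of `diag(d) + R` on its maximal domain: in the termwise difference of the two series
the real diagonal cancels. -/
theorem inner_eq_inner_of_diag {R : Seq →L[ℂ] Seq}
    (hsymm : ∀ x y, inner ℂ (R x) y = inner ℂ x (R y)) (d : ℤ → ℤ) {x x' y y' : Seq}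
    (hx : ∀ k, x' k = (d k : ℂ) * x k + R x k) (hy : ∀ k, y' k = (d k : ℂ) * y k + R y k) :
    inner ℂ y x' = inner ℂ y' x := by
  have h1 := (lp.hasSum_inner (𝕜 := ℂ) y x').sub (lp.hasSum_inner (𝕜 := ℂ) y' x)
  have h2 := (lp.hasSum_inner (𝕜 := ℂ) y (R x)).sub (lp.hasSum_inner (𝕜 := ℂ) (R y) x)
  rw [hsymm, sub_self] at h2
  rw [← sub_eq_zero]
  refine h1.unique (h2.congr_fun fun k => ?_)
  rw [hx k, hy k]
  simp only [RCLike.inner_apply, map_add, map_mul, map_intCast]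
  ring

namespace Weight

variable (a : Weight)

theorem repr_apply (u : L2) (k : ℤ) : a.basis.repr u k = inner ℂ (a.phi k) u := by
  rw [a.basis.repr_apply_apply, a.coe_basis]

theorem repr_phi (n : ℤ) : a.basis.repr (a.phi n) = unitVec n := by
  rw [← a.coe_basis]
  exact a.basis.repr_self n

/-- `R` is the matrix of `Λ_a`, in the basis `φ_n`, minus its diagonal part `|n|`. -/
def HasPert (R : Seq →L[ℂ] Seq) : Prop :=
  ∀ k n : ℤ, R (unitVec n) k =
    inner ℂ (a.phi k) (a.steklovPhi n) - if k = n then ((|n| : ℤ) : ℂ) else 0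

namespace HasPert

variable {a} {R : Seq →L[ℂ] Seq}

theorem repr_steklovPhi (h : a.HasPert R) (n : ℤ) :
    a.basis.repr (a.steklovPhi n) = ((|n| : ℤ) : ℂ) • unitVec n + R (unitVec n) := by
  ext k
  rw [repr_apply, lp.coeFn_add, Pi.add_apply, h k n, lp.coeFn_smul, Pi.smul_apply, unitVec_apply]
  split_ifs <;> simp

theorem symm (h : a.HasPert R) (x y : Seq) : inner ℂ (R x) y = inner ℂ x (R y) := by
  have h1 : ∀ k n, inner ℂ (R (unitVec k)) (unitVec n) = R (unitVec n) k := by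
    intro k n
    rw [← inner_conj_symm, inner_unitVec, h n k, h k n, map_sub, inner_conj_symm,
      a.isSteklov_symm (a.isSteklov_steklovPhi k) (a.isSteklov_steklovPhi n)]
    by_cases hkn : k = n
    · subst hkn; simp
    · simp [hkn, Ne.symm hkn]
  have h2 : ∀ k y, inner ℂ (R (unitVec k)) y = R y k := by
    intro k y
    have e : innerSL ℂ (R (unitVec k)) = (innerSL ℂ (unitVec k)).comp R := by
      refine lp.ext_continuousLinearMap (by simp) fun n => ?_
      ext
      have h1' := h1 k n
      rw [← inner_unitVec] at h1'
      simpa [unitVec] using h1'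
    have := DFunLike.congr_fun e y
    simpa [inner_unitVec] using this
  have h3 : ContinuousLinearMap.adjoint R = R := by
    ext y k
    rw [← inner_unitVec, ContinuousLinearMap.adjoint_inner_right, h2]
  rw [← ContinuousLinearMap.adjoint_inner_right, h3]

/-- The converse says that the coordinates do not enlarge the domain. Pairing with `a^{-1/2} e`, for
a Fourier mode `e` of frequency `n`, whose image under `Λ_a` is `|n| a^{1/2} e`, recovers the
coefficients of `Λ (a^{1/2} u)`. -/
theorem isSteklov_iff (h : a.HasPert R) (u v : L2) : a.IsSteklov u v ↔
    ∀ k, a.basis.repr v k = ((|k| : ℤ) : ℂ) * a.basis.repr u k + R (a.basis.repr u) k := by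
  have key : ∀ {u v : L2}, a.IsSteklov u v → ∀ k,
      a.basis.repr v k = ((|k| : ℤ) : ℂ) * a.basis.repr u k + R (a.basis.repr u) k := by
    intro u v huv k
    rw [repr_apply, ← a.isSteklov_symm (a.isSteklov_steklovPhi k) huv,
      ← a.basis.repr.inner_map_map, h.repr_steklovPhi, inner_add_left, inner_smul_left,
      inner_unitVec, h.symm, inner_unitVec]
    simp
  refine ⟨key, fun hv => ⟨mulOp a.invSqrtMap v, ?_, (a.mulOp_sqrt_invSqrt v).symm⟩⟩
  rw [isLambda_iff]
  intro n
  have hg : a.IsSteklov (mulOp a.invSqrtMap (one.phi n))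
      (((|n| : ℤ) : ℂ) • mulOp a.sqrtMap (one.phi n)) := by
    refine ⟨((|n| : ℤ) : ℂ) • one.phi n, ?_, by rw [map_smul]⟩
    rw [isLambda_iff, a.mulOp_sqrt_invSqrt]
    intro k
    rw [inner_smul_right, orthonormal_iff_ite.1 one.orthonormal_phi]
    split_ifs with hk
    · rw [hk]
    · simp
  have h3 := inner_eq_inner_of_diag h.symm _ hv (key hg)
  rw [a.basis.repr.inner_map_map, a.basis.repr.inner_map_map] at h3
  rw [← inner_mulOp_invSqrt, h3, inner_smul_left, inner_mulOp_sqrt]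
  simp

theorem mem_eigenspace_iff (h : a.HasPert R) (lam : ℝ) (u : L2) :
    u ∈ a.eigenspace lam ↔ a.basis.repr u ∈ seqEigenspace R lam := by
  have hP : ∀ k, a.basis.repr (a.P0 u) k = if k = 0 then a.basis.repr u k else 0 := by
    intro k
    rw [P0_apply, map_smul, repr_phi, lp.coeFn_smul, Pi.smul_apply, unitVec_apply]
    split_ifs with hk
    · rw [hk, repr_apply]; simp
    · simp
  have hd : ∀ k : ℤ, (diagVal k : ℂ) * a.basis.repr u k =
      ((|k| : ℤ) : ℂ) * a.basis.repr u k + a.basis.repr (a.P0 u) k := by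
    intro k
    rw [hP, diagVal]
    split_ifs with hk
    · simp [hk]
    · rw [← Int.cast_abs, Complex.ofReal_intCast, add_zero]
  rw [a.mem_eigenspace, mem_seqEigenspace]
  constructor
  · rintro ⟨v, hv, e⟩ k
    have e1 := congrArg (fun x => a.basis.repr x k) e
    simp only [map_add, map_smul, lp.coeFn_add, lp.coeFn_smul, Pi.add_apply, Pi.smul_apply,
      smul_eq_mul] at e1
    rw [hd, ← e1, (h.isSteklov_iff u v).1 hv k]
    ring
  · intro hu
    refine ⟨(lam : ℂ) • u - a.P0 u, (h.isSteklov_iff _ _).2 fun k => ?_, by abel⟩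
    rw [map_sub, map_smul, lp.coeFn_sub, Pi.sub_apply, lp.coeFn_smul, Pi.smul_apply, smul_eq_mul,
      ← hu k, hd]
    ring

theorem eigenspace_eq_map (h : a.HasPert R) (lam : ℝ) : a.eigenspace lam =
    (seqEigenspace R lam).map (a.basis.repr.symm.toLinearEquiv : Seq →ₗ[ℂ] L2) := by
  ext u
  rw [h.mem_eigenspace_iff, Submodule.mem_map]
  constructor
  · exact fun hu => ⟨_, hu, a.basis.repr.symm_apply_apply u⟩
  · rintro ⟨x, hx, rfl⟩
    change a.basis.repr (a.basis.repr.symm x) ∈ _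
    rwa [LinearIsometryEquiv.apply_symm_apply]

theorem lnDiag_eq (h : a.HasPert R) {m : ℕ} (hm : 0 < m) (hR : ‖R‖ < 1) :
    a.lnDiag m = logEntry hm R := by
  have h1 : ∀ lam : ℝ, a.lnTerm (a.phi m) lam = a.basis.repr.symm ((Real.log lam : ℂ) •
      (seqEigenspace R lam).starProjection (unitVec m)) := by
    intro lam
    have e := Submodule.starProjection_map_apply a.basis.repr.symm (seqEigenspace R lam) (a.phi m)
    rw [LinearIsometryEquiv.symm_symm, repr_phi] at e
    rw [lnTerm, map_smul, ← e]
    simp only [h.eigenspace_eq_map lam]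
  have h2 : HasSum (a.lnTerm (a.phi m)) (a.basis.repr.symm (logVec hm R)) := by
    rw [funext h1]
    exact (hasSum_log_starProjection hm hR h.symm).mapL
      (a.basis.repr.symm.toContinuousLinearEquiv : Seq →L[ℂ] L2)
  rw [lnDiag, pairing, lnOp, h2.tsum_eq, ← a.basis.repr.inner_map_map, repr_phi,
    LinearIsometryEquiv.apply_symm_apply, inner_logVec]

end HasPert

end Weight

/-! ### Smooth periodic families of weights -/

/-- A smooth family of weights that is `2π`-periodic in the parameter. -/
structure IsSmoothLoop (A : ℝ → Weight) : Prop where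
  smooth : ContDiff ℝ ∞ fun q : ℝ × ℝ => A q.1 (q.2 : Circ)
  periodic : ∀ σ x, A (σ + 2 * Real.pi) x = A σ x

/-- The functions `∫₀^θ a⁻¹` of a family of weights. -/
def phase (A : ℝ → Weight) (q : ℝ × ℝ) : ℝ := (A q.1).angle q.2

namespace IsSmoothLoop

variable {A : ℝ → Weight}

theorem contDiff_inv (hA : IsSmoothLoop A) :
    ContDiff ℝ ∞ fun q : ℝ × ℝ => (A q.1 (q.2 : Circ))⁻¹ :=
  hA.smooth.inv fun q => ((A q.1).pos _).ne'

/-- The substitution `s = u θ` moves `θ` from the limit of integration into the integrand. -/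
theorem contDiff_phase (hA : IsSmoothLoop A) : ContDiff ℝ ∞ (phase A) := by
  have h1 : phase A = fun q : ℝ × ℝ => q.2 * ∫ u in (0 : ℝ)..1,
      (A q.1 ((u * q.2 : ℝ) : Circ))⁻¹ := by
    funext q
    have := intervalIntegral.mul_integral_comp_mul_right (a := 0) (b := 1)
      (f := fun s : ℝ => (A q.1 (s : Circ))⁻¹) (c := q.2)
    rw [this, zero_mul, one_mul]
    rfl
  rw [h1]
  refine contDiff_snd.mul ?_
  have h2 : ContDiff ℝ ∞ fun z : (ℝ × ℝ) × ℝ => (A z.1.1 ((z.2 * z.1.2 : ℝ) : Circ))⁻¹ :=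
    hA.contDiff_inv.comp ((contDiff_fst.comp contDiff_fst).prodMk
      (contDiff_snd.mul (contDiff_snd.comp contDiff_fst)))
  exact contDiff_parametric_intervalIntegral h2 0 1

theorem isPhase (hA : IsSmoothLoop A) : IsPhase (phase A) where
  smooth := hA.contDiff_phase
  periodic σ θ := by simp only [phase, Weight.angle, hA.periodic]
  add_two_pi σ θ := (A σ).angle_add_two_pi θ
  deriv_pos q := by
    have h1 := (hA.contDiff_phase.differentiable (by simp) q).hasFDerivAt
    have h2 : HasDerivAt (fun θ : ℝ => (q.1, θ)) ((0 : ℝ), (1 : ℝ)) q.2 :=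
      (hasDerivAt_const q.2 q.1).prodMk (hasDerivAt_id q.2)
    have h3 := h1.comp_hasDerivAt q.2 h2
    rw [h3.unique ((A q.1).hasDerivAt_angle q.2)]
    exact inv_pos.2 ((A q.1).pos _)

/-- The amplitude `1` does not involve `r`, so `r` is free to encode the ratio of `n` and `j`. -/
theorem coef_eq (A : ℝ → Weight) (n j : ℤ) (r : ℝ) : (fun σ => (A σ).coef n j) = fun σ =>
    ((2 * Real.pi : ℝ) : ℂ)⁻¹ * oscIntegral (phase A) (fun _ => 1) n j r σ := by
  funext σ
  simp only [Weight.coef, oscIntegral, one_mul]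
  rfl

theorem contDiff_coef (hA : IsSmoothLoop A) (n j : ℤ) :
    ContDiff ℝ ∞ fun σ => (A σ).coef n j := by
  rw [coef_eq A n j 0]
  exact contDiff_const.mul (hA.isPhase.contDiff_oscIntegral torusSmooth_one n j 0)

theorem iteratedDeriv_coef (A : ℝ → Weight) (i : ℕ) (n j : ℤ) (r σ : ℝ) :
    iteratedDeriv i (fun σ => (A σ).coef n j) σ = ((2 * Real.pi : ℝ) : ℂ)⁻¹ *
      iteratedDeriv i (oscIntegral (phase A) (fun _ => 1) n j r) σ := by
  rw [coef_eq A n j r]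
  exact iteratedDeriv_const_mul_field _ _

theorem norm_iteratedDeriv_coef_le (A : ℝ → Weight) (i : ℕ) (n j : ℤ) (r σ : ℝ) :
    ‖iteratedDeriv i (fun σ => (A σ).coef n j) σ‖ ≤
      ‖iteratedDeriv i (oscIntegral (phase A) (fun _ => 1) n j r) σ‖ := by
  rw [iteratedDeriv_coef A i n j r σ, norm_mul, norm_inv, Complex.norm_real,
    Real.norm_of_nonneg Real.two_pi_pos.le]
  refine mul_le_of_le_one_left (norm_nonneg _) (inv_le_one_of_one_le₀ ?_)
  linarith [Real.pi_gt_three]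

theorem coef_decay (hA : IsSmoothLoop A) (i M : ℕ) : ∃ C, 0 ≤ C ∧ ∀ (n j : ℕ) (σ : ℝ),
    ‖iteratedDeriv i (fun σ => (A σ).coef (n + 1) (j + 1)) σ‖ * ((n : ℝ) + j + 2) ^ M ≤ C := by
  obtain ⟨C, hC⟩ := hA.isPhase.iteratedDeriv_oscIntegral_decay i M torusSmooth_one
  have key : ∀ (n j : ℕ) (σ : ℝ),
      ‖iteratedDeriv i (fun σ => (A σ).coef (n + 1) (j + 1)) σ‖ * ((n : ℝ) + j + 2) ^ M ≤ C := by
    intro n j σ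
    have hN : (0 : ℝ) < (n : ℝ) + j + 2 := by positivity
    set N : ℝ := (n : ℝ) + j + 2 with hNdef
    have hx0 : 0 ≤ (n + 1) / N := by positivity
    have hx1 : (n + 1) / N ≤ 1 := by
      rw [div_le_one hN, hNdef]
      linarith [(Nat.cast_nonneg j : (0 : ℝ) ≤ j)]
    -- With `N = (n + 1) + (j + 1)`, this `r` gives `N sin² r = n + 1` and `N cos² r = j + 1`.
    have hs : Real.sin (Real.arcsin (Real.sqrt ((n + 1) / N))) ^ 2 = (n + 1) / N := by
      rw [Real.sin_arcsin (by linarith [Real.sqrt_nonneg ((n + 1) / N)])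
        (Real.sqrt_le_one.2 hx1), Real.sq_sqrt hx0]
    have h := hC (n + 1) (j + 1) N (Real.arcsin (Real.sqrt ((n + 1) / N))) σ hN.le
      (by rw [hs]; push_cast; field_simp)
      (by rw [Real.cos_sq', hs]; push_cast; field_simp; rw [hNdef]; ring)
    refine le_trans ?_ h
    gcongr
    exact norm_iteratedDeriv_coef_le A i _ _ _ σ
  exact ⟨C, le_trans (by positivity) (key 0 0 0), key⟩

/-- The estimates for the powers `0` and `2` of `|k|` are added, which provides summability over the
rows `k`. -/
theorem coef_growth (hA : IsSmoothLoop A) (i : ℕ) : ∃ C, 0 ≤ C ∧ ∀ (k j : ℤ) (σ : ℝ),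
    ‖iteratedDeriv i (fun σ => (A σ).coef k j) σ‖ * (1 + (k : ℝ) ^ 2) ≤
      C * (1 + |(j : ℝ)|) ^ (2 + i) := by
  obtain ⟨C, hC0, hC⟩ := hA.isPhase.iteratedDeriv_oscIntegral_growth i 0 torusSmooth_one
  obtain ⟨D, hD0, hD⟩ := hA.isPhase.iteratedDeriv_oscIntegral_growth i 2 torusSmooth_one
  refine ⟨C + D, by positivity, fun k j σ => ?_⟩
  have h1 := hC k j 0 σ
  have h2 := hD k j 0 σ
  rw [sq_abs] at h2
  rw [pow_zero, mul_one] at h1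
  have h3 : (1 + |(j : ℝ)|) ^ (0 + i) ≤ (1 + |(j : ℝ)|) ^ (2 + i) :=
    pow_le_pow_right₀ (by linarith [abs_nonneg (j : ℝ)]) (by omega)
  refine (mul_le_mul_of_nonneg_right (norm_iteratedDeriv_coef_le A i k j 0 σ)
    (by positivity)).trans ?_
  nlinarith [mul_le_mul_of_nonneg_left h3 hC0]

end IsSmoothLoop

/-! ### The perturbation of a smooth family of weights -/

theorem contDiff_tsum_smul {ι F : Type*} [NormedAddCommGroup F] [NormedSpace ℂ F]
    [CompleteSpace F] {f : ι → ℝ → ℂ} {E : ι → F} (hE : ∀ p, ‖E p‖ ≤ 1)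
    (hf : ∀ p, ContDiff ℝ ∞ (f p)) {w : ι → ℝ} (hw : Summable w)
    (hb : ∀ i : ℕ, ∃ C, ∀ p σ, ‖iteratedDeriv i (f p) σ‖ ≤ C * w p) :
    ContDiff ℝ ∞ fun σ => ∑' p, f p σ • E p := by
  choose C hC using hb
  refine contDiff_tsum (N := ⊤) (v := fun i p => C i * w p) (fun p => (hf p).smul contDiff_const)
    (fun i _ => hw.mul_left _) fun i p σ _ => ?_
  have h := ContinuousLinearMap.norm_iteratedFDeriv_comp_left
    ((ContinuousLinearMap.toSpanSingleton ℂ (E p)).restrictScalars ℝ) (x := σ) (n := i)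
    (hf p).contDiffAt (by exact_mod_cast le_top)
  refine h.trans ?_
  rw [norm_iteratedFDeriv_eq_norm_iteratedDeriv, ContinuousLinearMap.norm_restrictScalars,
    ContinuousLinearMap.norm_toSpanSingleton]
  exact (mul_le_of_le_one_left (norm_nonneg _) (hE p)).trans (hC i p σ)

theorem norm_iteratedDeriv_conj (f : ℝ → ℂ) (i : ℕ) (σ : ℝ) :
    ‖iteratedDeriv i (fun σ => (starRingEnd ℂ) (f σ)) σ‖ = ‖iteratedDeriv i f σ‖ := by
  rw [← norm_iteratedFDeriv_eq_norm_iteratedDeriv, ← norm_iteratedFDeriv_eq_norm_iteratedDeriv]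
  exact Complex.conjLIE.norm_iteratedFDeriv_comp_left f σ i

theorem Weight.coef_zero_left (a : Weight) {j : ℤ} (hj : j ≠ 0) : a.coef 0 j = 0 := by
  have h := a.integral_inv_mul_exp_add 0 j
  simp only [Int.cast_zero, zero_mul, zero_add] at h
  rw [intervalIntegral.integral_const_mul] at h
  rw [Weight.coef]
  simp only [Int.cast_zero, zero_mul, zero_add]
  rw [(mul_eq_zero.1 h).resolve_left (by exact_mod_cast hj), mul_zero]

/-- The index of the terms in the series for the perturbation. -/
abbrev PertIndex : Type := ℤˣ × ℕ × ℕ × ℤ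

/-- The coefficients of the series for the perturbation. -/
def Weight.pertCoef (a : Weight) (p : PertIndex) : ℂ :=
  2 * (p.2.2.1 + 1 : ℂ) * (a.coef (p.1 * (p.2.1 + 1)) (p.1 * (p.2.2.1 + 1)) *
    a.coef (-p.2.2.2) (-(p.1 * (p.2.2.1 + 1))))

/-- The matrix units of the series for the perturbation. -/
def matrixUnit (p : PertIndex) : Seq →L[ℂ] Seq :=
  InnerProductSpace.rankOne ℂ (unitVec p.2.2.2) (unitVec (p.1 * (p.2.1 + 1)))

theorem norm_matrixUnit_le (p : PertIndex) : ‖matrixUnit p‖ ≤ 1 := by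
  rw [matrixUnit, InnerProductSpace.norm_rankOne, norm_unitVec, norm_unitVec, one_mul]

theorem matrixUnit_apply (p : PertIndex) (n k : ℤ) : matrixUnit p (unitVec n) k =
    if n = p.1 * (p.2.1 + 1) ∧ k = p.2.2.2 then 1 else 0 := by
  rw [matrixUnit, InnerProductSpace.rankOne_apply, inner_unitVec, lp.coeFn_smul, Pi.smul_apply,
    unitVec_apply, unitVec_apply]
  by_cases h1 : n = p.1 * (p.2.1 + 1) <;> by_cases h2 : k = p.2.2.2 <;>
    simp [h1, h2, eq_comm]

/-- A summable weight on the indices of the perturbation. -/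
def pertWeight (p : PertIndex) : ℝ :=
  (((p.2.1 : ℝ) + 1) ^ 2)⁻¹ * ((((p.2.2.1 : ℝ) + 1) ^ 2)⁻¹ * (1 + (p.2.2.2 : ℝ) ^ 2)⁻¹)

theorem summable_inv_one_add_sq : Summable fun k : ℤ => (1 + (k : ℝ) ^ 2)⁻¹ := by
  have h : Summable fun k : ℤ => ((k : ℝ) ^ 2)⁻¹ := by
    simpa using Real.summable_one_div_int_pow.2 (one_lt_two)
  refine Summable.of_norm_bounded_eventually h ?_
  have : ∀ᶠ k : ℤ in cofinite, k ≠ 0 := 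
    (Set.finite_singleton (0 : ℤ)).compl_mem_cofinite
  filter_upwards [this] with k hk
  have hk' : (0 : ℝ) < (k : ℝ) ^ 2 := by positivity
  rw [Real.norm_of_nonneg (by positivity)]
  gcongr
  linarith

theorem summable_inv_succ_sq : Summable fun n : ℕ => (((n : ℝ) + 1) ^ 2)⁻¹ := by
  have := (summable_nat_add_iff 1).2 (Real.summable_nat_pow_inv.2 one_lt_two)
  simpa using this

theorem summable_pertWeight : Summable pertWeight := by
  have h1 := summable_inv_succ_sq.mul_of_nonneg summable_inv_one_add_sq
    (fun n => by positivity) fun k => by positivity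
  have h2 := summable_inv_succ_sq.mul_of_nonneg h1
    (fun n => by positivity) fun p => by positivity
  have h3 := (Summable.of_finite (f := fun _ : ℤˣ => (1 : ℝ))).mul_of_nonneg h2
    (fun n => zero_le_one) fun p => by positivity
  exact h3.congr fun p => one_mul _

namespace IsSmoothLoop

variable {A : ℝ → Weight}

theorem coef_decay_units (hA : IsSmoothLoop A) (i M : ℕ) :
    ∃ C, 0 ≤ C ∧ ∀ (s : ℤˣ) (n j : ℕ) (σ : ℝ),
    ‖iteratedDeriv i (fun σ => (A σ).coef (s * (n + 1)) (s * (j + 1))) σ‖ *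
      ((n : ℝ) + j + 2) ^ M ≤ C := by
  obtain ⟨C, hC0, hC⟩ := hA.coef_decay i M
  refine ⟨C, hC0, fun s n j σ => ?_⟩
  rcases Int.units_eq_one_or s with rfl | rfl
  · simpa using hC n j σ
  · have h : (fun σ => (A σ).coef (((-1 : ℤˣ) : ℤ) * (n + 1)) (((-1 : ℤˣ) : ℤ) * (j + 1))) =
        fun σ => (starRingEnd ℂ) ((A σ).coef (n + 1) (j + 1)) := by
      funext σ
      rw [← Weight.coef_neg]
      simp
    rw [h, norm_iteratedDeriv_conj]
    exact hC n j σ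

theorem pertCoef_bound (hA : IsSmoothLoop A) (i : ℕ) : ∃ C, ∀ (p : PertIndex) (σ : ℝ),
    ‖iteratedDeriv i (fun σ => (A σ).pertCoef p) σ‖ ≤ C * pertWeight p := by
  -- Of the `7 + i` powers of `N`, at most `2 + i` absorb the growth of the second factor. The other
  -- five pay for `(j + 1)` times the weights `(n + 1)² (j + 1)²`.
  choose C hC0 hC using fun l => hA.coef_decay_units l (7 + i)
  choose D hD0 hD using hA.coef_growth
  refine ⟨∑ l ∈ Finset.range (i + 1), (i.choose l : ℝ) * (2 * C l * D (i - l)), fun p σ => ?_⟩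
  obtain ⟨s, n, j, k⟩ := p
  set f := fun σ => (A σ).coef (s * (n + 1)) (s * (j + 1)) with hf
  set g := fun σ => (A σ).coef (-k) (-(s * (j + 1))) with hg
  have hfg : (fun σ => (A σ).pertCoef (s, n, j, k)) = fun σ => (2 * (j + 1 : ℂ)) * (f σ * g σ) :=
    rfl
  rw [hfg, iteratedDeriv_const_mul_field, norm_mul, ← norm_iteratedFDeriv_eq_norm_iteratedDeriv]
  have h1 := norm_iteratedFDeriv_mul_le (hA.contDiff_coef (s * (n + 1)) (s * (j + 1)))
    (hA.contDiff_coef (-k) (-(s * (j + 1)))) σ (n := i) (by exact_mod_cast le_top)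
  have hj : ‖(2 * (j + 1 : ℂ))‖ = 2 * ((j : ℝ) + 1) := by
    have : (2 * (j + 1 : ℂ)) = ((2 * ((j : ℝ) + 1) : ℝ) : ℂ) := by push_cast; ring
    rw [this, Complex.norm_real, Real.norm_of_nonneg (by positivity)]
  rw [hj]
  refine (mul_le_mul_of_nonneg_left h1 (by positivity)).trans ?_
  rw [Finset.mul_sum, Finset.sum_mul]
  refine Finset.sum_le_sum fun l hl => ?_
  rw [norm_iteratedFDeriv_eq_norm_iteratedDeriv, norm_iteratedFDeriv_eq_norm_iteratedDeriv]
  have e1 := hC l s n j σ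
  have e2 := hD (i - l) (-k) (-(s * (j + 1))) σ
  have hs : |((-(s * (j + 1)) : ℤ) : ℝ)| = (j : ℝ) + 1 := by
    have h0 : (0 : ℝ) ≤ (j : ℝ) + 1 := by positivity
    rcases Int.units_eq_one_or s with rfl | rfl
    · rw [Units.val_one, one_mul, Int.cast_neg, abs_neg]
      push_cast
      exact abs_of_nonneg h0
    · simpa using abs_of_nonneg h0
  rw [hs, Int.cast_neg, neg_sq] at e2
  set N : ℝ := (n : ℝ) + j + 2 with hN
  set x := ‖iteratedDeriv l (fun σ => (A σ).coef (s * (n + 1)) (s * (j + 1))) σ‖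
  set y := ‖iteratedDeriv (i - l) (fun σ => (A σ).coef (-k) (-(s * (j + 1)))) σ‖
  have hn0 : (0 : ℝ) ≤ n := Nat.cast_nonneg n
  have hj0 : (0 : ℝ) ≤ j := Nat.cast_nonneg j
  have hN0 : 0 < N := by positivity
  have h2 : (1 + ((j : ℝ) + 1)) ^ (2 + (i - l)) ≤ N ^ (2 + i) :=
    (pow_le_pow_left₀ (by positivity) (by linarith) _).trans
      (pow_le_pow_right₀ (by linarith) (by omega))
  have h3 : ((j : ℝ) + 1) ^ 3 * ((n : ℝ) + 1) ^ 2 ≤ N ^ 5 := by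
    calc ((j : ℝ) + 1) ^ 3 * ((n : ℝ) + 1) ^ 2 ≤ N ^ 3 * N ^ 2 := by
          gcongr <;> linarith
      _ = N ^ 5 := by ring
  have h4 : 2 * ((j : ℝ) + 1) * (x * y) * (((n : ℝ) + 1) ^ 2 * (((j : ℝ) + 1) ^ 2 *
      (1 + (k : ℝ) ^ 2))) ≤ 2 * C l * D (i - l) := by
    have h5 : x * y * N ^ (7 + i) * (1 + (k : ℝ) ^ 2) ≤ C l * (D (i - l) * N ^ (2 + i)) := by
      calc x * y * N ^ (7 + i) * (1 + (k : ℝ) ^ 2)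
          = (x * N ^ (7 + i)) * (y * (1 + (k : ℝ) ^ 2)) := by ring
        _ ≤ C l * (D (i - l) * N ^ (2 + i)) := by
          refine mul_le_mul e1 (e2.trans ?_) (by positivity) (hC0 l)
          exact mul_le_mul_of_nonneg_left h2 (hD0 _)
    have h6 : x * y * N ^ 5 * (1 + (k : ℝ) ^ 2) ≤ C l * D (i - l) := by
      have h7 : 0 < N ^ (2 + i) := by positivity
      refine le_of_mul_le_mul_right ?_ h7
      calc x * y * N ^ 5 * (1 + (k : ℝ) ^ 2) * N ^ (2 + i)
          = x * y * N ^ (7 + i) * (1 + (k : ℝ) ^ 2) := by ring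
        _ ≤ _ := h5
        _ = _ := by ring
    have hxy : 0 ≤ x * y * (1 + (k : ℝ) ^ 2) := by positivity
    nlinarith [mul_le_mul_of_nonneg_left h3 hxy]
  have h8 : 0 < ((n : ℝ) + 1) ^ 2 * (((j : ℝ) + 1) ^ 2 * (1 + (k : ℝ) ^ 2)) := by positivity
  rw [← le_div_iff₀ h8] at h4
  have h9 : (2 * C l * D (i - l)) / (((n : ℝ) + 1) ^ 2 * (((j : ℝ) + 1) ^ 2 *
      (1 + (k : ℝ) ^ 2))) = 2 * C l * D (i - l) * pertWeight (s, n, j, k) := by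
    rw [pertWeight, ← mul_inv, ← mul_inv, div_eq_mul_inv]
  rw [h9] at h4
  calc 2 * ((j : ℝ) + 1) * ((i.choose l : ℝ) * x * y)
      = (i.choose l : ℝ) * (2 * ((j : ℝ) + 1) * (x * y)) := by ring
    _ ≤ (i.choose l : ℝ) * (2 * C l * D (i - l) * pertWeight (s, n, j, k)) := by gcongr
    _ = _ := by ring

theorem summable_pert (hA : IsSmoothLoop A) (σ : ℝ) :
    Summable fun p => (A σ).pertCoef p • matrixUnit p := by
  obtain ⟨C, hC⟩ := hA.pertCoef_bound 0
  refine Summable.of_norm_bounded (summable_pertWeight.mul_left C) fun p => ?_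
  rw [norm_smul]
  refine (mul_le_of_le_one_right (norm_nonneg _) (norm_matrixUnit_le p)).trans ?_
  simpa using hC p σ

theorem hasPert (hA : IsSmoothLoop A) (σ : ℝ) :
    (A σ).HasPert (∑' p, (A σ).pertCoef p • matrixUnit p) := by
  intro k n
  set R := ∑' p, (A σ).pertCoef p • matrixUnit p
  have h1 : HasSum (fun p => (A σ).pertCoef p *
      if n = p.1 * (p.2.1 + 1) ∧ k = p.2.2.2 then 1 else 0) (R (unitVec n) k) := by
    have h := ((hA.summable_pert σ).hasSum.mapL
      (ContinuousLinearMap.apply ℂ Seq (unitVec n))).mapL (innerSL ℂ (unitVec k))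
    simpa [inner_unitVec, matrixUnit_apply] using h
  -- For a fixed entry only the indices with one sign and one column survive, which leaves the
  -- series over `j`.
  have hcol : ∀ (s : ℤˣ) (n' : ℕ), n = s * (n' + 1) → HasSum (fun j : ℕ =>
      (A σ).pertCoef (s, n', j, k)) (R (unitVec n) k) := by
    intro s n' hn
    have hinj : Function.Injective fun j : ℕ => ((s, n', j, k) : PertIndex) := by
      intro j j' hj
      simpa using hj
    rw [← hinj.hasSum_iff] at h1
    · simpa [Function.comp_def, hn] using h1
    · rintro ⟨s', n'', j, k'⟩ hp
      rw [if_neg, mul_zero]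
      rintro ⟨h2, h3⟩
      refine hp ⟨j, ?_⟩
      simp only at h2 h3
      rw [hn] at h2
      rcases Int.units_eq_one_or s with rfl | rfl <;>
        rcases Int.units_eq_one_or s' with rfl | rfl <;> simp at h2 <;> first
          | omega
          | simp [h2, h3]
  rcases lt_trichotomy n 0 with hn | hn | hn
  · obtain ⟨n', rfl⟩ : ∃ n' : ℕ, n = ((-1 : ℤˣ) : ℤ) * (n' + 1) :=
      ⟨(-n - 1).toNat, by push_cast; omega⟩
    have h2 := (A σ).hasSum_inner_steklovPhi_neg k (((-1 : ℤˣ) : ℤ) * (n' + 1))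
    have h3 := (hcol (-1) n' rfl).unique (h2.congr_fun fun j => ?_)
    · rw [h3]
      split_ifs
      · rw [abs_of_neg hn]; push_cast; ring
      · simp
    · rw [Weight.pertCoef, ← Weight.coef_neg]
      simp [mul_assoc]
  -- Column `0`: no index `p` reaches it, and `Λ_a φ_0 = 0`.
  · have h2 : HasSum (fun _ : PertIndex => (0 : ℂ)) (R (unitVec n) k) := by
      refine h1.congr_fun fun p => ?_
      rw [if_neg, mul_zero]
      rintro ⟨h3, -⟩
      rw [hn] at h3
      rcases Int.units_eq_one_or p.1 with h | h <;> rw [h] at h3 <;> simp at h3 <;> omega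
    have h3 := (A σ).hasSum_inner_steklovPhi k n
    have h4 : HasSum (fun _ : ℤ => (0 : ℂ)) (inner ℂ ((A σ).phi k) ((A σ).steklovPhi n)) := by
      refine h3.congr_fun fun j => ?_
      rcases eq_or_ne j 0 with rfl | hj
      · simp
      · rw [hn, Weight.coef_zero_left _ (neg_ne_zero.2 hj)]
        simp
    rw [h2.unique hasSum_zero, h4.unique hasSum_zero, hn]
    simp
  · obtain ⟨n', rfl⟩ : ∃ n' : ℕ, n = ((1 : ℤˣ) : ℤ) * (n' + 1) :=
      ⟨(n - 1).toNat, by push_cast; omega⟩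
    have h2 := (A σ).hasSum_inner_steklovPhi_pos k (((1 : ℤˣ) : ℤ) * (n' + 1))
    have h3 := (hcol 1 n' rfl).unique (h2.congr_fun fun j => ?_)
    · rw [h3, abs_of_pos hn]
    · rw [Weight.pertCoef, ← Weight.coef_neg]
      simp [mul_assoc]

theorem exists_pert (hA : IsSmoothLoop A) :
    ∃ R : ℝ → Seq →L[ℂ] Seq, ContDiff ℝ ∞ R ∧ ∀ σ, (A σ).HasPert (R σ) := by
  refine ⟨fun σ => ∑' p, (A σ).pertCoef p • matrixUnit p, ?_, hA.hasPert⟩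
  refine contDiff_tsum_smul norm_matrixUnit_le (fun p => ?_) summable_pertWeight hA.pertCoef_bound
  exact contDiff_const.mul ((hA.contDiff_coef _ _).mul (hA.contDiff_coef _ _))

end IsSmoothLoop

/-! ### Even families through the constant weight -/

theorem Weight.eq_one_of_forall {a : Weight} (h : ∀ x, a x = 1) : a = Weight.one := by
  obtain ⟨f, _, _, _⟩ := a
  obtain rfl : f = fun _ => 1 := funext h
  rfl

theorem Weight.coef_one (n j : ℤ) : Weight.one.coef n j = if n + j = 0 then 1 else 0 := by
  split_ifs with h
  · obtain rfl : j = -n := by omega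
    rw [Weight.coef]
    have : ∀ θ : ℝ, Complex.I * (n * (Weight.one.angle θ : ℂ) + ((-n : ℤ) : ℂ) * θ) = 0 := by
      intro θ
      rw [Weight.angle_one]
      push_cast
      ring
    simp only [this, Complex.exp_zero, intervalIntegral.integral_const, sub_zero]
    rw [Complex.real_smul, mul_one, inv_mul_cancel₀]
    exact_mod_cast Real.two_pi_pos.ne'
  · have h1 := Weight.one.integral_inv_mul_exp_add n j
    have h2 : ∀ θ : ℝ, ((Weight.one (θ : Circ))⁻¹ : ℝ) = 1 := fun θ => inv_one
    simp only [h2, Complex.ofReal_one, mul_one] at h1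
    rw [intervalIntegral.integral_const_mul] at h1
    rw [Weight.coef, (mul_eq_zero.1 h1).resolve_left (by exact_mod_cast h), mul_zero]

theorem Weight.norm_coef_le_one (a : Weight) (n j : ℤ) : ‖a.coef n j‖ ≤ 1 := by
  have h := intervalIntegral.norm_integral_le_of_norm_le_const (a := 0) (b := 2 * Real.pi) (C := 1)
    (f := fun θ : ℝ => Complex.exp (Complex.I * (n * (a.angle θ : ℂ) + j * (θ : ℂ))))
    fun θ _ => by
      have : Complex.I * (n * (a.angle θ : ℂ) + j * (θ : ℂ)) =
          ((n * a.angle θ + j * θ : ℝ) : ℂ) * Complex.I := by push_cast; ring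
      rw [this, Complex.norm_exp_ofReal_mul_I]
  rw [sub_zero, abs_of_pos Real.two_pi_pos, one_mul] at h
  rw [Weight.coef, norm_mul, norm_inv, Complex.norm_real, Real.norm_of_nonneg Real.two_pi_pos.le,
    inv_mul_le_iff₀ Real.two_pi_pos, mul_one]
  exact h

/-- Writing `a⁻¹ = 1 + (a⁻¹ - 1)` in `integral_inv_mul_exp_add` shows that, off `n + j = 0`, the
coefficient is as small as `a⁻¹ - 1`. -/
theorem Weight.add_mul_coef (a : Weight) (n j : ℤ) : ((n : ℂ) + j) * a.coef n j =
    -(n * (((2 * Real.pi : ℝ) : ℂ)⁻¹ * ∫ θ in (0 : ℝ)..(2 * Real.pi),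
      ((((a (θ : Circ))⁻¹ - 1 : ℝ)) : ℂ) *
        Complex.exp (Complex.I * (n * (a.angle θ : ℂ) + j * (θ : ℂ))))) := by
  have h1 := a.integral_inv_mul_exp_add n j
  have h2 : ∀ θ : ℝ, (n * (((a (θ : Circ))⁻¹ : ℝ) : ℂ) + j) *
      Complex.exp (Complex.I * (n * (a.angle θ : ℂ) + j * (θ : ℂ))) =
      n * (((((a (θ : Circ))⁻¹ - 1 : ℝ)) : ℂ) *
        Complex.exp (Complex.I * (n * (a.angle θ : ℂ) + j * (θ : ℂ)))) +
      ((n : ℂ) + j) * Complex.exp (Complex.I * (n * (a.angle θ : ℂ) + j * (θ : ℂ))) := by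
    intro θ
    push_cast
    ring
  simp only [h2] at h1
  rw [intervalIntegral.integral_add, intervalIntegral.integral_const_mul,
    intervalIntegral.integral_const_mul] at h1
  · rw [Weight.coef]
    linear_combination ((2 * Real.pi : ℝ) : ℂ)⁻¹ * h1
  · refine (continuous_const.mul (Continuous.mul ?_ (a.continuous_exp n j))).intervalIntegrable _ _
    exact Complex.continuous_ofReal.comp (a.continuous_inv.sub continuous_const)
  · exact (continuous_const.mul (a.continuous_exp n j)).intervalIntegrable _ _

/-- A smooth periodic family of weights that is even in the parameter `σ` and of the form
`1 + b σ² + o(σ²)` at `0`. -/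
structure IsEvenLoop (A : ℝ → Weight) (b : Circ → ℝ) : Prop extends IsSmoothLoop A where
  even : ∀ σ, A (-σ) = A σ
  initial : ∀ x, A 0 x = 1
  tendsto : ∀ x, Tendsto (fun σ : ℝ => (σ ^ 2)⁻¹ * (A σ x - 1)) (𝓝[≠] 0) (𝓝 (b x))

namespace IsEvenLoop

variable {A : ℝ → Weight} {b : Circ → ℝ}

theorem zero_eq_one (hA : IsEvenLoop A b) : A 0 = Weight.one := Weight.eq_one_of_forall hA.initial

/-- The function is even in `σ`, vanishes at `σ = 0`, and its second derivative in `σ` is bounded by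
periodicity. The first variable of `h` is a dummy. -/
theorem inv_sub_one_bound (hA : IsEvenLoop A b) :
    ∃ C, ∀ σ θ : ℝ, |(A σ (θ : Circ))⁻¹ - 1| ≤ C * σ ^ 2 := by
  set h : ℝ × ℝ × ℝ → ℂ := fun q => (((A q.2.1 (q.2.2 : Circ))⁻¹ : ℝ) : ℂ) with hdef
  have hh : TorusSmooth h := by
    refine ⟨Complex.ofRealCLM.contDiff.comp (hA.contDiff_inv.comp contDiff_snd), ?_⟩
    rintro w (rfl | rfl | rfl) q
    · simp [h]
    · simp [h, hA.periodic]
    · simp only [h, Prod.snd_add, Prod.fst_add, add_zero, AddCircle.coe_add_period]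
  obtain ⟨C, -, hC⟩ := ((hh.dirDeriv (0, 1, 0)).dirDeriv (0, 1, 0)).bounded
  refine ⟨C, fun σ θ => ?_⟩
  have hline : ∀ {g : ℝ × ℝ × ℝ → ℂ}, TorusSmooth g → ∀ σ,
      HasDerivAt (fun σ : ℝ => g (0, σ, θ)) (dirDeriv (0, 1, 0) g (0, σ, θ)) σ := by
    intro g hg σ
    exact (hg.smooth.differentiable (by simp) (0, σ, θ)).hasFDerivAt.comp_hasDerivAt σ
      ((hasDerivAt_const σ (0 : ℝ)).prodMk ((hasDerivAt_id σ).prodMk (hasDerivAt_const σ θ)))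
  have hd : iteratedDeriv 2 (fun σ : ℝ => h (0, σ, θ) - 1) =
      fun σ => dirDeriv (0, 1, 0) (dirDeriv (0, 1, 0) h) (0, σ, θ) := by
    have e1 : deriv (fun σ : ℝ => h (0, σ, θ) - 1) = fun σ => dirDeriv (0, 1, 0) h (0, σ, θ) :=
      funext fun σ => ((hline hh σ).sub_const 1).deriv
    rw [iteratedDeriv_succ, iteratedDeriv_one, e1]
    exact funext fun σ => (hline (hh.dirDeriv _) σ).deriv
  have := norm_le_sq_of_even (f := fun σ : ℝ => h (0, σ, θ) - 1) (C := C) ?_ ?_ ?_ ?_ σ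
  · rw [← Real.norm_eq_abs, ← Complex.norm_real]
    simpa [h] using this
  · have : ContDiff ℝ ∞ fun σ : ℝ => h (0, σ, θ) - 1 :=
      (hh.smooth.comp (contDiff_const.prodMk (contDiff_id.prodMk contDiff_const))).sub
        contDiff_const
    exact_mod_cast contDiff_infty.1 this 2
  · intro σ
    simp only [h, hA.even]
  · simp [h, hA.initial]
  · intro σ
    rw [hd]
    exact hC _

/-- The same second order bound, now with the rapid decay of the second derivative in `σ`: smallness
in `σ` and decay in `n + j` hold together. -/
theorem coef_decay_sq (hA : IsEvenLoop A b) (M : ℕ) : ∃ C, 0 ≤ C ∧ ∀ (n j : ℕ) (σ : ℝ),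
    ‖(A σ).coef (n + 1) (j + 1)‖ * ((n : ℝ) + j + 2) ^ M ≤ C * σ ^ 2 := by
  obtain ⟨C, hC0, hC⟩ := hA.toIsSmoothLoop.coef_decay 2 M
  refine ⟨C, hC0, fun n j σ => ?_⟩
  have hN : 0 < ((n : ℝ) + j + 2) ^ M := by positivity
  have h := norm_le_sq_of_even (f := fun σ => (A σ).coef (n + 1) (j + 1))
    (C := C / ((n : ℝ) + j + 2) ^ M)
    (by exact_mod_cast contDiff_infty.1 (hA.toIsSmoothLoop.contDiff_coef _ _) 2)
    (fun σ => by simp only [hA.even]) ?_ (fun σ => (le_div_iff₀ hN).2 (hC n j σ)) σ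
  · rw [div_mul_eq_mul_div, le_div_iff₀ hN] at h
    exact h
  · rw [hA.zero_eq_one, Weight.coef_one, if_neg (by omega)]

theorem tendsto_coef_zero (hA : IsEvenLoop A b) (n j : ℤ) :
    Tendsto (fun σ => (A σ).coef n j) (𝓝[≠] 0) (𝓝 (if n + j = 0 then 1 else 0)) := by
  rw [← Weight.coef_one, ← hA.zero_eq_one]
  exact ((hA.toIsSmoothLoop.contDiff_coef n j).continuous.tendsto 0).mono_left
    nhdsWithin_le_nhds

theorem tendsto_inv_sub_one (hA : IsEvenLoop A b) (x : Circ) :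
    Tendsto (fun σ : ℝ => (σ ^ 2)⁻¹ * ((A σ x)⁻¹ - 1)) (𝓝[≠] 0) (𝓝 (-b x)) := by
  obtain ⟨θ, rfl⟩ := QuotientAddGroup.mk_surjective x
  have hc : Continuous fun σ : ℝ => (A σ (θ : Circ))⁻¹ :=
    hA.contDiff_inv.continuous.comp (continuous_id.prodMk continuous_const)
  have h0 := (hc.tendsto 0).mono_left (nhdsWithin_le_nhds (s := {0}ᶜ))
  rw [hA.initial, inv_one] at h0
  have h1 := ((hA.tendsto (θ : Circ)).mul h0).neg
  rw [mul_one] at h1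
  refine h1.congr fun σ => ?_
  have := ((A σ).pos (θ : Circ)).ne'
  field_simp
  ring

/-- `Weight.add_mul_coef` divided by `σ²`: `(a⁻¹ - 1) / σ²` tends boundedly to `-b`, and the angle
tends to `θ`. -/
theorem tendsto_coef (hA : IsEvenLoop A b) {n j : ℤ} (hnj : n + j ≠ 0) :
    Tendsto (fun σ : ℝ => ((σ ^ 2)⁻¹ : ℝ) * (A σ).coef n j) (𝓝[≠] 0)
      (𝓝 (n / (n + j) * fourierCoeff (fun x => (b x : ℂ)) (-(n + j)))) := by
  have hnj' : (n : ℂ) + j ≠ 0 := by exact_mod_cast hnj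
  obtain ⟨C, hC⟩ := hA.inv_sub_one_bound
  have h1 : Tendsto (fun σ : ℝ => ∫ θ in (0 : ℝ)..(2 * Real.pi),
      (((σ ^ 2)⁻¹ * ((A σ (θ : Circ))⁻¹ - 1) : ℝ) : ℂ) *
        Complex.exp (Complex.I * (n * ((A σ).angle θ : ℂ) + j * (θ : ℂ)))) (𝓝[≠] 0)
      (𝓝 (∫ θ in (0 : ℝ)..(2 * Real.pi), ((-b (θ : Circ) : ℝ) : ℂ) *
        Complex.exp (Complex.I * (n * (θ : ℂ) + j * (θ : ℂ))))) := by
    refine intervalIntegral.tendsto_integral_filter_of_dominated_convergence (fun _ => C) ?_ ?_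
      intervalIntegrable_const ?_
    · refine Eventually.of_forall fun σ => Continuous.aestronglyMeasurable ?_
      refine Continuous.mul ?_ ((A σ).continuous_exp n j)
      exact Complex.continuous_ofReal.comp
        (continuous_const.mul ((A σ).continuous_inv.sub continuous_const))
    · filter_upwards [self_mem_nhdsWithin] with σ hσ
      refine Eventually.of_forall fun θ _ => ?_
      have e : Complex.I * (n * ((A σ).angle θ : ℂ) + j * (θ : ℂ)) =
          ((n * (A σ).angle θ + j * θ : ℝ) : ℂ) * Complex.I := by push_cast; ring
      have hσ2 : 0 < σ ^ 2 := sq_pos_of_ne_zero hσ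
      rw [norm_mul, e, Complex.norm_exp_ofReal_mul_I, mul_one, Complex.norm_real, Real.norm_eq_abs,
        abs_mul, abs_of_pos (inv_pos.2 hσ2), inv_mul_le_iff₀ hσ2]
      exact (hC σ θ).trans_eq (mul_comm _ _)
    · refine Eventually.of_forall fun θ _ => ?_
      refine ((Complex.continuous_ofReal.tendsto _).comp (hA.tendsto_inv_sub_one θ)).mul ?_
      have hc : Continuous fun σ : ℝ =>
          Complex.exp (Complex.I * (n * ((A σ).angle θ : ℂ) + j * (θ : ℂ))) := by
        have : Continuous fun σ : ℝ => (A σ).angle θ :=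
          hA.contDiff_phase.continuous.comp (continuous_id.prodMk continuous_const)
        fun_prop
      have h0 := (hc.tendsto 0).mono_left (nhdsWithin_le_nhds (s := {0}ᶜ))
      rwa [hA.zero_eq_one, Weight.angle_one] at h0
  have h2 := (h1.const_mul (-(n * ((2 * Real.pi : ℝ) : ℂ)⁻¹))).const_mul (((n : ℂ) + j)⁻¹)
  have h3 : ((n : ℂ) + j)⁻¹ * (-(n * ((2 * Real.pi : ℝ) : ℂ)⁻¹) *
      ∫ θ in (0 : ℝ)..(2 * Real.pi), ((-b (θ : Circ) : ℝ) : ℂ) *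
        Complex.exp (Complex.I * (n * (θ : ℂ) + j * (θ : ℂ)))) =
      n / (n + j) * fourierCoeff (fun x => (b x : ℂ)) (-(n + j)) := by
    rw [fourierCoeff_eq_intervalIntegral _ _ 0, zero_add, Complex.real_smul]
    have e : ∫ θ in (0 : ℝ)..(2 * Real.pi), ((-b (θ : Circ) : ℝ) : ℂ) *
        Complex.exp (Complex.I * (n * (θ : ℂ) + j * (θ : ℂ))) =
        -∫ θ in (0 : ℝ)..(2 * Real.pi), fourier (- -(n + j)) (θ : Circ) • (b (θ : Circ) : ℂ) := by
      rw [← intervalIntegral.integral_neg]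
      refine intervalIntegral.integral_congr fun θ _ => ?_
      rw [neg_neg, fourier_coe_apply, smul_eq_mul, Complex.ofReal_neg, neg_mul, mul_comm]
      congr 3
      push_cast
      field_simp
    rw [e]
    push_cast
    field_simp
  rw [h3] at h2
  refine h2.congr fun σ => ?_
  have h4 := (A σ).add_mul_coef n j
  have h5 : ∫ θ in (0 : ℝ)..(2 * Real.pi), (((σ ^ 2)⁻¹ * ((A σ (θ : Circ))⁻¹ - 1) : ℝ) : ℂ) *
        Complex.exp (Complex.I * (n * ((A σ).angle θ : ℂ) + j * (θ : ℂ))) =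
      (((σ ^ 2)⁻¹ : ℝ) : ℂ) * ∫ θ in (0 : ℝ)..(2 * Real.pi), (((A σ (θ : Circ))⁻¹ - 1 : ℝ) : ℂ) *
        Complex.exp (Complex.I * (n * ((A σ).angle θ : ℂ) + j * (θ : ℂ))) := by
    rw [← intervalIntegral.integral_const_mul]
    refine intervalIntegral.integral_congr fun θ _ => ?_
    push_cast
    ring
  rw [h5, inv_mul_eq_iff_eq_mul₀ hnj']
  linear_combination (-((σ ^ 2)⁻¹ : ℝ) : ℂ) * h4

end IsEvenLoop

/-! ### The second order expansion -/

theorem Weight.HasPert.unique {a : Weight} {R S : Seq →L[ℂ] Seq} (hR : a.HasPert R)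
    (hS : a.HasPert S) : R = S := by
  refine lp.ext_continuousLinearMap (by simp) fun n => ?_
  ext k
  have := (hR k n).trans (hS k n).symm
  simpa [unitVec] using this

theorem Weight.hasPert_one : Weight.one.HasPert 0 := by
  intro k n
  have h1 := Weight.one.hasSum_inner_steklovPhi k n
  have h2 := hasSum_single (f := fun j : ℤ => (starRingEnd ℂ) (Weight.one.coef k (-j)) *
    ((|j| : ℤ) * Weight.one.coef n (-j))) n fun j hj => by
      rw [Weight.coef_one n, if_neg (by omega), mul_zero, mul_zero]
  rw [h1.unique h2, Weight.coef_one, Weight.coef_one, if_pos (by omega : n + -n = 0)]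
  by_cases hkn : k = n
  · simp [hkn]
  · simp [hkn, show ¬k + -n = 0 by omega]

theorem Weight.HasPert.hasSum_entry {a : Weight} {R : Seq →L[ℂ] Seq} (hR : a.HasPert R) {m : ℕ}
    (hm : 0 < m) (k : ℤ) : HasSum (fun j : ℕ => 2 * (j + 1 : ℂ) * a.coef m (j + 1) *
      (starRingEnd ℂ) (a.coef k (j + 1))) (R (unitVec m) k) := by
  have h := a.hasSum_inner_steklovPhi_pos k m
  rw [hR k m, abs_of_pos (by exact_mod_cast hm)]
  exact h

/-- The limits of the coefficients `c(m, j + 1) / σ²` of a family `1 + b σ² + o(σ²)`. -/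
def limCoef (b : Circ → ℝ) (m j : ℕ) : ℂ :=
  m / (m + (j + 1)) * fourierCoeff (fun x => (b x : ℂ)) (-(m + (j + 1)))

theorem norm_two_mul_succ (j : ℕ) : ‖2 * (j + 1 : ℂ)‖ = 2 * ((j : ℝ) + 1) := by
  have : (2 * (j + 1 : ℂ)) = ((2 * ((j : ℝ) + 1) : ℝ) : ℂ) := by push_cast; ring
  rw [this, Complex.norm_real, Real.norm_of_nonneg (by positivity)]

namespace IsEvenLoop

variable {A : ℝ → Weight} {b : Circ → ℝ} {m : ℕ}

theorem tendsto_limCoef (hA : IsEvenLoop A b) (hm : 0 < m) (j : ℕ) :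
    Tendsto (fun σ : ℝ => ((σ ^ 2)⁻¹ : ℝ) * (A σ).coef m (j + 1)) (𝓝[≠] 0)
      (𝓝 (limCoef b m j)) := by
  have h := hA.tendsto_coef (n := m) (j := j + 1) (by omega)
  simpa [limCoef] using h

theorem coef_bound (hA : IsEvenLoop A b) (hm : 0 < m) : ∃ C, 0 ≤ C ∧ ∀ (j : ℕ) (σ : ℝ), σ ≠ 0 →
    ‖(((σ ^ 2)⁻¹ : ℝ) : ℂ) * (A σ).coef m (j + 1)‖ ≤ C * (((j : ℝ) + 1) ^ 3)⁻¹ := by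
  obtain ⟨C, hC0, hC⟩ := hA.coef_decay_sq 3
  obtain ⟨n, rfl⟩ : ∃ n, m = n + 1 := ⟨m - 1, by omega⟩
  refine ⟨C, hC0, fun j σ hσ => ?_⟩
  have h := hC n j σ
  have hσ2 : 0 < σ ^ 2 := sq_pos_of_ne_zero hσ
  have hj : 0 < ((j : ℝ) + 1) ^ 3 := by positivity
  rw [norm_mul, Complex.norm_real, Real.norm_of_nonneg (inv_nonneg.2 hσ2.le),
    inv_mul_le_iff₀ hσ2, ← div_eq_mul_inv, ← mul_div_assoc, le_div_iff₀ hj, mul_comm _ C]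
  refine le_trans ?_ h
  push_cast
  gcongr
  · linarith [(Nat.cast_nonneg n : (0 : ℝ) ≤ n)]
  · norm_num

theorem limCoef_bound (hA : IsEvenLoop A b) (hm : 0 < m) :
    ∃ C, 0 ≤ C ∧ ∀ j : ℕ, ‖limCoef b m j‖ ≤ C * (((j : ℝ) + 1) ^ 3)⁻¹ := by
  obtain ⟨C, hC0, hC⟩ := hA.coef_bound hm
  refine ⟨C, hC0, fun j => ?_⟩
  refine le_of_tendsto (hA.tendsto_limCoef hm j).norm ?_
  filter_upwards [self_mem_nhdsWithin] with σ hσ using hC j σ hσ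

/-- The first coefficient absorbs `σ⁻²`, the second tends to `1` if `k = -(j + 1)` and to `0`
otherwise. So the limit of `R e_m / σ²` lives on the negative indices. -/
theorem tendsto_entry (hA : IsEvenLoop A b) (hm : 0 < m) {R : ℝ → Seq →L[ℂ] Seq}
    (hR : ∀ σ, (A σ).HasPert (R σ)) (k : ℤ) :
    Tendsto (fun σ : ℝ => ((σ ^ 2)⁻¹ : ℝ) * R σ (unitVec m) k) (𝓝[≠] 0)
      (𝓝 (∑' j : ℕ, 2 * (j + 1 : ℂ) * limCoef b m j *
        if k + (j + 1) = 0 then 1 else 0)) := by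
  obtain ⟨C, hC0, hC⟩ := hA.coef_bound hm
  have h1 : Tendsto (fun σ : ℝ => ∑' j : ℕ, 2 * (j + 1 : ℂ) *
      (((σ ^ 2)⁻¹ : ℝ) * (A σ).coef m (j + 1)) * (starRingEnd ℂ) ((A σ).coef k (j + 1))) (𝓝[≠] 0)
      (𝓝 (∑' j : ℕ, 2 * (j + 1 : ℂ) * limCoef b m j * if k + (j + 1) = 0 then 1 else 0)) := by
    refine tendsto_tsum_of_dominated_convergence (summable_inv_succ_sq.mul_left (2 * C))
      (fun j => ?_) ?_
    · refine ((hA.tendsto_limCoef hm j).const_mul _).mul ?_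
      have := (Complex.continuous_conj.tendsto _).comp (hA.tendsto_coef_zero k (j + 1))
      rw [apply_ite (starRingEnd ℂ), map_one, map_zero] at this
      exact this
    · filter_upwards [self_mem_nhdsWithin] with σ hσ j
      rw [norm_mul, RCLike.norm_conj, norm_mul, norm_two_mul_succ]
      refine (mul_le_of_le_one_right (by positivity) ((A σ).norm_coef_le_one _ _)).trans ?_
      refine (mul_le_mul_of_nonneg_left (hC j σ hσ) (by positivity)).trans_eq ?_
      field_simp
  refine h1.congr fun σ => ?_
  rw [← ((hR σ).hasSum_entry hm k).tsum_eq, ← tsum_mul_left]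
  refine tsum_congr fun j => ?_
  ring

/-- For `k = m` both coefficients are `O(σ²)`. The diagonal entry is therefore of the order `σ⁴` of
the quadratic term and has to be kept with it. -/
theorem tendsto_entry_diag (hA : IsEvenLoop A b) (hm : 0 < m) {R : ℝ → Seq →L[ℂ] Seq}
    (hR : ∀ σ, (A σ).HasPert (R σ)) :
    Tendsto (fun σ : ℝ => ((σ ^ 4)⁻¹ : ℝ) * R σ (unitVec m) m) (𝓝[≠] 0)
      (𝓝 ((∑' j : ℕ, 2 * ((j : ℝ) + 1) * ‖limCoef b m j‖ ^ 2 : ℝ) : ℂ)) := by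
  obtain ⟨C, hC0, hC⟩ := hA.coef_bound hm
  have h1 : Tendsto (fun σ : ℝ => ∑' j : ℕ, 2 * (j + 1 : ℂ) *
      (((σ ^ 2)⁻¹ : ℝ) * (A σ).coef m (j + 1)) *
        (starRingEnd ℂ) (((σ ^ 2)⁻¹ : ℝ) * (A σ).coef m (j + 1))) (𝓝[≠] 0)
      (𝓝 (∑' j : ℕ, 2 * (j + 1 : ℂ) * limCoef b m j * (starRingEnd ℂ) (limCoef b m j))) := by
    refine tendsto_tsum_of_dominated_convergence (summable_inv_succ_sq.mul_left (2 * C * C))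
      (fun j => ?_) ?_
    · exact ((hA.tendsto_limCoef hm j).const_mul _).mul
        ((Complex.continuous_conj.tendsto _).comp (hA.tendsto_limCoef hm j))
    · filter_upwards [self_mem_nhdsWithin] with σ hσ j
      rw [norm_mul, RCLike.norm_conj, norm_mul, norm_two_mul_succ]
      have h2 : (((j : ℝ) + 1) ^ 3)⁻¹ ≤ 1 :=
        inv_le_one_of_one_le₀ (one_le_pow₀ (by linarith [(Nat.cast_nonneg j : (0 : ℝ) ≤ j)]))
      calc _ ≤ 2 * ((j : ℝ) + 1) * (C * (((j : ℝ) + 1) ^ 3)⁻¹) * (C * 1) := by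
            gcongr
            · exact hC j σ hσ
            · exact (hC j σ hσ).trans (by gcongr)
        _ = _ := by field_simp
  have h2 : ((∑' j : ℕ, 2 * ((j : ℝ) + 1) * ‖limCoef b m j‖ ^ 2 : ℝ) : ℂ) =
      ∑' j : ℕ, 2 * (j + 1 : ℂ) * limCoef b m j * (starRingEnd ℂ) (limCoef b m j) := by
    rw [Complex.ofReal_tsum]
    refine tsum_congr fun j => ?_
    rw [mul_assoc _ (limCoef b m j), Complex.mul_conj, Complex.normSq_eq_norm_sq]
    push_cast
    ring
  rw [h2]
  refine h1.congr fun σ => ?_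
  rw [← ((hR σ).hasSum_entry hm m).tsum_eq, ← tsum_mul_left]
  refine tsum_congr fun j => ?_
  rw [map_mul, Complex.conj_ofReal]
  push_cast
  ring

theorem summable_sq_limCoef (hA : IsEvenLoop A b) (hm : 0 < m) :
    Summable fun j : ℕ => 2 * ((j : ℝ) + 1) * ‖limCoef b m j‖ ^ 2 := by
  obtain ⟨C, hC0, hC⟩ := hA.limCoef_bound hm
  refine Summable.of_nonneg_of_le (fun j => by positivity) (fun j => ?_)
    (summable_inv_succ_sq.mul_left (2 * C * C))
  have h2 : (((j : ℝ) + 1) ^ 3)⁻¹ ≤ 1 :=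
    inv_le_one_of_one_le₀ (one_le_pow₀ (by linarith [(Nat.cast_nonneg j : (0 : ℝ) ≤ j)]))
  calc 2 * ((j : ℝ) + 1) * ‖limCoef b m j‖ ^ 2
      = 2 * ((j : ℝ) + 1) * ‖limCoef b m j‖ * ‖limCoef b m j‖ := by ring
    _ ≤ 2 * ((j : ℝ) + 1) * (C * (((j : ℝ) + 1) ^ 3)⁻¹) * (C * 1) := by
        gcongr
        · exact hC j
        · exact (hC j).trans (by gcongr)
    _ = _ := by field_simp

theorem tendsto_log_expansion (hA : IsEvenLoop A b) (hm : 0 < m) {R : ℝ → Seq →L[ℂ] Seq}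
    (hRs : ContDiff ℝ ∞ R) (hR : ∀ σ, (A σ).HasPert (R σ)) :
    ∃ S : ℝ, HasSum (fun j : ℕ => (m : ℝ)⁻¹ * (2 * ((j : ℝ) + 1) * ‖limCoef b m j‖ ^ 2 -
        meanResolv m (-(j + 1)) * (2 * ((j : ℝ) + 1) * ‖limCoef b m j‖) ^ 2)) S ∧
      Tendsto (fun σ : ℝ => (((σ ^ 4)⁻¹ : ℝ) : ℂ) * (logEntry hm (R σ) - Real.log m)) (𝓝[≠] 0)
        (𝓝 (S : ℂ)) := by
  have h0 : R 0 = 0 := by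
    have := hR 0
    rw [hA.zero_eq_one] at this
    exact this.unique Weight.hasPert_one
  have he : ∀ σ, R (-σ) = R σ := fun σ => by
    have := hR (-σ)
    rw [hA.even] at this
    exact this.unique (hR σ)
  -- Evenness and `R 0 = 0` give a norm limit of `R / σ²`; its column `m` is then read off from
  -- `tendsto_entry`.
  obtain ⟨V, hV⟩ := tendsto_inv_sq_smul_of_even (by exact_mod_cast contDiff_infty.1 hRs 2) he h0
  have hV' : Tendsto (fun σ : ℝ => (((σ ^ 2)⁻¹ : ℝ) : ℂ) • R σ) (𝓝[≠] 0) (𝓝 V) := by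
    refine hV.congr fun σ => ?_
    exact (Complex.coe_smul _ _).symm
  have hVs : ∀ x y, inner ℂ (V x) y = inner ℂ x (V y) := by
    intro x y
    have e : ∀ z, Tendsto (fun σ : ℝ => ((((σ ^ 2)⁻¹ : ℝ) : ℂ) • R σ) z) (𝓝[≠] 0) (𝓝 (V z)) :=
      fun z => ((ContinuousLinearMap.apply ℂ Seq z).continuous.tendsto _).comp hV'
    refine tendsto_nhds_unique ((e x).inner tendsto_const_nhds)
      ((tendsto_const_nhds.inner (e y)).congr fun σ => ?_)
    rw [_root_.smul_apply, _root_.smul_apply, inner_smul_left, inner_smul_right,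
      (hR σ).symm, Complex.conj_ofReal]
  have hVk : ∀ k, V (unitVec m) k = ∑' j : ℕ, 2 * (j + 1 : ℂ) * limCoef b m j *
      if k + (j + 1) = 0 then 1 else 0 := by
    intro k
    refine tendsto_nhds_unique ?_ (hA.tendsto_entry hm hR k)
    have e := (((innerSL ℂ (unitVec k)).comp
      (ContinuousLinearMap.apply ℂ Seq (unitVec m))).continuous.tendsto _).comp hV'
    simpa [inner_unitVec, Function.comp_def] using e
  have hVneg : ∀ p : ℕ, V (unitVec m) (-(p + 1)) = 2 * (p + 1 : ℂ) * limCoef b m p := by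
    intro p
    rw [hVk, tsum_eq_single p]
    · rw [if_pos (by omega), mul_one]
    · intro j hj
      rw [if_neg (by omega), mul_zero]
  have hVpos : ∀ k : ℤ, 0 ≤ k → V (unitVec m) k = 0 := by
    intro k hk
    rw [hVk]
    convert tsum_zero with j
    rw [if_neg (by omega), mul_zero]
  have hquad : HasSum (fun p : ℕ => meanResolv m (-(p + 1)) *
      (2 * ((p : ℝ) + 1) * ‖limCoef b m p‖) ^ 2) (quadTerm hm V).re := by
    have e := Complex.hasSum_re (hasSum_quadTerm hm hVs)
    simp only [Complex.ofReal_re] at e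
    have hinj : Function.Injective fun p : ℕ => -((p : ℤ) + 1) := fun p q h => by
      simp only at h
      omega
    rw [← hinj.hasSum_iff] at e
    · refine e.congr_fun fun p => ?_
      simp only [Function.comp_apply]
      rw [hVneg, norm_mul, norm_two_mul_succ]
    · intro k hk
      have : 0 ≤ k := by
        by_contra hk'
        exact hk ⟨(-k - 1).toNat, by simp only; omega⟩
      rw [hVpos k this]
      simp
  have hreal : ((quadTerm hm V).re : ℂ) = quadTerm hm V := by
    have e := hasSum_quadTerm hm hVs
    have e2 := Complex.hasSum_re e
    simp only [Complex.ofReal_re] at e2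
    exact (Complex.hasSum_ofReal.2 e2).unique e
  refine ⟨_, ((hA.summable_sq_limCoef hm).hasSum.sub hquad).mul_left _, ?_⟩
  have hR0 : Tendsto R (𝓝[≠] 0) (𝓝 0) := by
    rw [← h0]
    exact (hRs.continuous.tendsto 0).mono_left nhdsWithin_le_nhds
  have hO := (logEntry_expansion hm).comp_tendsto hR0
  have hR2 : R =O[𝓝[≠] 0] fun σ : ℝ => σ ^ 2 := by
    refine ((isBigO_refl (fun σ : ℝ => σ ^ 2) (𝓝[≠] 0)).smul (hV.isBigO_one ℝ)).congr' ?_ ?_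
    · filter_upwards [self_mem_nhdsWithin] with σ hσ
      rw [smul_smul, mul_inv_cancel₀ (pow_ne_zero 2 hσ), one_smul]
    · exact Eventually.of_forall fun σ => mul_one _
  -- The remainder is `O(‖R‖³) = O(σ⁶)`.
  have ho : Tendsto (fun σ : ℝ => (((σ ^ 4)⁻¹ : ℝ) : ℂ) * (logEntry hm (R σ) - (Real.log m +
      (m : ℂ)⁻¹ * (R σ (unitVec m) m - quadTerm hm (R σ))))) (𝓝[≠] 0) (𝓝 0) := by
    have e1 : (fun σ : ℝ => ‖R σ‖ ^ 3) =O[𝓝[≠] 0] fun σ : ℝ => (σ ^ 2) ^ 3 := hR2.norm_left.pow 3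
    have e2 : (fun σ : ℝ => (σ ^ 2) ^ 3) =o[𝓝[≠] 0] fun σ : ℝ => σ ^ 4 := by
      have := (isLittleO_pow_pow (𝕜 := ℝ) (by norm_num : 4 < 6)).mono
        (nhdsWithin_le_nhds (s := {0}ᶜ))
      refine this.congr_left fun σ => by ring
    have e3 := ((hO.trans e1).trans_isLittleO e2).tendsto_inv_smul_nhds_zero
    refine e3.congr fun σ => ?_
    rw [Complex.real_smul]
    rfl
  have h1 := (hA.tendsto_entry_diag hm hR).sub
    (((continuous_quadTerm hm).tendsto V).comp hV')
  have h2 := ho.add (h1.const_mul ((m : ℂ)⁻¹))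
  rw [zero_add, ← hreal] at h2
  push_cast at h2 ⊢
  refine h2.congr fun σ => ?_
  simp only [Function.comp_apply]
  rw [quadTerm_smul]
  ring

end IsEvenLoop

/-! ### The second order coefficient of a variation -/

/-- The reparametrization `τ = δ sin² σ` of a variation. -/
def sinLoop (δ : ℝ) (α : ℝ → Weight) (σ : ℝ) : Weight := α (δ * Real.sin σ ^ 2)

theorem tendsto_sin_sq_div_sq :
    Tendsto (fun σ : ℝ => (σ ^ 2)⁻¹ * Real.sin σ ^ 2) (𝓝[≠] 0) (𝓝 1) := by
  have h := (hasDerivAt_iff_tendsto_slope.1 (Real.hasDerivAt_sin 0)).pow 2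
  rw [Real.cos_zero, one_pow] at h
  refine h.congr fun σ => ?_
  rw [slope_def_field, Real.sin_zero, sub_zero, sub_zero, div_pow, div_eq_inv_mul]

theorem eventually_sin_ne_zero : ∀ᶠ σ : ℝ in 𝓝[≠] 0, Real.sin σ ≠ 0 := by
  have h := (Real.hasDerivAt_sin 0).eventually_ne (c := 0) (by simp)
  exact h

theorem IsVariationOfOne.hasDerivWithinAt {ε : ℝ} {α : ℝ → Weight} (hα : IsVariationOfOne ε α)
    (x : Circ) : HasDerivWithinAt (fun τ => α τ x) (velocity α x) (Set.Ici 0) 0 := by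
  obtain ⟨θ, rfl⟩ := QuotientAddGroup.mk_surjective x
  have h1 : ContDiffOn ℝ ∞ (fun τ => α τ (θ : Circ)) (Set.Ico 0 ε) :=
    hα.smooth.comp (contDiff_id.prodMk contDiff_const).contDiffOn fun τ hτ => ⟨hτ, trivial⟩
  have h2 := h1.differentiableOn (by simp) 0 (Set.left_mem_Ico.2 hα.eps_pos)
  exact (h2.mono_of_mem_nhdsWithin (Ico_mem_nhdsGE hα.eps_pos)).hasDerivWithinAt

/-- `δ < ε` keeps `δ sin² σ` inside `[0, ε)`, where the variation is smooth. The factor `δ` in the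
velocity comes from `sin² σ ~ σ²`. -/
theorem IsVariationOfOne.isEvenLoop {ε δ : ℝ} {α : ℝ → Weight} (hα : IsVariationOfOne ε α)
    (hδ : 0 < δ) (hδε : δ < ε) : IsEvenLoop (sinLoop δ α) fun x => δ * velocity α x where
  smooth := by
    have h : ContDiff ℝ ∞ fun q : ℝ × ℝ => (δ * Real.sin q.1 ^ 2, q.2) :=
      (contDiff_const.mul ((Real.contDiff_sin.comp contDiff_fst).pow 2)).prodMk contDiff_snd
    refine hα.smooth.comp_contDiff h fun q => ⟨⟨by positivity, ?_⟩, trivial⟩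
    nlinarith [Real.sin_sq_le_one q.1]
  periodic σ x := by rw [sinLoop, sinLoop, Real.sin_add_two_pi]
  even σ := by rw [sinLoop, sinLoop, Real.sin_neg, neg_sq]
  initial x := by
    rw [sinLoop, Real.sin_zero]
    simpa using hα.initial x
  tendsto x := by
    have h1 := hasDerivWithinAt_iff_tendsto_slope.1 (hα.hasDerivWithinAt x)
    have h2 : Tendsto (fun σ : ℝ => δ * Real.sin σ ^ 2) (𝓝[≠] 0) (𝓝[Set.Ici 0 \ {0}] 0) := by
      refine tendsto_nhdsWithin_iff.2 ⟨?_, ?_⟩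
      · have : Continuous fun σ : ℝ => δ * Real.sin σ ^ 2 := by fun_prop
        simpa using (this.tendsto 0).mono_left (nhdsWithin_le_nhds (s := {0}ᶜ))
      · filter_upwards [eventually_sin_ne_zero] with σ hσ
        exact ⟨by simp only [Set.mem_Ici]; positivity,
          mul_ne_zero hδ.ne' (pow_ne_zero 2 hσ)⟩
    have h3 := (tendsto_sin_sq_div_sq.const_mul δ).mul (h1.comp h2)
    rw [mul_one] at h3
    refine h3.congr' ?_
    filter_upwards [eventually_sin_ne_zero] with σ hσ
    simp only [Function.comp_apply]
    rw [slope_def_field, hα.initial, sub_zero, sinLoop]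
    have := hδ.ne'
    field_simp

theorem norm_fourierCoeff_neg (f : Circ → ℝ) (k : ℤ) :
    ‖fourierCoeff (fun x => (f x : ℂ)) (-k)‖ = ‖fourierCoeff (fun x => (f x : ℂ)) k‖ := by
  rw [← RCLike.norm_conj (fourierCoeff (fun x => (f x : ℂ)) k), fourierCoeff, fourierCoeff,
    ← integral_conj]
  congr 2
  funext x
  rw [smul_eq_mul, smul_eq_mul, map_mul, Complex.conj_ofReal, ← fourier_neg]

theorem norm_limCoef {δ : ℝ} (hδ : 0 < δ) (α : ℝ → Weight) (m j : ℕ) :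
    ‖limCoef (fun x => δ * velocity α x) m j‖ =
      m / (m + ((j : ℝ) + 1)) * (δ * ‖velocityCoeff α ((m : ℤ) + (j + 1 : ℕ))‖) := by
  have h1 : (m / (m + (j + 1)) : ℂ) = ((m / (m + ((j : ℝ) + 1)) : ℝ) : ℂ) := by push_cast; ring
  have h2 : (fun x => ((δ * velocity α x : ℝ) : ℂ)) =
      fun x => (δ : ℂ) * (velocity α x : ℂ) := by
    funext x
    push_cast
    ring
  rw [limCoef, norm_mul, norm_fourierCoeff_neg, h1, Complex.norm_real,
    Real.norm_of_nonneg (by positivity), h2, fourierCoeff.const_mul, norm_mul, Complex.norm_real,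
    Real.norm_of_nonneg hδ.le, velocityCoeff]
  push_cast
  rfl

/-! ### Evaluation of `γ(p, m)`. -/

theorem diagVal_neg_succ (j : ℕ) : diagVal (-(j + 1)) = (j : ℝ) + 1 := by
  rw [diagVal, if_neg (by omega), Int.cast_neg, abs_neg]
  push_cast
  exact abs_of_nonneg (by positivity)

theorem meanResolv_neg_succ_of_ne {m j : ℕ} (hm : 0 < m) (hj : j + 1 ≠ m) :
    meanResolv m (-(j + 1)) = (((j : ℝ) + 1) - m)⁻¹ -
      m * Real.log (((j : ℝ) + 1) / m) / (((j : ℝ) + 1) - m) ^ 2 := by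
  have hd := diagVal_neg_succ j
  set q : ℝ := (j : ℝ) + 1 with hq
  have hq0 : 0 < q := by positivity
  have hm0 : (0 : ℝ) < m := by exact_mod_cast hm
  have hne : q - m ≠ 0 := by
    rw [hq, sub_ne_zero]
    exact_mod_cast hj
  have hpos : ∀ t ∈ Set.uIcc (0 : ℝ) 1, 0 < m + t * (q - m) := by
    intro t ht
    rw [Set.uIcc_of_le zero_le_one] at ht
    rcases ht.1.eq_or_lt with h | h
    · rw [← h]; simpa using hm0
    · nlinarith [mul_nonneg (sub_nonneg.2 ht.2) hm0.le, mul_pos h hq0]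
  have h : ∀ t ∈ Set.uIcc (0 : ℝ) 1, HasDerivAt (fun t : ℝ => t * (q - m)⁻¹ -
      m / (q - m) ^ 2 * Real.log (m + t * (q - m))) (t * (m + t * (q - m))⁻¹) t := by
    intro t ht
    have h1 : HasDerivAt (fun t : ℝ => m + t * (q - m)) (q - m) t := by
      simpa using ((hasDerivAt_id t).mul_const (q - m)).const_add (m : ℝ)
    have h2 := ((hasDerivAt_id t).mul_const (q - m)⁻¹).sub
      ((h1.log (hpos t ht).ne').const_mul (m / (q - m) ^ 2))
    refine h2.congr_deriv ?_
    have hD := (hpos t ht).ne'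
    generalize hDt : m + t * (q - m) = D at hD
    field_simp
    linear_combination -hDt
  rw [meanResolv, hd, intervalIntegral.integral_eq_sub_of_hasDerivAt h]
  · rw [Real.log_div hq0.ne' hm0.ne']
    simp
    ring
  · refine ContinuousOn.intervalIntegrable (continuousOn_id.mul ?_)
    exact ContinuousOn.inv₀ (by fun_prop) fun t ht => (hpos t ht).ne'

theorem meanResolv_neg_self {m j : ℕ} (hj : j + 1 = m) :
    meanResolv m (-(j + 1)) = (2 * (m : ℝ))⁻¹ := by
  have hd : diagVal (-(j + 1)) = m := by
    rw [diagVal_neg_succ, ← hj]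
    push_cast
    rfl
  rw [meanResolv, hd, sub_self]
  simp only [mul_zero, add_zero]
  rw [intervalIntegral.integral_mul_const, integral_id]
  rw [mul_inv]
  norm_num

/-- Here `p = j + 1`. If `p = m`, the average of `Q_t` is `1/(2m)` and the two contributions cancel;
this agrees with `gammaCoeff m m = 0`, where the denominator is zero. -/
theorem expansion_term {δ : ℝ} (hδ : 0 < δ) (α : ℝ → Weight) {m : ℕ} (hm : 0 < m) (j : ℕ) :
    (m : ℝ)⁻¹ * (2 * ((j : ℝ) + 1) * ‖limCoef (fun x => δ * velocity α x) m j‖ ^ 2 -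
        meanResolv m (-(j + 1)) *
          (2 * ((j : ℝ) + 1) * ‖limCoef (fun x => δ * velocity α x) m j‖) ^ 2) =
      2 * δ ^ 2 * (gammaCoeff (j + 1) m * ‖velocityCoeff α ((m : ℤ) + (j + 1 : ℕ))‖ ^ 2) := by
  have hm0 : (m : ℝ) ≠ 0 := by exact_mod_cast hm.ne'
  have hs : (m : ℝ) + ((j : ℝ) + 1) ≠ 0 := by positivity
  rw [norm_limCoef hδ, gammaCoeff]
  generalize ‖velocityCoeff α ((m : ℤ) + (j + 1 : ℕ))‖ = v
  by_cases hj : j + 1 = m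
  · rw [meanResolv_neg_self hj]
    subst hj
    push_cast at hm0 hs ⊢
    rw [sub_self]
    field_simp
    ring
  · rw [meanResolv_neg_succ_of_ne hm hj]
    have hne : ((j : ℝ) + 1) - m ≠ 0 := by
      rw [sub_ne_zero]
      exact_mod_cast hj
    have hne' : (m : ℝ) - ((j : ℝ) + 1) ≠ 0 := by
      rw [← neg_sub]
      exact neg_ne_zero.2 hne
    push_cast
    generalize Real.log (((j : ℝ) + 1) / m) = L
    have e : ((j : ℝ) + 1 - m) ^ 2 = ((m : ℝ) - ((j : ℝ) + 1)) ^ 2 := by ring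
    have e' : ((j : ℝ) + 1 - m)⁻¹ = -((m : ℝ) - ((j : ℝ) + 1))⁻¹ := by
      rw [← inv_neg, neg_sub]
    rw [e, e']
    field_simp
    ring

/-- The index `p = m` may be added because division by zero makes its term vanish. -/
theorem hasSum_secondTerm_iff (α : ℝ → Weight) {m : ℕ} {S : ℝ} :
    HasSum (fun j : ℕ => gammaCoeff (j + 1) m * ‖velocityCoeff α ((m : ℤ) + (j + 1 : ℕ))‖ ^ 2) S ↔
      HasSum (secondTerm α m) S := by
  have hinj : Function.Injective fun p : {p : ℕ // 0 < p ∧ p ≠ m} => (p : ℕ) - 1 := by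
    rintro ⟨p, hp, _⟩ ⟨q, hq, _⟩ h
    simp only at h
    exact Subtype.ext (show p = q by omega)
  rw [← hinj.hasSum_iff]
  · refine iff_of_eq (congrArg (fun f => HasSum f S) (funext fun p => ?_))
    simp only [Function.comp_apply]
    rw [secondTerm, Nat.sub_add_cancel p.2.1]
  · intro j hj
    have : j + 1 = m := by
      by_contra h
      exact hj ⟨⟨j + 1, by omega, h⟩, by simp⟩
    subst this
    simp [gammaCoeff]

/-! ### From the parameter `σ` back to `τ = δ sin² σ` -/

/-- The inverse of `σ ↦ δ sin² σ`. -/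
def arcsinSqrt (δ τ : ℝ) : ℝ := Real.arcsin (Real.sqrt (τ / δ))

section ArcsinSqrt

variable {δ : ℝ}

theorem mul_sin_sq_arcsinSqrt (hδ : 0 < δ) {τ : ℝ} (hτ : τ ∈ Set.Icc 0 δ) :
    δ * Real.sin (arcsinSqrt δ τ) ^ 2 = τ := by
  have h0 : 0 ≤ τ / δ := div_nonneg hτ.1 hδ.le
  have h1 : τ / δ ≤ 1 := (div_le_one hδ).2 hτ.2
  rw [arcsinSqrt, Real.sin_arcsin (by linarith [Real.sqrt_nonneg (τ / δ)])
    (Real.sqrt_le_one.2 h1), Real.sq_sqrt h0]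
  field_simp

theorem tendsto_arcsinSqrt (hδ : 0 < δ) :
    Tendsto (arcsinSqrt δ) (𝓝[>] 0) (𝓝[>] 0) := by
  refine tendsto_nhdsWithin_iff.2 ⟨?_, ?_⟩
  · have h : Continuous (arcsinSqrt δ) :=
      Real.continuous_arcsin.comp (Real.continuous_sqrt.comp (continuous_id.div_const δ))
    have h0 := (h.tendsto 0).mono_left (nhdsWithin_le_nhds (s := Set.Ioi 0))
    simpa [arcsinSqrt] using h0
  · filter_upwards [self_mem_nhdsWithin] with τ hτ
    exact Real.arcsin_pos.2 (Real.sqrt_pos.2 (div_pos hτ hδ))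

/-- The derivative is found by differentiating the identity `δ sin² (arcsinSqrt δ τ) = τ`. -/
theorem eventually_hasDerivAt_arcsinSqrt (hδ : 0 < δ) : ∀ᶠ τ in 𝓝[>] (0 : ℝ),
    HasDerivAt (arcsinSqrt δ)
      (2 * δ * Real.sin (arcsinSqrt δ τ) * Real.cos (arcsinSqrt δ τ))⁻¹ τ := by
  filter_upwards [Ioo_mem_nhdsGT hδ] with τ hτ
  have h0 : 0 < τ / δ := div_pos hτ.1 hδ
  have h1 : τ / δ < 1 := (div_lt_one hδ).2 hτ.2
  have hd : DifferentiableAt ℝ (arcsinSqrt δ) τ := by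
    refine DifferentiableAt.comp τ (Real.differentiableAt_arcsin.2 ⟨?_, ?_⟩)
      (((differentiableAt_id (𝕜 := ℝ) (x := τ)).div_const δ).sqrt h0.ne')
    · linarith [Real.sqrt_nonneg (τ / δ)]
    · exact ((Real.sqrt_lt' one_pos).2 (by simpa using h1)).ne
  have h2 := ((hd.hasDerivAt.sin).pow 2).const_mul δ
  have h3 : (fun τ => δ * Real.sin (arcsinSqrt δ τ) ^ 2) =ᶠ[𝓝 τ] id := by
    filter_upwards [Ioo_mem_nhds hτ.1 hτ.2] with x hx
    exact mul_sin_sq_arcsinSqrt hδ (Set.Ioo_subset_Icc_self hx)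
  have h4 := (h2.congr_of_eventuallyEq h3.symm).unique (hasDerivAt_id τ)
  have h5 : deriv (arcsinSqrt δ) τ =
      (2 * δ * Real.sin (arcsinSqrt δ τ) * Real.cos (arcsinSqrt δ τ))⁻¹ := by
    refine eq_inv_of_mul_eq_one_left ?_
    rw [← h4]
    push_cast
    ring
  rw [← h5]
  exact hd.hasDerivAt

end ArcsinSqrt

/-! ### From the expansion in `σ` to derivatives in `τ`. -/

section Calculus

variable {F G : ℝ → ℂ} {δ r : ℝ} {c₀ c : ℂ}

theorem isLittleO_of_tendsto_inv_smul {l : Filter ℝ} {f : ℝ → ℂ} {g : ℝ → ℝ}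
    (hg : ∀ᶠ x in l, g x ≠ 0) (h : Tendsto (fun x => (g x)⁻¹ • f x) l (𝓝 0)) : f =o[l] g := by
  refine ((isBigO_refl g l).smul_isLittleO ((isLittleO_one_iff ℝ).2 h)).congr' ?_ ?_
  · filter_upwards [hg] with x hx
    rw [smul_smul, mul_inv_cancel₀ hx, one_smul]
  · exact Eventually.of_forall fun x => mul_one _

/-- Smoothness of `G` is what permits differentiating: `G - c₀ - c σ⁴` is `o(σ⁴)`, so its derivative
is `o(σ³)`. -/
theorem tendsto_deriv_of_tendsto_fourth (hr : 0 < r) (hG : ContDiffOn ℝ ∞ G (Set.Ioo (-r) r))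
    (hG0 : G 0 = c₀) (hlim : Tendsto (fun σ : ℝ => (((σ ^ 4)⁻¹ : ℝ) : ℂ) * (G σ - c₀)) (𝓝[≠] 0)
      (𝓝 c)) :
    Tendsto (fun σ : ℝ => (((σ ^ 3)⁻¹ : ℝ) : ℂ) * deriv G σ) (𝓝[≠] 0) (𝓝 (4 * c)) := by
  set H : ℝ → ℂ := fun σ => G σ - (c₀ + ((σ ^ 4 : ℝ) : ℂ) * c) with hH
  have hpoly : ∀ σ : ℝ, HasDerivAt (fun σ : ℝ => c₀ + ((σ ^ 4 : ℝ) : ℂ) * c)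
      (((4 * σ ^ 3 : ℝ) : ℂ) * c) σ := by
    intro σ
    have := ((hasDerivAt_pow 4 σ).ofReal_comp.mul_const c).const_add c₀
    simpa using this
  have hHs : ContDiffOn ℝ ∞ H (Set.Ioo (-r) r) := by
    refine hG.sub (contDiff_const.add (ContDiff.mul ?_ contDiff_const)).contDiffOn
    exact Complex.ofRealCLM.contDiff.comp (contDiff_id.pow 4)
  have hHo : H =o[𝓝 0] fun σ : ℝ => σ ^ 4 := by
    rw [← nhdsNE_sup_pure]
    refine IsLittleO.sup ?_ ?_
    · have h1 : Tendsto (fun σ : ℝ => (σ ^ 4)⁻¹ • H σ) (𝓝[≠] 0) (𝓝 0) := by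
        have := hlim.sub_const c
        rw [sub_self] at this
        refine this.congr' ?_
        filter_upwards [self_mem_nhdsWithin] with σ hσ
        have hσ' : (σ : ℂ) ≠ 0 := by exact_mod_cast hσ
        rw [Complex.real_smul, hH]
        push_cast
        field_simp
        ring
      refine isLittleO_of_tendsto_inv_smul ?_ h1
      filter_upwards [self_mem_nhdsWithin] with σ hσ using pow_ne_zero 4 hσ
    · refine isLittleO_pure.2 ?_
      simp [hH, hG0]
  have hd := deriv_isLittleO_of_isLittleO (n := 3) hr
    (contDiffOn_infty.1 hHs 4) hHo
  have h2 := (hd.mono (nhdsWithin_le_nhds (s := {0}ᶜ))).tendsto_inv_smul_nhds_zero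
  have h3 := h2.add_const (4 * c)
  rw [zero_add] at h3
  refine h3.congr' ?_
  have hmem : Set.Ioo (-r) r ∈ 𝓝 (0 : ℝ) := Ioo_mem_nhds (by linarith) hr
  filter_upwards [self_mem_nhdsWithin, nhdsWithin_le_nhds hmem] with σ hσ hσr
  have hσ' : (σ : ℂ) ≠ 0 := by exact_mod_cast hσ
  have hGd : DifferentiableAt ℝ G σ :=
    (hG.contDiffAt (Ioo_mem_nhds hσr.1 hσr.2)).differentiableAt (by simp)
  have hHd : deriv H σ = deriv G σ - ((4 * σ ^ 3 : ℝ) : ℂ) * c :=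
    (hGd.hasDerivAt.sub (hpoly σ)).deriv
  rw [hHd, Complex.real_smul]
  push_cast
  field_simp
  ring

theorem tendsto_div_sin : Tendsto (fun σ : ℝ => σ / Real.sin σ) (𝓝[≠] 0) (𝓝 1) := by
  have h := (hasDerivAt_iff_tendsto_slope.1 (Real.hasDerivAt_sin 0)).inv₀ (by simp)
  rw [Real.cos_zero, inv_one] at h
  refine h.congr fun σ => ?_
  rw [slope_def_field, Real.sin_zero, sub_zero, sub_zero, inv_div]

theorem eventually_eq_comp_arcsinSqrt (hδ : 0 < δ) (hr : 0 < r)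
    (hFG : ∀ σ ∈ Set.Ioo (-r) r, F (δ * Real.sin σ ^ 2) = G σ) :
    ∀ᶠ τ in 𝓝[>] (0 : ℝ), arcsinSqrt δ τ ∈ Set.Ioo (-r) r ∧ F τ = G (arcsinSqrt δ τ) := by
  have hmem : Set.Ioo (-r) r ∈ 𝓝 (0 : ℝ) := Ioo_mem_nhds (by linarith) hr
  filter_upwards [Ioo_mem_nhdsGT hδ, (tendsto_arcsinSqrt hδ).eventually
    (nhdsWithin_le_nhds hmem)] with τ hτ hσ
  refine ⟨hσ, ?_⟩
  rw [← hFG _ hσ, mul_sin_sq_arcsinSqrt hδ (Set.Ioo_subset_Icc_self hτ)]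

theorem eventually_hasDerivAt_comp_arcsinSqrt (hδ : 0 < δ) (hr : 0 < r)
    (hG : ContDiffOn ℝ ∞ G (Set.Ioo (-r) r))
    (hFG : ∀ σ ∈ Set.Ioo (-r) r, F (δ * Real.sin σ ^ 2) = G σ) :
    ∀ᶠ τ in 𝓝[>] (0 : ℝ), HasDerivAt F
      ((2 * δ * Real.sin (arcsinSqrt δ τ) * Real.cos (arcsinSqrt δ τ))⁻¹ •
        deriv G (arcsinSqrt δ τ)) τ := by
  have h := eventually_eq_comp_arcsinSqrt hδ hr hFG
  have h' := eventually_eventually_nhdsWithin.2 h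
  filter_upwards [h, h', eventually_hasDerivAt_arcsinSqrt hδ, self_mem_nhdsWithin]
    with τ h1 h2 h3 h4
  have hGd : DifferentiableAt ℝ G (arcsinSqrt δ τ) :=
    (hG.contDiffAt (Ioo_mem_nhds h1.1.1 h1.1.2)).differentiableAt (by simp)
  refine (hGd.hasDerivAt.scomp τ h3).congr_of_eventuallyEq ?_
  rw [nhdsWithin_eq_nhds.2 (Ioi_mem_nhds h4)] at h2
  filter_upwards [h2] with x hx using hx.2

/-- `τ² = δ² sin⁴ σ` is asymptotic to `δ² σ⁴`. -/
theorem isLittleO_sub_comp_arcsinSqrt (hδ : 0 < δ) (hr : 0 < r)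
    (hFG : ∀ σ ∈ Set.Ioo (-r) r, F (δ * Real.sin σ ^ 2) = G σ)
    (hlim : Tendsto (fun σ : ℝ => (((σ ^ 4)⁻¹ : ℝ) : ℂ) * (G σ - c₀)) (𝓝[≠] 0)
      (𝓝 (δ ^ 2 * c))) :
    (fun τ : ℝ => F τ - (c₀ + (τ : ℂ) ^ 2 * c)) =o[𝓝[>] 0] fun τ : ℝ => τ ^ 2 := by
  have hδ' : (δ : ℂ) ≠ 0 := by exact_mod_cast hδ.ne'
  have h1 : Tendsto (fun σ : ℝ => (((δ * Real.sin σ ^ 2) ^ 2)⁻¹ : ℝ) • (G σ - c₀)) (𝓝[≠] 0)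
      (𝓝 c) := by
    have h2 := (((Complex.continuous_ofReal.tendsto _).comp (tendsto_div_sin.pow 4)).mul
      hlim).const_mul ((δ : ℂ) ^ 2)⁻¹
    have e : ((δ : ℂ) ^ 2)⁻¹ * (((1 ^ 4 : ℝ) : ℂ) * (δ ^ 2 * c)) = c := by
      push_cast
      field_simp
    rw [e] at h2
    refine h2.congr' ?_
    filter_upwards [self_mem_nhdsWithin, eventually_sin_ne_zero] with σ hσ hs
    have hσ' : (σ : ℂ) ≠ 0 := by exact_mod_cast hσ
    have hs' : Complex.sin σ ≠ 0 := by exact_mod_cast hs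
    simp only [Function.comp_apply, Complex.real_smul]
    push_cast
    field_simp
  have h3 := (h1.sub_const c).comp ((tendsto_arcsinSqrt hδ).mono_right
    (nhdsWithin_mono _ fun x hx => ne_of_gt hx))
  rw [sub_self] at h3
  refine isLittleO_of_tendsto_inv_smul ?_ (h3.congr' ?_)
  · filter_upwards [self_mem_nhdsWithin] with τ hτ using pow_ne_zero 2 (ne_of_gt hτ)
  · filter_upwards [eventually_eq_comp_arcsinSqrt hδ hr hFG, Ioo_mem_nhdsGT hδ] with τ hτ hτδ
    have hτ' : (τ : ℂ) ≠ 0 := by exact_mod_cast hτδ.1.ne'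
    rw [Function.comp_apply, mul_sin_sq_arcsinSqrt hδ (Set.Ioo_subset_Icc_self hτδ), hτ.2,
      Complex.real_smul, Complex.real_smul]
    push_cast
    field_simp
    ring

theorem hasDerivWithinAt_zero_of_fourth (hδ : 0 < δ) (hr : 0 < r)
    (hFG : ∀ σ ∈ Set.Ioo (-r) r, F (δ * Real.sin σ ^ 2) = G σ) (hG0 : G 0 = c₀)
    (hlim : Tendsto (fun σ : ℝ => (((σ ^ 4)⁻¹ : ℝ) : ℂ) * (G σ - c₀)) (𝓝[≠] 0)
      (𝓝 (δ ^ 2 * c))) : HasDerivWithinAt F 0 (Set.Ici 0) 0 := by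
  have hF0 : F 0 = c₀ := by
    have := hFG 0 ⟨by linarith, hr⟩
    simpa [hG0] using this
  rw [← hasDerivWithinAt_Ioi_iff_Ici, hasDerivWithinAt_iff_isLittleO, hF0]
  have h1 := isLittleO_sub_comp_arcsinSqrt hδ hr hFG hlim
  have h2 : (fun τ : ℝ => τ ^ 2) =o[𝓝[>] 0] fun τ : ℝ => τ - 0 := by
    have := (isLittleO_pow_pow (𝕜 := ℝ) (by norm_num : 1 < 2)).mono
      (nhdsWithin_le_nhds (s := Set.Ioi 0))
    simpa using this
  have h3 : (fun τ : ℝ => (τ : ℂ) ^ 2 * c) =O[𝓝[>] 0] fun τ : ℝ => τ ^ 2 := by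
    refine IsBigO.of_bound ‖c‖ (Eventually.of_forall fun τ => ?_)
    rw [norm_mul, norm_pow, Complex.norm_real, norm_pow, mul_comm]
  refine ((h1.trans h2).add (h3.trans_isLittleO h2)).congr_left fun τ => ?_
  simp
  ring

/-- `F'(0) = 0`, and `F'(τ)/τ = G'(σ) / (2 δ² sin³ σ cos σ)` tends to `4 δ² c / (2 δ²) = 2c`. -/
theorem hasDerivWithinAt_derivWithin_of_fourth (hδ : 0 < δ) (hr : 0 < r)
    (hG : ContDiffOn ℝ ∞ G (Set.Ioo (-r) r))
    (hFG : ∀ σ ∈ Set.Ioo (-r) r, F (δ * Real.sin σ ^ 2) = G σ) (hG0 : G 0 = c₀)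
    (hlim : Tendsto (fun σ : ℝ => (((σ ^ 4)⁻¹ : ℝ) : ℂ) * (G σ - c₀)) (𝓝[≠] 0)
      (𝓝 (δ ^ 2 * c))) :
    HasDerivWithinAt (derivWithin F (Set.Ici 0)) (2 * c) (Set.Ici 0) 0 := by
  have hδ' : (δ : ℂ) ≠ 0 := by exact_mod_cast hδ.ne'
  have h0 : derivWithin F (Set.Ici 0) 0 = 0 :=
    (hasDerivWithinAt_zero_of_fourth hδ hr hFG hG0 hlim).derivWithin
      (uniqueDiffOn_Ici 0 0 (by simp))
  have h1 : Tendsto (fun σ : ℝ => (δ * Real.sin σ ^ 2)⁻¹ •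
      ((2 * δ * Real.sin σ * Real.cos σ)⁻¹ • deriv G σ)) (𝓝[≠] 0) (𝓝 (2 * c)) := by
    have hcos : Tendsto (fun σ : ℝ => Real.cos σ) (𝓝[≠] 0) (𝓝 1) := by
      simpa using (Real.continuous_cos.tendsto 0).mono_left (nhdsWithin_le_nhds (s := {0}ᶜ))
    have hK := ((tendsto_div_sin.pow 3).mul (hcos.inv₀ one_ne_zero)).const_mul (2 * δ ^ 2)⁻¹
    have h2 := ((Complex.continuous_ofReal.tendsto _).comp hK).mul
      (tendsto_deriv_of_tendsto_fourth hr hG hG0 hlim)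
    have e : (((2 * δ ^ 2)⁻¹ * (1 ^ 3 * 1⁻¹) : ℝ) : ℂ) * (4 * (δ ^ 2 * c)) = 2 * c := by
      push_cast
      field_simp
      ring
    rw [e] at h2
    refine h2.congr' ?_
    filter_upwards [self_mem_nhdsWithin, eventually_sin_ne_zero, hcos.eventually_ne one_ne_zero]
      with σ hσ hs hc
    have hσ' : (σ : ℂ) ≠ 0 := by exact_mod_cast hσ
    have hs' : Complex.sin σ ≠ 0 := by exact_mod_cast hs
    have hc' : Complex.cos σ ≠ 0 := by exact_mod_cast hc
    simp only [Function.comp_apply, Complex.real_smul]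
    push_cast
    field_simp
  have h3 := h1.comp ((tendsto_arcsinSqrt hδ).mono_right
    (nhdsWithin_mono _ fun x hx => ne_of_gt hx))
  rw [← hasDerivWithinAt_Ioi_iff_Ici, hasDerivWithinAt_iff_tendsto_slope' (by simp)]
  refine h3.congr' ?_
  filter_upwards [eventually_hasDerivAt_comp_arcsinSqrt hδ hr hG hFG, Ioo_mem_nhdsGT hδ]
    with τ hτ hτδ
  rw [slope, h0, derivWithin_of_mem_nhds (Ici_mem_nhds hτδ.1), hτ.deriv, Function.comp_apply,
    mul_sin_sq_arcsinSqrt hδ (Set.Ioo_subset_Icc_self hτδ), sub_zero, vsub_eq_sub, sub_zero]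

end Calculus

theorem logEntry_zero {m : ℕ} (hm : 0 < m) : logEntry hm 0 = Real.log m := by
  simp [logEntry]

/-! ### Variations of the constant weight -/

theorem IsVariationOfOne.exists_local_model {ε : ℝ} {α : ℝ → Weight} (hα : IsVariationOfOne ε α)
    {m : ℕ} (hm : 0 < m) : ∃ (δ r S : ℝ) (G : ℝ → ℂ), 0 < δ ∧ 0 < r ∧
      HasSum (secondTerm α m) S ∧ ContDiffOn ℝ ∞ G (Set.Ioo (-r) r) ∧
      (∀ σ ∈ Set.Ioo (-r) r, (α (δ * Real.sin σ ^ 2)).lnDiag m = G σ) ∧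
      G 0 = (Real.log m : ℂ) ∧
      Tendsto (fun σ : ℝ => (((σ ^ 4)⁻¹ : ℝ) : ℂ) * (G σ - (Real.log m : ℂ))) (𝓝[≠] 0)
        (𝓝 ((δ : ℂ) ^ 2 * (2 * S : ℝ))) := by
  have hδ : 0 < ε / 2 := half_pos hα.eps_pos
  have hA := hα.isEvenLoop hδ (half_lt_self hα.eps_pos)
  obtain ⟨R, hRs, hR⟩ := hA.toIsSmoothLoop.exists_pert
  have hR0 : R 0 = 0 := by
    have h := hR 0
    rw [hA.zero_eq_one] at h
    exact h.unique Weight.hasPert_one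
  -- The formula for the logarithm needs `‖R‖ < 1`, which holds near `σ = 0` by continuity.
  obtain ⟨r, hr, hball⟩ : ∃ r > 0, ∀ σ ∈ Set.Ioo (-r) r, ‖R σ‖ < 1 := by
    have h : ∀ᶠ σ in 𝓝 (0 : ℝ), ‖R σ‖ < 1 :=
      hRs.continuous.norm.continuousAt.eventually_lt continuousAt_const (by simp [hR0])
    obtain ⟨r, hr, h⟩ := Metric.eventually_nhds_iff_ball.1 h
    refine ⟨r, hr, fun σ hσ => h σ ?_⟩
    rwa [Real.ball_eq_Ioo, zero_sub, zero_add]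
  obtain ⟨S, hS, hlim⟩ := hA.tendsto_log_expansion hm hRs hR
  simp only [expansion_term hδ α hm] at hS
  have hδ2 : 2 * (ε / 2) ^ 2 ≠ 0 := by positivity
  have hsum : HasSum (secondTerm α m) ((2 * (ε / 2) ^ 2)⁻¹ * S) := by
    refine (hasSum_secondTerm_iff α).1 ((hS.mul_left (2 * (ε / 2) ^ 2)⁻¹).congr_fun fun j => ?_)
    rw [inv_mul_cancel_left₀ hδ2]
  refine ⟨ε / 2, r, _, fun σ => logEntry hm (R σ), hδ, hr, hsum, fun σ hσ => ?_, fun σ hσ =>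
    (hR σ).lnDiag_eq hm (hball σ hσ), by simp only [hR0, logEntry_zero], ?_⟩
  · exact (((contDiffAt_logEntry hm (hball σ hσ)).restrict_scalars ℝ).comp σ
      hRs.contDiffAt).contDiffWithinAt
  · have e : ((ε / 2 : ℝ) : ℂ) ^ 2 * (2 * ((2 * (ε / 2) ^ 2)⁻¹ * S) : ℝ) = (S : ℂ) := by
      rw [← Complex.ofReal_pow, ← Complex.ofReal_mul]
      congr 1
      have := hα.eps_pos.ne'
      field_simp
    rw [e]
    exact hlim

end SteklovLog

end

theorem theorem3 (ε : ℝ) (α : ℝ → SteklovLog.Weight) (hα : SteklovLog.IsVariationOfOne ε α)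
    (m : ℕ) (hm : 0 < m) :
    -- the series that define `ln(Λ + P₀) φ_m` and the second-order coefficient converge
    (∀ τ ∈ Set.Ico 0 ε, Summable ((α τ).lnTerm ((α τ).phi m))) ∧
    Summable (SteklovLog.secondTerm α m) ∧
    -- the first derivative at `0`
    HasDerivWithinAt (fun τ => (α τ).lnDiag m) 0 (Set.Ici 0) 0 ∧
    -- the second derivative at `0`
    (∀ᶠ τ in 𝓝[>] (0 : ℝ), DifferentiableAt ℝ (fun τ => (α τ).lnDiag m) τ) ∧
    HasDerivWithinAt (derivWithin (fun τ => (α τ).lnDiag m) (Set.Ici 0))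
      ((4 * ∑' p, SteklovLog.secondTerm α m p : ℝ) : ℂ) (Set.Ici 0) 0 ∧
    -- the Taylor expansion
    (fun τ => (α τ).lnDiag m -
        ((Real.log m + 2 * τ ^ 2 * ∑' p, SteklovLog.secondTerm α m p : ℝ) : ℂ))
      =o[𝓝[>] 0] (fun τ : ℝ => τ ^ 2) := by
  obtain ⟨δ, r, S, G, hδ, hr, hS, hG, hFG, hG0, hlim⟩ := hα.exists_local_model hm
  -- Convergence of the logarithm series needs no smallness: `φ_m` lies in the domain of `Λ_a` for
  -- every weight.
  refine ⟨fun τ _ => (α τ).summable_lnTerm ((α τ).isSteklov_steklovPhi m), hS.summable,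
    SteklovLog.hasDerivWithinAt_zero_of_fourth hδ hr hFG hG0 hlim, ?_, ?_, ?_⟩
  · filter_upwards [SteklovLog.eventually_hasDerivAt_comp_arcsinSqrt
      (F := fun τ => (α τ).lnDiag m) hδ hr hG hFG] with τ hτ
    exact hτ.differentiableAt
  · have h := SteklovLog.hasDerivWithinAt_derivWithin_of_fourth
      (F := fun τ => (α τ).lnDiag m) hδ hr hG hFG hG0 hlim
    rw [hS.tsum_eq]
    convert h using 1
    push_cast
    ring
  · refine (SteklovLog.isLittleO_sub_comp_arcsinSqrt (F := fun τ => (α τ).lnDiag m) hδ hr hFG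
      hlim).congr_left fun τ => ?_
    rw [hS.tsum_eq]
    push_cast
    ring
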